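/- **Tilings.** A tile in $\mathbb R^d$ is a connected bounded subset of $\mathbb R^d$ which is the closure of its interior, possibly carrying a decoration. A tiling $\mathcal T$ is an infinite set of tiles which cover $\mathbb R^d$ and overlap at most at their boundaries. Let $\mathcal M=\mathcal M_{\rm II}(\mathcal T)$ be the set of *doubly pointed pattern classes*: translation classes of finite subsets (patterns) $P$ of $\mathcal T$ together with an ordered pair $(s,t)$ of tiles of $P$. Two classes are composable, $a\vdash b$, if they have representatives $(P,s,t)$, $(Q,t,u)$ in $\mathcal T$ sharing the tile $t$; then $ab$ is the class of $(P\cup Q,s,u)$. The inverse of the class of $(P,s,t)$ is the class of $(P,t,s)$. $\mathcal T$ is of *finite type* if only finitely many elements of $\mathcal M$ consist of exactly two tiles and cover a connected set. **Almost-groupoids.** An almost-groupoid is a set $\Gamma$ with a partially defined associative multiplication in which every $a$ has a unique inverse $a^{-1}$, i.e. a unique $x$ with $axa=a$, $xax=x$ (equivalently, $\Gamma\cup\{0\}$ is an inverse semigroup with zero, undefined products being $0$); $\mathcal M$ is one. Units are the elements $xx^{-1}$, and $x\preceq y$ means $xx^{-1}=xy^{-1}$. Let $\widetilde\Gamma$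 be the set of decreasing sequences $x_0\succeq x_1\succeq\cdots$ in $\Gamma$, pre-ordered by $(x_n)\preceq(y_n)$ iff $\forall n\,\exists m:\ x_m\preceq y_n$, modulo the associated equivalence relation. $\mathcal R(\Gamma)$ is the set of minimal elements of $\widetilde\Gamma$, with the partial multiplication induced by point-wise multiplication of sequences and with the topology generated by the sets $\{\tilde y\in\mathcal R(\Gamma):\tilde y\preceq c\}$, $c\in\Gamma$ (elements of $\Gamma$ being regarded as constant sequences). A decreasing sequence is *approximating* if its class is minimal. An isomorphism $\mathcal R(\Gamma)\to\mathcal R(\Gamma')$ is a homeomorphism which preserves composability and products in both directions. **Local derivation rules.** A local derivation rule from $\Gamma$ to $\Gamma'$ is a map $\hat\varphi:\mathcal C\to\Gamma'$ on a finite subset $\mathcal C=\mathcal C^{-1}\subset\Gamma$ such that, for $c,c_1,\dots,c_n\in\mathcal C$: (E1) $\hat\varphi(c^{-1})=\hat\varphi(c)^{-1}$; (E2) if $c_1\cdots c_n$ is defined then so is $\hat\varphi(c_1)\cdots\hat\varphi(c_n)$; (E3) if $c_1\cdots c_n$ is a unit then so is $\hat\varphi(c_1)\cdots\hat\varphi(c_n)$;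 and such that, with $\langle\mathcal C\rangle$ the set of all defined products of elements of $\mathcal C$, for every $c\in\Gamma$ the sets $$\Phi(c)=\{\hat\varphi(c_1)\cdots\hat\varphi(c_n):c_1\cdots c_n=c,\ c_i\in\mathcal C\},\qquad H(c)=\{c'\in\langle\mathcal C\rangle:c'\succeq c\}$$ are finite and lower directed, and the induced map $$\varphi:D(\varphi)=\{c\in\Gamma:\exists c'\in\langle\mathcal C\rangle,\ c\preceq c'\}\to\Gamma',\qquad \varphi(c)=\min\Phi(\min H(c)),$$ is an approximating prehomomorphism: it commutes with inversion, $x\vdash y$ implies $\varphi(x)\vdash\varphi(y)$ and $\varphi(xy)\preceq\varphi(x)\varphi(y)$, and it maps approximating sequences to approximating sequences. Then $\mathcal R(\varphi)$ maps the class of an approximating sequence $(c_n)$ in $D(\varphi)$ to the class of $(\varphi(c_n))$. **Topological equivalence.** $\Gamma$ and $\Gamma'$ are *topologically equivalent* if there are local derivation rules $\hat\varphi$ from $\Gamma$ to $\Gamma'$ and $\hat\psi$ from $\Gamma'$ to $\Gamma$, with induced maps $\varphi,\psi$, such that, with $D=D(\psi\circ\varphi)=\{c\in D(\varphi):\varphi(c)\in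 D(\psi)\}$, 1. every element of $\Gamma$ has a smaller element in $D$, 2. every element of $\mathcal R(\Gamma)$ is the class of a sequence in $D$ (that is, $\mathcal R(D)=\mathcal R(\Gamma)$), 3. $\psi(\varphi(c))$ and $c$ have a common lower bound in $\Gamma$ for every $c\in D$, and the same holds with $(\Gamma,\varphi)$ and $(\Gamma',\psi)$ interchanged. **Theorem.** Let $\mathcal T$ and $\mathcal T'$ be tilings of finite type (possibly of different dimensions). Then $\mathcal M_{\rm II}(\mathcal T)$ and $\mathcal M_{\rm II}(\mathcal T')$ are topologically equivalent if and only if the topological groupoids $\mathcal R(\mathcal M_{\rm II}(\mathcal T))$ and $\mathcal R(\mathcal M_{\rm II}(\mathcal T'))$ are isomorphic. Moreover, every isomorphism $f:\mathcal R(\mathcal M_{\rm II}(\mathcal T))\to\mathcal R(\mathcal M_{\rm II}(\mathcal T'))$ is locally defined: there is a local derivation rule from $\mathcal M_{\rm II}(\mathcal T)$ to $\mathcal M_{\rm II}(\mathcal T')$ whose induced map $\varphi$ satisfies $\mathcal R(D(\varphi))=\mathcal R(\mathcal M_{\rm II}(\mathcal T))$ and $\mathcal R(\varphi)=f$. -/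

import Mathlib

open scoped Pointwise

universe u v w

namespace TilingGroupoid

/-! ## Almost-groupoids -/

/-- An almost-groupoid: a set with a partially defined associative multiplication and a unique
inverse. `mul x y = some z` says that `x` and `y` are composable with product `z`; `mul x y = none`
says that they are not composable. -/
class AlmostGroupoid (Γ : Type u) where
  mul : Γ → Γ → Option Γ
  inv : Γ → Γ
  assoc : ∀ x y z : Γ,
    (mul x y).bind (fun t => mul t z) = (mul y z).bind (fun t => mul x t)
  mul_inv_mul : ∀ x : Γ, (mul x (inv x)).bind (fun t => mul t x) = some x
  inv_mul_inv : ∀ x : Γ, (mul (inv x) x).bind (fun t => mul t (inv x)) = some (inv x)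
  inv_unique : ∀ a x : Γ, (mul a x).bind (fun t => mul t a) = some a →
    (mul x a).bind (fun t => mul t x) = some x → x = inv a

section InverseSemigroup

variable {S : Type u} [Semigroup S]

theorem idem_mul_idem (i : S → S)
    (h1 : ∀ a : S, a * i a * a = a) (h2 : ∀ a : S, i a * a * i a = i a)
    (hu : ∀ a x : S, a * x * a = a → x * a * x = x → x = i a)
    {e f : S} (he : e * e = e) (hf : f * f = f) :
    (e * f) * (e * f) = e * f := by
  set x := i (e * f) with hx
  have k1 : (e * f) * x * (e * f) = e * f := h1 _
  have k2 : x * (e * f) * x = x := h2 _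
  have k3 : f * x * e = x := by
    refine hu _ _ ?_ ?_
    · calc (e * f) * (f * x * e) * (e * f) = e * (f * f) * x * (e * e) * f := by
            simp only [mul_assoc]
        _ = e * f := by rw [he, hf]; simpa only [mul_assoc] using k1
    · calc f * x * e * (e * f) * (f * x * e) = f * (x * ((e * e) * (f * f)) * x) * e := by
            simp only [mul_assoc]
        _ = f * x * e := by rw [he, hf, k2]
  have k4 : x * x = x := by
    calc x * x = (f * x * e) * (f * x * e) := by rw [k3]
      _ = f * (x * (e * f) * x) * e := by simp only [mul_assoc]
      _ = x := by rw [k2, k3]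
  have k5 : e * f = i x := hu x (e * f) k2 k1
  have k6 : x = i x := hu x x (by rw [k4, k4]) (by rw [k4, k4])
  rw [k5, ← k6, k4]

theorem idem_comm (i : S → S)
    (h1 : ∀ a : S, a * i a * a = a) (h2 : ∀ a : S, i a * a * i a = i a)
    (hu : ∀ a x : S, a * x * a = a → x * a * x = x → x = i a)
    {e f : S} (he : e * e = e) (hf : f * f = f) : e * f = f * e := by
  have a := idem_mul_idem i h1 h2 hu he hf
  have b := idem_mul_idem i h1 h2 hu hf he
  have c : e * f = i (e * f) := hu _ _ (by rw [a, a]) (by rw [a, a])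
  have d : f * e = i (e * f) := by
    refine hu _ _ ?_ ?_
    · calc e * f * (f * e) * (e * f) = e * (f * f) * (e * e) * f := by simp only [mul_assoc]
        _ = e * f := by rw [he, hf]; simpa only [mul_assoc] using a
    · calc f * e * (e * f) * (f * e) = f * (e * e) * (f * f) * e := by simp only [mul_assoc]
        _ = f * e := by rw [he, hf]; simpa only [mul_assoc] using b
  rw [c, ← d]

theorem inv_inv' (i : S → S)
    (h1 : ∀ a : S, a * i a * a = a) (h2 : ∀ a : S, i a * a * i a = i a)
    (hu : ∀ a x : S, a * x * a = a → x * a * x = x → x = i a)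
    (a : S) : i (i a) = a := (hu (i a) a (h2 a) (h1 a)).symm

theorem mul_inv_rev' (i : S → S)
    (h1 : ∀ a : S, a * i a * a = a) (h2 : ∀ a : S, i a * a * i a = i a)
    (hu : ∀ a x : S, a * x * a = a → x * a * x = x → x = i a)
    (x y : S) : i (x * y) = i y * i x := by
  have p : (i x * x) * (i x * x) = i x * x := by rw [← mul_assoc, h2]
  have q : (y * i y) * (y * i y) = y * i y := by rw [← mul_assoc, h1]
  have c := idem_comm i h1 h2 hu p q
  refine (hu _ _ ?_ ?_).symm
  · calc x * y * (i y * i x) * (x * y) = x * ((y * i y) * (i x * x)) * y := by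
          simp only [mul_assoc]
      _ = (x * i x * x) * (y * i y * y) := by rw [← c]; simp only [mul_assoc]
      _ = x * y := by rw [h1, h1]
  · calc i y * i x * (x * y) * (i y * i x) = i y * ((i x * x) * (y * i y)) * i x := by
          simp only [mul_assoc]
      _ = (i y * y * i y) * (i x * x * i x) := by rw [c]; simp only [mul_assoc]
      _ = i y * i x := by rw [h2, h2]

theorem order_trans (i : S → S)
    (h1 : ∀ a : S, a * i a * a = a) (h2 : ∀ a : S, i a * a * i a = i a)
    (hu : ∀ a x : S, a * x * a = a → x * a * x = x → x = i a)
    {x y z : S} (hxy : x * i y = x * i x) (hyz : y * i z = y * i y) :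
    x * i z = x * i x := by
  have key : ∀ {s t : S}, s * i t = s * i s → t * (i s * s) = s := by
    intro s t h
    have h' : i (s * i t) = i (s * i s) := by rw [h]
    rw [mul_inv_rev' i h1 h2 hu, mul_inv_rev' i h1 h2 hu, inv_inv' i h1 h2 hu,
      inv_inv' i h1 h2 hu] at h'
    rw [← mul_assoc, h', h1]
  have hx := key hxy
  have hy := key hyz
  have p : (i x * x) * (i x * x) = i x * x := by rw [← mul_assoc, h2]
  have q : (i y * y) * (i y * y) = i y * y := by rw [← mul_assoc, h2]
  have c := idem_comm i h1 h2 hu p q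
  have hz : z * ((i y * y) * (i x * x)) = x := by rw [← mul_assoc, hy, hx]
  have hxe : x * (i y * y) = x := by
    calc x * (i y * y) = z * ((i y * y) * (i x * x)) * (i y * y) := by rw [hz]
      _ = z * (((i x * x) * (i y * y)) * (i y * y)) := by rw [c]; simp only [mul_assoc]
      _ = z * ((i x * x) * (i y * y)) := by rw [mul_assoc (i x * x), q]
      _ = x := by rw [c, hz]
  have hix : i x = (i x * x) * ((i y * y) * i z) := by
    have ex : i x = i (z * ((i y * y) * (i x * x))) := by rw [hz]
    rw [mul_inv_rev' i h1 h2 hu z, mul_inv_rev' i h1 h2 hu (i y * y),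
      mul_inv_rev' i h1 h2 hu (i y), mul_inv_rev' i h1 h2 hu (i x) x,
      inv_inv' i h1 h2 hu, inv_inv' i h1 h2 hu] at ex
    simpa only [mul_assoc] using ex
  calc x * i z = (x * (i y * y)) * i z := by rw [hxe]
    _ = (x * i x * x) * ((i y * y) * i z) := by rw [h1]; simp only [mul_assoc]
    _ = x * ((i x * x) * ((i y * y) * i z)) := by simp only [mul_assoc]
    _ = x * i x := by rw [← hix]

end InverseSemigroup

namespace AlmostGroupoid

variable {Γ : Type u} [AlmostGroupoid Γ]

/-- The inverse semigroup obtained by adding a zero element, `none`. -/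
@[reducible] def zeroSemigroup (Γ : Type u) [AlmostGroupoid Γ] : Semigroup (Option Γ) where
  mul a b := a.bind fun x => b.bind fun y => mul x y
  mul_assoc a b c := by
    show ((a.bind fun x => b.bind fun y => mul x y).bind fun t => c.bind fun z => mul t z)
      = a.bind fun x => (b.bind fun y => c.bind fun z => mul y z).bind fun t => mul x t
    rcases a with _ | x
    · rfl
    rcases b with _ | y
    · rfl
    rcases c with _ | z
    · simp
    · exact assoc x y z

theorem mul_inv_trans {x y z : Γ} (hxy : mul x (inv y) = mul x (inv x))
    (hyz : mul y (inv z) = mul y (inv y)) : mul x (inv z) = mul x (inv x) := by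
  let _ := zeroSemigroup Γ
  have hs : ∀ a b : Γ, (some a * some b : Option Γ) = mul a b := fun _ _ => rfl
  have hm : ∀ (a : Option Γ) (b : Γ), a * some b = a.bind fun t => mul t b := fun a b => by
    cases a <;> rfl
  have hn : ∀ a : Option Γ, a * none = none := fun a => by cases a <;> rfl
  have hn' : ∀ a : Option Γ, (none : Option Γ) * a = none := fun _ => rfl
  refine order_trans (S := Option Γ) (Option.map inv) ?_ ?_ ?_ (x := some x) (y := some y)
    (z := some z) hxy hyz
  · rintro (_ | a)
    · rfl
    · simp only [Option.map_some, hs, hm, mul_inv_mul]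
  · rintro (_ | a)
    · rfl
    · simp only [Option.map_some, hs, hm, inv_mul_inv]
  · rintro (_ | a) (_ | b) p q
    · rfl
    · simp [hn, hn'] at q
    · simp [hn, hn'] at p
    · simp only [hs, hm] at p q
      rw [Option.map_some, inv_unique a b p q]

/-- The order of an almost-groupoid: `x ≤ y` whenever `r(x) = x y⁻¹`, where `r(x) = x x⁻¹`.
(The product `x x⁻¹` is always defined.) -/
instance : Preorder Γ where
  le x y := mul x (inv y) = mul x (inv x)
  le_refl _ := rfl
  le_trans _ _ _ := mul_inv_trans

/-- Units are the elements of the form `x x⁻¹`. -/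
def IsUnitElt (e : Γ) : Prop := ∃ x : Γ, mul x (inv x) = some e

/-- The product `c₁ c₂ ⋯ cₙ` of a nonempty list. It is defined if and only if `c₁, …, cₙ` are
collatable, i.e. `c₁ ⋯ cₖ` and `cₖ₊₁` are composable for all `k`. -/
def listProd : List Γ → Option Γ
  | [] => none
  | c :: l => l.foldlM mul c

end AlmostGroupoid

open AlmostGroupoid

/-! ## The topological groupoid of an almost-groupoid -/

/-- Decreasing sequences in `Γ`. -/
structure DecSeq (Γ : Type u) [AlmostGroupoid Γ] where
  seq : ℕ → Γ
  antitone : Antitone seq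

/-- The pre-order on decreasing sequences: `x ≤ y` whenever for all `n` there is an `m` with
`x m ≤ y n`. -/
instance (Γ : Type u) [AlmostGroupoid Γ] : Preorder (DecSeq Γ) where
  le x y := ∀ n, ∃ m, x.seq m ≤ y.seq n
  le_refl x n := ⟨n, le_refl _⟩
  le_trans x y z hxy hyz n := by
    obtain ⟨m, hm⟩ := hyz n
    obtain ⟨k, hk⟩ := hxy m
    exact ⟨k, le_trans hk hm⟩

/-- Decreasing sequences modulo the equivalence `x ≤ y ∧ y ≤ x`, with the induced partial order. -/
abbrev SeqClass (Γ : Type u) [AlmostGroupoid Γ] : Type u :=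
  Antisymmetrization (DecSeq Γ) (· ≤ ·)

/-- The class of a decreasing sequence. -/
abbrev DecSeq.cls {Γ : Type u} [AlmostGroupoid Γ] (x : DecSeq Γ) : SeqClass Γ :=
  toAntisymmetrization (· ≤ ·) x

/-- Elements of `Γ` as constant sequences. -/
def constClass {Γ : Type u} [AlmostGroupoid Γ] (c : Γ) : SeqClass Γ :=
  DecSeq.cls ⟨fun _ => c, antitone_const⟩

/-- The topology on classes generated by the sets `{y | y ≤ c}`, `c ∈ Γ`. -/
instance (Γ : Type u) [AlmostGroupoid Γ] : TopologicalSpace (SeqClass Γ) :=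
  TopologicalSpace.generateFrom {U | ∃ c : Γ, U = {y | y ≤ constClass c}}

/-- `𝓡(Γ)`: the minimal classes, with the relative topology. -/
abbrev Grpd (Γ : Type u) [AlmostGroupoid Γ] : Type u := {a : SeqClass Γ // IsMin a}

/-- The graph of the partial multiplication of `𝓡(Γ)`, which is induced by the point-wise
multiplication of decreasing sequences: `a` and `b` are composable with product `c`. -/
def Grpd.IsProd {Γ : Type u} [AlmostGroupoid Γ] (a b c : Grpd Γ) : Prop :=
  ∃ x y z : DecSeq Γ, x.cls = a.1 ∧ y.cls = b.1 ∧ z.cls = c.1 ∧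
    ∀ n, mul (x.seq n) (y.seq n) = some (z.seq n)

/-- Isomorphisms of topological groupoids `𝓡(Γ) → 𝓡(Γ')`: homeomorphisms that preserve, in both
directions, composability and products. -/
structure GrpdIso (Γ : Type u) (Γ' : Type v) [AlmostGroupoid Γ] [AlmostGroupoid Γ'] where
  toHomeo : Grpd Γ ≃ₜ Grpd Γ'
  map_isProd : ∀ a b c : Grpd Γ,
    Grpd.IsProd a b c ↔ Grpd.IsProd (toHomeo a) (toHomeo b) (toHomeo c)

/-- A sequence is approximating if it is decreasing and its class is minimal. -/
def IsApproximatingSeq {Γ : Type u} [AlmostGroupoid Γ] (x : ℕ → Γ) : Prop :=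
  ∃ h : Antitone x, IsMin (DecSeq.cls ⟨x, h⟩)

/-- Approximating prehomomorphisms `D ⊆ Γ → Γ'`. -/
structure IsApproximatingPrehom {Γ : Type u} {Γ' : Type v} [AlmostGroupoid Γ] [AlmostGroupoid Γ']
    {D : Set Γ} (φ : D → Γ') : Prop where
  map_inv : ∀ x y : D, (y : Γ) = inv (x : Γ) → φ y = inv (φ x)
  map_mul : ∀ x y z : D, mul (x : Γ) (y : Γ) = some (z : Γ) →
    ∃ t, mul (φ x) (φ y) = some t ∧ φ z ≤ t
  map_approximating : ∀ x : ℕ → D, IsApproximatingSeq (fun n => (x n : Γ)) →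
    IsApproximatingSeq (fun n => φ (x n))

/-! ## Local derivation rules and topological equivalence -/

theorem exists_isLeast_of_directed {α : Type u} [Preorder α] {s : Set α} (hs : s.Finite)
    (hd : DirectedOn (· ≥ ·) s) (hne : s.Nonempty) : ∃ a, IsLeast s a := by
  obtain ⟨a, ha, hmin⟩ := hs.exists_minimal hne
  refine ⟨a, ha, fun b hb => ?_⟩
  obtain ⟨z, hz, hza, hzb⟩ := hd a ha b hb
  exact le_trans (hmin hz hza) hzb

/-- A finite set `C = C⁻¹` of generators together with a map `C → Γ'` which satisfies:
(E1) it commutes with the inverse map, (E2) it maps collatable families to collatable families,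
(E3) if a product of generators is a unit then so is the product of their images. -/
structure RuleData (Γ : Type u) (Γ' : Type v) [AlmostGroupoid Γ] [AlmostGroupoid Γ'] where
  C : Set Γ
  finite : C.Finite
  inv_mem : ∀ c ∈ C, inv c ∈ C
  toFun : C → Γ'
  map_inv : ∀ c : C, toFun ⟨inv (c : Γ), inv_mem c c.2⟩ = inv (toFun c)
  map_collatable : ∀ l : List C, (listProd (l.map Subtype.val)).isSome → (listProd (l.map toFun)).isSome
  map_unit : ∀ (l : List C) (e : Γ) (e' : Γ'), listProd (l.map Subtype.val) = some e →
    listProd (l.map toFun) = some e' → IsUnitElt e → IsUnitElt e'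

namespace RuleData

variable {Γ : Type u} {Γ' : Type v} [AlmostGroupoid Γ] [AlmostGroupoid Γ'] (R : RuleData Γ Γ')

/-- The almost-groupoid `⟨C⟩` generated by `C = C⁻¹`: all defined products of elements of `C`. -/
def gen : Set Γ := {c | ∃ l : List R.C, listProd (l.map Subtype.val) = some c}

/-- The order ideal `I(⟨C⟩)` generated by `⟨C⟩`. -/
def dom : Set Γ := {c | ∃ c' ∈ R.gen, c ≤ c'}

/-- `Φ(c)`: the products of images over all decompositions `c = c₁ ⋯ cₙ` into generators. -/
def Phi (c : Γ) : Set Γ' :=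
  {c' | ∃ l : List R.C, listProd (l.map Subtype.val) = some c ∧ listProd (l.map R.toFun) = some c'}

/-- `H(c)`: the elements of `⟨C⟩` that are larger than `c`. -/
def H (c : Γ) : Set Γ := {c' | c' ∈ R.gen ∧ c ≤ c'}

theorem Phi_nonempty {c : Γ} (hc : c ∈ R.gen) : (R.Phi c).Nonempty := by
  obtain ⟨l, hl⟩ := hc
  have h := R.map_collatable l (by rw [hl]; rfl)
  obtain ⟨c', hc'⟩ := Option.isSome_iff_exists.1 h
  exact ⟨c', l, hl, hc'⟩

/-- All the sets `Φ(c)` and `H(c)` are finite and lower directed. -/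
structure FiniteDirected : Prop where
  finite_Phi : ∀ c, (R.Phi c).Finite
  directed_Phi : ∀ c, DirectedOn (· ≥ ·) (R.Phi c)
  finite_H : ∀ c, (R.H c).Finite
  directed_H : ∀ c, DirectedOn (· ≥ ·) (R.H c)

variable {R}

theorem FiniteDirected.exists_value (h : R.FiniteDirected) (c : R.dom) :
    ∃ c' : Γ', ∃ m : Γ, IsLeast (R.H c) m ∧ IsLeast (R.Phi m) c' := by
  obtain ⟨c, c₁, hc₁, hle⟩ := c
  obtain ⟨m, hm⟩ := exists_isLeast_of_directed (h.finite_H c) (h.directed_H c) ⟨c₁, hc₁, hle⟩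
  obtain ⟨c', hc'⟩ := exists_isLeast_of_directed (h.finite_Phi m) (h.directed_Phi m)
    (R.Phi_nonempty hm.1.1)
  exact ⟨c', m, hm, hc'⟩

/-- The induced map `I(⟨C⟩) → Γ'`, `c ↦ min Φ(min H(c))`. -/
noncomputable def FiniteDirected.value (h : R.FiniteDirected) (c : R.dom) : Γ' :=
  (h.exists_value c).choose

end RuleData

/-- Local derivation rules from `Γ` to `Γ'`: the sets `Φ(c)` and `H(c)` are finite and lower
directed, and the induced map is approximating. -/
structure LocalDerivationRule (Γ : Type u) (Γ' : Type v) [AlmostGroupoid Γ] [AlmostGroupoid Γ']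
    extends RuleData Γ Γ' where
  finiteDirected : toRuleData.FiniteDirected
  approximating : IsApproximatingPrehom finiteDirected.value

namespace LocalDerivationRule

variable {Γ : Type u} {Γ' : Type v} [AlmostGroupoid Γ] [AlmostGroupoid Γ']

/-- The local morphism `φ : I(⟨C⟩) → Γ'` induced by the rule. -/
noncomputable def map (R : LocalDerivationRule Γ Γ') : R.dom → Γ' := R.finiteDirected.value

/-- `f = 𝓡(φ)` for the local morphism `φ` induced by the rule; in particular `𝓡(φ)` is
defined on all of `𝓡(Γ)`. Here `𝓡(φ)` maps the class of `(xₙ)` to the class of `(φ(xₙ))`. -/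
def Induces (R : LocalDerivationRule Γ Γ') (f : Grpd Γ → Grpd Γ') : Prop :=
  ∀ a : Grpd Γ, ∃ (x : ℕ → R.dom) (hx : Antitone fun n => (x n : Γ))
    (hy : Antitone fun n => R.map (x n)),
    DecSeq.cls ⟨fun n => (x n : Γ), hx⟩ = a.1 ∧ DecSeq.cls ⟨fun n => R.map (x n), hy⟩ = (f a).1

/-- The domain of `ψ ∘ φ`. -/
def compDom (R : LocalDerivationRule Γ Γ') (S : LocalDerivationRule Γ' Γ) : Set Γ :=
  {c | ∃ h : c ∈ R.dom, R.map ⟨c, h⟩ ∈ S.dom}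

/-- `S` is a one-sided inverse of `R` on the level of groupoids, i.e. `𝓡(ψ ∘ φ) = id` on all of
`𝓡(Γ)`, expressed in local terms. -/
structure IsLocalLeftInverse (S : LocalDerivationRule Γ' Γ) (R : LocalDerivationRule Γ Γ') :
    Prop where
  /-- Every element of `Γ` has a smaller element in `D(ψ ∘ φ)`. -/
  dense : ∀ c : Γ, ∃ x ∈ compDom R S, x ≤ c
  /-- `𝓡(D(ψ ∘ φ)) = 𝓡(Γ)`. -/
  covers : ∀ a : Grpd Γ, ∃ x : DecSeq Γ, x.cls = a.1 ∧ ∀ n, x.seq n ∈ compDom R S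
  /-- `ψ(φ(c))` and `c` have a lower bound. -/
  lowerBound : ∀ (c : Γ) (h : c ∈ R.dom) (h' : R.map ⟨c, h⟩ ∈ S.dom),
    ∃ z : Γ, z ≤ S.map ⟨R.map ⟨c, h⟩, h'⟩ ∧ z ≤ c

end LocalDerivationRule

/-- Topological equivalence of almost-groupoids. -/
def TopologicallyEquivalent (Γ : Type u) (Γ' : Type v) [AlmostGroupoid Γ] [AlmostGroupoid Γ'] :
    Prop :=
  ∃ (R : LocalDerivationRule Γ Γ') (S : LocalDerivationRule Γ' Γ),
    S.IsLocalLeftInverse R ∧ R.IsLocalLeftInverse S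

/-! ## Tilings and their almost-groupoids -/

/-- A tile in `ℝᵈ`: a connected bounded set which is the closure of its interior, together with a
decoration. -/
@[ext]
structure Tile (d : ℕ) (δ : Type w) where
  carrier : Set (EuclideanSpace ℝ (Fin d))
  decoration : δ
  isConnected : IsConnected carrier
  isBounded : Bornology.IsBounded carrier
  closure_interior : closure (interior carrier) = carrier

variable {d : ℕ} {δ : Type w}

/-- Translation of tiles. -/
noncomputable instance : AddAction (EuclideanSpace ℝ (Fin d)) (Tile d δ) where
  vadd x t :=
    { carrier := x +ᵥ t.carrier
      decoration := t.decoration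
      isConnected := t.isConnected.image _ (continuous_const_vadd x).continuousOn
      isBounded := t.isBounded.vadd x
      closure_interior := by rw [interior_vadd, closure_vadd, t.closure_interior] }
  zero_vadd t := Tile.ext (zero_vadd _ t.carrier) rfl
  add_vadd x y t := Tile.ext (add_vadd x y t.carrier) rfl

/-- A tiling of `ℝᵈ`: an infinite set of tiles which cover `ℝᵈ` and overlap at most at their
boundaries. -/
structure Tiling (d : ℕ) (δ : Type w) where
  tiles : Set (Tile d δ)
  infinite : tiles.Infinite
  covers : (⋃ t ∈ tiles, t.carrier) = Set.univ
  overlap : tiles.Pairwise fun s t => s.carrier ∩ t.carrier ⊆ frontier s.carrier ∩ frontier t.carrier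

/-- Patterns (finite subsets) of a tiling with an ordered pair of chosen tiles. -/
@[ext]
structure PointedPattern (T : Tiling d δ) where
  tiles : Set (Tile d δ)
  fst : Tile d δ
  snd : Tile d δ
  finite : tiles.Finite
  subset : tiles ⊆ T.tiles
  fst_mem : fst ∈ tiles
  snd_mem : snd ∈ tiles

variable {T : Tiling d δ}

/-- `q` is the translate of `p` by `x`. -/
def IsTranslate (x : EuclideanSpace ℝ (Fin d)) (p q : PointedPattern T) : Prop :=
  x +ᵥ p.tiles = q.tiles ∧ x +ᵥ p.fst = q.fst ∧ x +ᵥ p.snd = q.snd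

/-- Equivalence under translation. -/
instance patternSetoid (T : Tiling d δ) : Setoid (PointedPattern T) where
  r p q := ∃ x, IsTranslate x p q
  iseqv :=
    { refl := fun p => ⟨0, zero_vadd _ _, zero_vadd _ _, zero_vadd _ _⟩
      symm := by
        rintro p q ⟨x, h1, h2, h3⟩
        exact ⟨-x, by rw [← h1, neg_vadd_vadd], by rw [← h2, neg_vadd_vadd],
          by rw [← h3, neg_vadd_vadd]⟩
      trans := by
        rintro p q s ⟨x, h1, h2, h3⟩ ⟨y, k1, k2, k3⟩
        exact ⟨y + x, by rw [add_vadd, h1, k1], by rw [add_vadd, h2, k2],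
          by rw [add_vadd, h3, k3]⟩ }

/-- The doubly pointed pattern classes of a tiling: pattern classes together with an ordered pair
of chosen tiles. -/
def PatternClass (T : Tiling d δ) : Type w := Quotient (patternSetoid T)

/-- The translation class of a doubly pointed pattern. -/
def PointedPattern.cls (p : PointedPattern T) : PatternClass T := Quotient.mk _ p

/-- The finite type condition: there are only finitely many connected doubly pointed pattern
classes which consist of two tiles. -/
def Tiling.FiniteType (T : Tiling d δ) : Prop :=
  {c : PatternClass T | ∃ p : PointedPattern T, p.cls = c ∧ p.tiles.ncard = 2 ∧
    IsConnected (⋃ t ∈ p.tiles, t.carrier)}.Finite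

/-- Interchange of the two chosen tiles. -/
def PointedPattern.swap (p : PointedPattern T) : PointedPattern T :=
  ⟨p.tiles, p.snd, p.fst, p.finite, p.subset, p.snd_mem, p.fst_mem⟩

/-- The union of two patterns, with the first chosen tile of the first one and the second chosen
tile of the second one. -/
def PointedPattern.union (p q : PointedPattern T) : PointedPattern T :=
  ⟨p.tiles ∪ q.tiles, p.fst, q.snd, p.finite.union q.finite, Set.union_subset p.subset q.subset,
    Or.inl p.fst_mem, Or.inr q.snd_mem⟩

/-- Two classes are composable if they have representatives in the tiling such that the second
chosen tile of the first one is the first chosen tile of the second one; their product is then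
the class of the union, with the two remaining chosen tiles. -/
def IsProduct (a b c : PatternClass T) : Prop :=
  ∃ p q : PointedPattern T, p.cls = a ∧ q.cls = b ∧ p.snd = q.fst ∧ (p.union q).cls = c

open Classical in
/-- The partial multiplication of pattern classes. -/
noncomputable def patternMul (a b : PatternClass T) : Option (PatternClass T) :=
  if h : ∃ c, IsProduct a b c then some h.choose else none

theorem cls_eq_iff {p q : PointedPattern T} : p.cls = q.cls ↔ ∃ x, IsTranslate x p q :=
  Quotient.eq (r := patternSetoid T)

theorem eq_zero_of_vadd_eq {x : EuclideanSpace ℝ (Fin d)} {t : Tile d δ} (h : x +ᵥ t = t) :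
    x = 0 := by
  by_contra hx
  have hc : x +ᵥ t.carrier = t.carrier := congrArg Tile.carrier h
  obtain ⟨y, hy⟩ := t.isConnected.nonempty
  have hn : ∀ n : ℕ, n • x + y ∈ t.carrier := by
    intro n
    induction n with
    | zero => simpa using hy
    | succ n ih =>
      rw [← hc]
      refine ⟨_, ih, ?_⟩
      simp only [vadd_eq_add]
      rw [succ_nsmul']
      abel
  obtain ⟨r, hr⟩ := t.isBounded.exists_norm_le
  have hpos : 0 < ‖x‖ := norm_pos_iff.2 hx
  obtain ⟨n, hn'⟩ := exists_nat_gt ((r + ‖y‖) / ‖x‖)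
  have h1 := hr _ (hn n)
  have h2 : ‖n • x‖ ≤ ‖n • x + y‖ + ‖y‖ := by
    calc ‖n • x‖ = ‖(n • x + y) - y‖ := by rw [add_sub_cancel_right]
      _ ≤ _ := norm_sub_le _ _
  have h3 : ‖n • x‖ = n * ‖x‖ := by
    rw [← Nat.cast_smul_eq_nsmul ℝ, norm_smul]; simp
  rw [div_lt_iff₀ hpos] at hn'
  linarith

theorem eq_of_vadd_eq_vadd {x y : EuclideanSpace ℝ (Fin d)} {t : Tile d δ}
    (h : x +ᵥ t = y +ᵥ t) : x = y := by
  have : (-y + x) +ᵥ t = t := by rw [add_vadd, h, neg_vadd_vadd]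
  have := eq_zero_of_vadd_eq this
  rw [neg_add_eq_zero] at this
  exact this.symm

theorem isProduct_unique {a b c c' : PatternClass T} (h : IsProduct a b c)
    (h' : IsProduct a b c') : c = c' := by
  obtain ⟨p, q, rfl, rfl, hpq, rfl⟩ := h
  obtain ⟨p', q', hp, hq, hpq', rfl⟩ := h'
  obtain ⟨x, x1, x2, x3⟩ := cls_eq_iff.1 hp.symm
  obtain ⟨y, y1, y2, y3⟩ := cls_eq_iff.1 hq.symm
  have hxy : x = y := eq_of_vadd_eq_vadd (t := q.fst) (by rw [y2, ← hpq', ← x3, hpq])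
  subst hxy
  refine cls_eq_iff.2 ⟨x, ?_, x2, y3⟩
  show x +ᵥ (p.tiles ∪ q.tiles) = p'.tiles ∪ q'.tiles
  rw [Set.vadd_set_union, x1, y1]

theorem patternMul_eq_some {a b c : PatternClass T} :
    patternMul a b = some c ↔ IsProduct a b c := by
  unfold patternMul
  split_ifs with h
  · rw [Option.some_inj]
    exact ⟨fun e => e ▸ h.choose_spec, fun hc => isProduct_unique h.choose_spec hc⟩
  · simp only [false_iff]
    exact fun hc => h ⟨c, hc⟩

/-- A sub-pattern of a pattern moves with it. -/
theorem exists_translate {p q : PointedPattern T} {x : EuclideanSpace ℝ (Fin d)}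
    (h : x +ᵥ p.tiles ⊆ q.tiles) : ∃ p' : PointedPattern T, IsTranslate x p p' :=
  ⟨⟨x +ᵥ p.tiles, x +ᵥ p.fst, x +ᵥ p.snd, p.finite.vadd_set, h.trans q.subset,
    Set.vadd_mem_vadd_set p.fst_mem, Set.vadd_mem_vadd_set p.snd_mem⟩, rfl, rfl, rfl⟩

theorem mul_mul_left {a b c e : PatternClass T} :
    ((patternMul a b).bind fun t => patternMul t c) = some e ↔
      ∃ p q s : PointedPattern T, p.cls = a ∧ q.cls = b ∧ s.cls = c ∧ p.snd = q.fst ∧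
        q.snd = s.fst ∧ ((p.union q).union s).cls = e := by
  rw [Option.bind_eq_some_iff]
  constructor
  · rintro ⟨t, h1, h2⟩
    obtain ⟨p, q, rfl, rfl, hpq, rfl⟩ := patternMul_eq_some.1 h1
    obtain ⟨m, s, hm, rfl, hms, rfl⟩ := patternMul_eq_some.1 h2
    obtain ⟨x, x1, x2, x3⟩ := cls_eq_iff.1 hm.symm
    have hu : (x +ᵥ p.tiles) ∪ (x +ᵥ q.tiles) = m.tiles := by
      rw [← Set.vadd_set_union]; exact x1
    obtain ⟨p', hp⟩ := exists_translate (p := p) (q := m) (x := x)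
      (hu ▸ Set.subset_union_left)
    obtain ⟨q', hq⟩ := exists_translate (p := q) (q := m) (x := x)
      (hu ▸ Set.subset_union_right)
    have hm' : p'.union q' = m := by
      refine PointedPattern.ext ?_ ?_ ?_
      · show p'.tiles ∪ q'.tiles = _
        rw [← hp.1, ← hq.1, hu]
      · exact hp.2.1.symm.trans x2
      · exact hq.2.2.symm.trans x3
    refine ⟨p', q', s, (cls_eq_iff.2 ⟨x, hp⟩).symm, (cls_eq_iff.2 ⟨x, hq⟩).symm, rfl, ?_, ?_, ?_⟩
    · rw [← hp.2.2, ← hq.2.1, hpq]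
    · rw [← hms, ← hm']; rfl
    · rw [hm']
  · rintro ⟨p, q, s, rfl, rfl, rfl, h1, h2, rfl⟩
    exact ⟨(p.union q).cls, patternMul_eq_some.2 ⟨p, q, rfl, rfl, h1, rfl⟩,
      patternMul_eq_some.2 ⟨p.union q, s, rfl, rfl, h2, rfl⟩⟩

theorem mul_mul_right {a b c e : PatternClass T} :
    ((patternMul b c).bind fun t => patternMul a t) = some e ↔
      ∃ p q s : PointedPattern T, p.cls = a ∧ q.cls = b ∧ s.cls = c ∧ p.snd = q.fst ∧
        q.snd = s.fst ∧ ((p.union q).union s).cls = e := by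
  have hassoc : ∀ p q s : PointedPattern T, (p.union q).union s = p.union (q.union s) :=
    fun p q s => PointedPattern.ext (Set.union_assoc _ _ _) rfl rfl
  rw [Option.bind_eq_some_iff]
  constructor
  · rintro ⟨t, h1, h2⟩
    obtain ⟨q, s, rfl, rfl, hqs, rfl⟩ := patternMul_eq_some.1 h1
    obtain ⟨p, m, rfl, hm, hpm, rfl⟩ := patternMul_eq_some.1 h2
    obtain ⟨x, x1, x2, x3⟩ := cls_eq_iff.1 hm.symm
    have hu : (x +ᵥ q.tiles) ∪ (x +ᵥ s.tiles) = m.tiles := by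
      rw [← Set.vadd_set_union]; exact x1
    obtain ⟨q', hq⟩ := exists_translate (p := q) (q := m) (x := x)
      (hu ▸ Set.subset_union_left)
    obtain ⟨s', hs⟩ := exists_translate (p := s) (q := m) (x := x)
      (hu ▸ Set.subset_union_right)
    have hm' : q'.union s' = m := by
      refine PointedPattern.ext ?_ ?_ ?_
      · show q'.tiles ∪ s'.tiles = _
        rw [← hq.1, ← hs.1, hu]
      · exact hq.2.1.symm.trans x2
      · exact hs.2.2.symm.trans x3
    refine ⟨p, q', s', rfl, (cls_eq_iff.2 ⟨x, hq⟩).symm, (cls_eq_iff.2 ⟨x, hs⟩).symm, ?_, ?_, ?_⟩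
    · rw [hpm, ← hm']; rfl
    · rw [← hq.2.2, ← hs.2.1, hqs]
    · rw [hassoc, hm']
  · rintro ⟨p, q, s, rfl, rfl, rfl, h1, h2, rfl⟩
    exact ⟨(q.union s).cls, patternMul_eq_some.2 ⟨q, s, rfl, rfl, h2, rfl⟩,
      patternMul_eq_some.2 ⟨p, q.union s, rfl, rfl, h1, by rw [hassoc]⟩⟩

theorem ncard_eq_of_cls_eq {p q : PointedPattern T} (h : p.cls = q.cls) :
    p.tiles.ncard = q.tiles.ncard := by
  obtain ⟨x, hx, -, -⟩ := cls_eq_iff.1 h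
  rw [← hx]
  exact (Set.ncard_image_of_injective _ (AddAction.injective x)).symm

/-- Patterns with the same class and nested sets of tiles which share a chosen tile agree. -/
theorem eq_of_cls_eq {p q : PointedPattern T} (h : p.cls = q.cls) (hs : p.tiles ⊆ q.tiles)
    (hc : p.fst = q.fst ∨ p.snd = q.snd) : p = q := by
  have ht : p.tiles = q.tiles :=
    Set.eq_of_subset_of_ncard_le hs (ncard_eq_of_cls_eq h).ge q.finite
  obtain ⟨x, -, h2, h3⟩ := cls_eq_iff.1 h
  have hx : x = 0 := by
    rcases hc with hc | hc
    · exact eq_zero_of_vadd_eq (h2.trans hc.symm)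
    · exact eq_zero_of_vadd_eq (h3.trans hc.symm)
  subst hx
  rw [zero_vadd] at h2 h3
  exact PointedPattern.ext ht h2 h3

/-- The inverse of a pattern class: interchange of the chosen tiles. -/
def patternInv (a : PatternClass T) : PatternClass T :=
  Quotient.map (sa := patternSetoid T) (sb := patternSetoid T) PointedPattern.swap
    (fun _ _ ⟨x, h1, h2, h3⟩ => ⟨x, h1, h3, h2⟩) a

theorem patternInv_cls (p : PointedPattern T) : patternInv p.cls = p.swap.cls := rfl

/-- If `a x a = a`, then representatives can be chosen with `x` inside `a`, with interchanged
chosen tiles. -/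
theorem exists_rep_of_mul_mul {a x : PatternClass T}
    (h : ((patternMul a x).bind fun t => patternMul t a) = some a) :
    ∃ p q : PointedPattern T, p.cls = a ∧ q.cls = x ∧ q.tiles ⊆ p.tiles ∧ q.fst = p.snd ∧
      q.snd = p.fst := by
  obtain ⟨p, q, s, rfl, rfl, hs, h1, h2, h3⟩ := mul_mul_left.1 h
  have e := eq_of_cls_eq h3.symm (Set.subset_union_left.trans Set.subset_union_left) (Or.inl rfl)
  have et : p.tiles = p.tiles ∪ q.tiles ∪ s.tiles := congrArg PointedPattern.tiles e
  have es : p.snd = ((p.union q).union s).snd := congrArg PointedPattern.snd e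
  have e' := eq_of_cls_eq hs (Set.subset_union_right.trans et.ge) (Or.inr es.symm)
  refine ⟨p, q, rfl, rfl, (Set.subset_union_right.trans Set.subset_union_left).trans et.ge,
    h1.symm, ?_⟩
  rw [h2, e']

/-- The almost-groupoid of a tiling. -/
noncomputable instance : AlmostGroupoid (PatternClass T) where
  mul := patternMul
  inv := patternInv
  assoc x y z := Option.ext fun e => mul_mul_left.trans mul_mul_right.symm
  mul_inv_mul x := by
    induction x using Quotient.inductionOn with
    | h p =>
      refine mul_mul_left.2 ⟨p, p.swap, p, rfl, rfl, rfl, rfl, rfl, congrArg _ ?_⟩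
      exact PointedPattern.ext (by simp [PointedPattern.union, PointedPattern.swap]) rfl rfl
  inv_mul_inv x := by
    induction x using Quotient.inductionOn with
    | h p =>
      refine mul_mul_left.2 ⟨p.swap, p, p.swap, rfl, rfl, rfl, rfl, rfl, congrArg _ ?_⟩
      exact PointedPattern.ext (by simp [PointedPattern.union, PointedPattern.swap]) rfl rfl
  inv_unique a x h1 h2 := by
    obtain ⟨p, q, rfl, rfl, hs, hf, hg⟩ := exists_rep_of_mul_mul h1
    obtain ⟨q', p', hq, hp, hs', -, -⟩ := exists_rep_of_mul_mul h2
    have hle : p.tiles.ncard ≤ q.tiles.ncard := by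
      rw [← ncard_eq_of_cls_eq hq, ← ncard_eq_of_cls_eq hp]
      exact Set.ncard_le_ncard hs' q'.finite
    have ht : q.tiles = p.tiles := Set.eq_of_subset_of_ncard_le hs hle p.finite
    rw [patternInv_cls]
    exact congrArg _ (PointedPattern.ext ht hf hg)

end TilingGroupoid

/-! An almost-groupoid with a zero added is an inverse semigroup, and its order is the natural
partial order. An element `a` of `𝓡(Γ)` is therefore handled through the lower directed set of all
`c ∈ Γ` above it (`Grpd.Below`): these sets determine `a`, form a basis of the topology and describe
products (`Grpd.isProd_iff`). Pattern classes are moreover unitary: whatever lies above a unit is a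
unit. Hence compatible elements have meets, and `a` lies below every `x` that is compatible with all
elements above `a` (`Grpd.below_of_forall_compatible`). This principle turns mere compatibility into
order throughout.

If the classes are topologically equivalent, both rules have domains large enough to define maps of
groupoids (`exists_represents`). These are continuous and multiplicative, and the common lower bound
of `ψ(φ(c))` and `c` makes them mutually inverse (`leftInverse_of_represents`).

Conversely, let `f` be an isomorphism. The primitive elements, which absorb everything compatible
with them, are the classes of pairs of tiles: they record only a relative position. By continuity
every `a` lies below some `c` such that `f` sends everything below `c` below one primitive element.
Compactness of the set of elements below a class, together with generation by the finitely many
pairs of touching tiles, yields a finite generating set `C = C⁻¹` of such `c`, with primitive values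
`φ̂(c)`. Then (E1)–(E3) follow by evaluating `f` at an element of `𝓡(Γ)` below the product in
question. Directedness of `Φ(c)` comes from (E3), and finiteness of `H(c)` from the finiteness of
the left factors of `c`.

The heart is the finiteness of `Φ(c)`, since `c` may have infinitely many decompositions
(`finite_Phi`). Fix `a` below `c`. A prefix of a decomposition is one of finitely many left factors
`p` of `c`, and below `p` there is only one element with the range of `a`. So the relative position
reached by the image path after that prefix lies in a finite set depending only on `c`. Each
generator contributes a pair of tiles, so the path visits only tiles in finitely many positions, and
finitely many patterns can arise. Finally `𝓡(φ) = f`: every class of `Γ'` is a product of pairs, and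
a sufficiently small value of the rule is absorbed by each of them.

The geometric input is finite local complexity. Finite type restricts only touching tiles, so
isolated tiles must first be excluded; this is a Baire category argument on partitions into
countably many closed sets. Then there are finitely many tiles up to translation, balls of given
radius meet boundedly many of them, and nearby tiles are linked by bounded chains of touching tiles.
From this one gets the finite generation and, by a König type argument, the compactness
(`exists_finite_cover`). -/

namespace TilingGroupoid

/-! ## Inverse semigroups and their natural order -/

/-- An inverse semigroup. -/
class InverseSemigroup (S : Type u) extends Semigroup S, Inv S where
  mul_inv_mul_self : ∀ a : S, a * a⁻¹ * a = a
  inv_mul_mul_inv : ∀ a : S, a⁻¹ * a * a⁻¹ = a⁻¹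
  eq_inv_of : ∀ a x : S, a * x * a = a → x * a * x = x → x = a⁻¹

namespace InverseSemigroup

variable {S : Type u} [InverseSemigroup S] {x y z e f x' y' : S}

theorem idem_mul_comm (he : e * e = e) (hf : f * f = f) : e * f = f * e :=
  idem_comm (·⁻¹) mul_inv_mul_self inv_mul_mul_inv eq_inv_of he hf

theorem idem_mul (he : e * e = e) (hf : f * f = f) : e * f * (e * f) = e * f :=
  idem_mul_idem (·⁻¹) mul_inv_mul_self inv_mul_mul_inv eq_inv_of he hf

theorem inv_inv_eq (x : S) : x⁻¹⁻¹ = x :=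
  inv_inv' (·⁻¹) mul_inv_mul_self inv_mul_mul_inv eq_inv_of x

theorem mul_inv_eq (x y : S) : (x * y)⁻¹ = y⁻¹ * x⁻¹ :=
  mul_inv_rev' (·⁻¹) mul_inv_mul_self inv_mul_mul_inv eq_inv_of x y

theorem mul_inv_idem (x : S) : x * x⁻¹ * (x * x⁻¹) = x * x⁻¹ := by
  rw [← mul_assoc, mul_inv_mul_self]

theorem inv_mul_idem (x : S) : x⁻¹ * x * (x⁻¹ * x) = x⁻¹ * x := by
  rw [← mul_assoc, inv_mul_mul_inv]

theorem inv_of_idem (he : e * e = e) : e⁻¹ = e :=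
  (eq_inv_of e e (by rw [he, he]) (by rw [he, he])).symm

theorem conj_idem (x : S) (he : e * e = e) : x * e * x⁻¹ * (x * e * x⁻¹) = x * e * x⁻¹ := by
  calc x * e * x⁻¹ * (x * e * x⁻¹) = x * (e * (x⁻¹ * x)) * e * x⁻¹ := by simp only [mul_assoc]
    _ = x * x⁻¹ * x * (e * e) * x⁻¹ := by
        rw [idem_mul_comm he (inv_mul_idem x)]; simp only [mul_assoc]
    _ = x * e * x⁻¹ := by rw [mul_inv_mul_self, he]

/-- Moving an idempotent to the left of an element. -/
theorem mul_idem_eq (x : S) (he : e * e = e) : x * e = x * e * x⁻¹ * x := by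
  calc x * e = x * ((x⁻¹ * x) * e) := by rw [← mul_assoc, ← mul_assoc, mul_inv_mul_self]
    _ = x * e * x⁻¹ * x := by rw [idem_mul_comm (inv_mul_idem x) he]; simp only [mul_assoc]

/-- The natural partial order. -/
def NatLE (x y : S) : Prop := ∃ e, e * e = e ∧ x = e * y

theorem natLE_mul_idem (x : S) (he : e * e = e) : NatLE (x * e) x :=
  ⟨_, conj_idem x he, mul_idem_eq x he⟩

theorem natLE_idem_mul (x : S) (he : e * e = e) : NatLE (e * x) x := ⟨e, he, rfl⟩

theorem NatLE.exists_right (h : NatLE x y) : ∃ e, e * e = e ∧ x = y * e := by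
  obtain ⟨e, he, rfl⟩ := h
  have h1 := mul_idem_eq y⁻¹ he
  have h2 : y⁻¹ * e * y * (y⁻¹ * e * y) = y⁻¹ * e * y := by
    simpa only [inv_inv_eq] using conj_idem y⁻¹ he
  refine ⟨y⁻¹ * e * y, h2, ?_⟩
  calc e * y = e * (y * y⁻¹) * y := by rw [mul_assoc, mul_inv_mul_self]
    _ = y * (y⁻¹ * e * y) := by
      rw [idem_mul_comm he (mul_inv_idem y)]; simp only [mul_assoc]

theorem NatLE.trans (h : NatLE x y) (h' : NatLE y z) : NatLE x z := by
  obtain ⟨e, he, rfl⟩ := h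
  obtain ⟨f, hf, rfl⟩ := h'
  exact ⟨e * f, idem_mul he hf, (mul_assoc _ _ _).symm⟩

theorem NatLE.antisymm (h : NatLE x y) (h' : NatLE y x) : x = y := by
  obtain ⟨e, he, hx⟩ := h
  obtain ⟨f, hf, hy⟩ := h'
  have hy' : f * y = y := by rw [hy, ← mul_assoc, hf]
  calc x = e * (f * y) := by rw [hy', hx]
    _ = f * (e * y) := by rw [← mul_assoc, idem_mul_comm he hf, mul_assoc]
    _ = y := by rw [← hx, ← hy]

theorem NatLE.inv (h : NatLE x y) : NatLE x⁻¹ y⁻¹ := by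
  obtain ⟨e, he, rfl⟩ := h
  rw [mul_inv_eq, inv_of_idem he]
  exact natLE_mul_idem _ he

theorem NatLE.mul (h : NatLE x x') (h' : NatLE y y') : NatLE (x * y) (x' * y') := by
  obtain ⟨e, he, rfl⟩ := h
  obtain ⟨f, hf, rfl⟩ := h'
  refine ⟨e * (x' * f * x'⁻¹), idem_mul he (conj_idem x' hf), ?_⟩
  calc e * x' * (f * y') = e * (x' * f) * y' := by simp only [mul_assoc]
    _ = e * (x' * f * x'⁻¹ * x') * y' := by rw [← mul_idem_eq x' hf]
    _ = _ := by simp only [mul_assoc]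

/-- This identifies the order used in the statement with the natural order, for which monotonicity
of products and inverses is accessible. Conversely, inverting the equation gives `y * x⁻¹ = x *
x⁻¹`, so `x` is the restriction of `y` by `x⁻¹ * x`. -/
theorem natLE_iff : NatLE x y ↔ x * y⁻¹ = x * x⁻¹ := by
  constructor
  · rintro ⟨e, he, rfl⟩
    rw [mul_inv_eq, inv_of_idem he]
    calc e * y * y⁻¹ = e * e * (y * y⁻¹) := by rw [he, mul_assoc]
      _ = e * ((y * y⁻¹) * e) := by rw [mul_assoc, idem_mul_comm he (mul_inv_idem y)]
      _ = _ := by simp only [mul_assoc]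
  · intro h
    have h' : y * x⁻¹ = x * x⁻¹ := by
      have := congrArg (·⁻¹) h
      simpa only [mul_inv_eq, inv_inv_eq] using this
    have : x = y * (x⁻¹ * x) := by rw [← mul_assoc, h', mul_inv_mul_self]
    rw [this]
    exact natLE_mul_idem _ (inv_mul_idem x)

/-- An element below a product is a product of a smaller element with the second factor. -/
theorem NatLE.mul_inv_mul_cancel (h : NatLE z (x * y)) : z * y⁻¹ * y = z := by
  obtain ⟨e, he, rfl⟩ := h
  calc e * (x * y) * y⁻¹ * y = e * x * (y * y⁻¹ * y) := by simp only [mul_assoc]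
    _ = _ := by rw [mul_inv_mul_self, mul_assoc]

theorem NatLE.mul_inv_le (h : NatLE z (x * y)) : NatLE (z * y⁻¹) x := by
  obtain ⟨e, he, rfl⟩ := h
  have : e * (x * y) * y⁻¹ = e * (x * (y * y⁻¹)) := by simp only [mul_assoc]
  rw [this]
  exact (natLE_idem_mul _ he).trans (natLE_mul_idem _ (mul_inv_idem y))

end InverseSemigroup

/-! ## Order and multiplication in an almost-groupoid -/

namespace AlmostGroupoid

open InverseSemigroup

variable {Γ : Type u} [AlmostGroupoid Γ] {x y z w x' y' e : Γ}

/-- An almost-groupoid with a zero added is an inverse semigroup. -/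
instance : InverseSemigroup (Option Γ) where
  toSemigroup := zeroSemigroup Γ
  inv := Option.map inv
  mul_inv_mul_self a := by
    cases a with
    | none => rfl
    | some a =>
      have h := mul_inv_mul a
      change ((mul a (inv a)).bind fun t => (some a).bind fun y => mul t y) = _
      simpa using h
  inv_mul_mul_inv a := by
    cases a with
    | none => rfl
    | some a =>
      have h := inv_mul_inv a
      change ((mul (inv a) a).bind fun t => (some (inv a)).bind fun y => mul t y) = _
      simpa using h
  eq_inv_of a x h1 h2 := by
    cases a with
    | none =>
      cases x with
      | none => rfl
      | some x => exact absurd h2 (by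
          change ((Option.bind (Option.bind (some x) _) _)) ≠ _
          simp)
    | some a =>
      cases x with
      | none => exact absurd h1 (by
          change ((Option.bind (Option.bind (some a) _) _)) ≠ _
          simp)
      | some x => exact congrArg some (inv_unique a x h1 h2)

theorem some_mul_some (x y : Γ) : (some x * some y : Option Γ) = mul x y := rfl

theorem inv_some (x : Γ) : (some x : Option Γ)⁻¹ = some (inv x) := rfl

theorem none_mul' (a : Option Γ) : none * a = none := rfl

theorem mul_none' (a : Option Γ) : a * none = none := by cases a <;> rfl

theorem le_iff_natLE : x ≤ y ↔ NatLE (some x) (some y) :=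
  (natLE_iff (x := some x) (y := some y)).symm

theorem exists_of_natLE {a : Option Γ} (h : NatLE (some x) a) : ∃ y, a = some y ∧ x ≤ y := by
  cases a with
  | none =>
    obtain ⟨e, -, h⟩ := h
    rw [mul_none'] at h
    simp at h
  | some y => exact ⟨y, rfl, le_iff_natLE.2 h⟩

theorem eq_of_le_of_le (h : x ≤ y) (h' : y ≤ x) : x = y :=
  Option.some_injective _ ((le_iff_natLE.1 h).antisymm (le_iff_natLE.1 h'))

@[simp] theorem inv_inv_self (x : Γ) : inv (inv x) = x :=
  Option.some_injective _ (inv_inv_eq (some x))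

theorem mul_eq_inv (h : mul x y = some z) : mul (inv y) (inv x) = some (inv z) := by
  have := mul_inv_eq (some x) (some y)
  rw [some_mul_some, h] at this
  exact this.symm

theorem inv_le_inv (h : x ≤ y) : inv x ≤ inv y := le_iff_natLE.2 (le_iff_natLE.1 h).inv

/-- The zero is the least element of the inverse semigroup, so a nonzero product stays nonzero when
the factors grow: composability passes upwards. -/
theorem mul_mono (hx : x ≤ x') (hy : y ≤ y') (h : mul x y = some z) :
    ∃ z', mul x' y' = some z' ∧ z ≤ z' := by
  have := (le_iff_natLE.1 hx).mul (le_iff_natLE.1 hy)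
  rw [some_mul_some, h] at this
  exact exists_of_natLE this

theorem le_of_mul (hx : x ≤ x') (hy : y ≤ y') (h : mul x y = some z) {z' : Γ}
    (h' : mul x' y' = some z') : z ≤ z' := by
  obtain ⟨t, ht, hz⟩ := mul_mono hx hy h
  rw [h'] at ht
  exact (Option.some_injective _ ht) ▸ hz

theorem mul_assoc_left {a b c ab abc : Γ} (h : mul a b = some ab) (h' : mul ab c = some abc) :
    ∃ bc, mul b c = some bc ∧ mul a bc = some abc := by
  have := AlmostGroupoid.assoc a b c
  rw [h, Option.bind_some, h'] at this
  exact Option.bind_eq_some_iff.1 this.symm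

theorem mul_assoc_right {a b c bc abc : Γ} (h : mul b c = some bc) (h' : mul a bc = some abc) :
    ∃ ab, mul a b = some ab ∧ mul ab c = some abc := by
  have := AlmostGroupoid.assoc a b c
  rw [h, Option.bind_some, h'] at this
  exact Option.bind_eq_some_iff.1 this

theorem exists_mul_inv (x : Γ) : ∃ e, mul x (inv x) = some e ∧ mul e x = some x :=
  Option.bind_eq_some_iff.1 (mul_inv_mul x)

theorem exists_inv_mul (x : Γ) : ∃ e, mul (inv x) x = some e ∧ mul x e = some x := by
  obtain ⟨e, he, hx⟩ := exists_mul_inv x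
  exact mul_assoc_left he hx

/-- Dividing an element below a product by the second factor. -/
theorem exists_mul_inv_of_le (h : mul x y = some w) (hz : z ≤ w) :
    ∃ t, mul z (inv y) = some t ∧ t ≤ x ∧ mul t y = some z := by
  have hz' : NatLE (some z) (some x * some y) := by
    rw [some_mul_some, h]; exact le_iff_natLE.1 hz
  have h1 := hz'.mul_inv_mul_cancel
  have h2 := hz'.mul_inv_le
  rw [inv_some, some_mul_some] at h1 h2
  cases ht : mul z (inv y) with
  | none => rw [ht, none_mul'] at h1; simp at h1
  | some t => rw [ht] at h1 h2; exact ⟨t, rfl, le_iff_natLE.2 h2, h1⟩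

theorem isUnitElt_iff : IsUnitElt e ↔ mul e e = some e := by
  constructor
  · rintro ⟨x, hx⟩
    have := mul_inv_idem (some x)
    rwa [inv_some, some_mul_some, hx] at this
  · intro h
    refine ⟨e, ?_⟩
    have : (some e : Option Γ)⁻¹ = some e := inv_of_idem h
    rwa [Option.some_injective _ this]

theorem IsUnitElt.inv_eq (he : IsUnitElt e) : inv e = e :=
  Option.some_injective _ (inv_of_idem (S := Option Γ) (e := some e) (isUnitElt_iff.1 he))

theorem IsUnitElt.mul_le (he : IsUnitElt e) (h : mul e x = some z) : z ≤ x :=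
  le_iff_natLE.2 ⟨some e, isUnitElt_iff.1 he, h.symm⟩

theorem IsUnitElt.mul_le_left (he : IsUnitElt e) (h : mul x e = some z) : z ≤ x := by
  have := natLE_mul_idem (some x) (e := some e) (isUnitElt_iff.1 he)
  rw [some_mul_some, h] at this
  exact le_iff_natLE.2 this

theorem isUnitElt_of_inv_mul (h : mul (inv x) x = some e) : IsUnitElt e :=
  ⟨inv x, by rwa [inv_inv_self]⟩

/-- If `x ≤ y` then `x = (x x⁻¹) y`. -/
theorem mul_inv_mul_of_le (h : x ≤ y) (he : mul x (inv x) = some e) : mul e y = some x := by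
  obtain ⟨f, hf, hx⟩ := le_iff_natLE.1 h
  have h1 : some x * (some x)⁻¹ * some y = some x := by
    rw [← natLE_iff.1 (le_iff_natLE.1 h)]
    refine NatLE.mul_inv_mul_cancel (x := f) ?_
    rw [← hx]
    exact le_iff_natLE.1 le_rfl
  rw [inv_some, some_mul_some, he] at h1
  exact h1

/-- If `x ≤ y` then `x = y (x⁻¹ x)`. -/
theorem exists_mul_eq_of_le (h : x ≤ y) : ∃ e, IsUnitElt e ∧ mul y e = some x := by
  obtain ⟨e, he, hx⟩ := (le_iff_natLE.1 h).exists_right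
  cases e with
  | none => rw [mul_none'] at hx; simp at hx
  | some e => exact ⟨e, isUnitElt_iff.2 he, hx.symm⟩

theorem IsUnitElt.of_le (he : IsUnitElt e) (h : x ≤ e) : IsUnitElt x := by
  rw [isUnitElt_iff] at he ⊢
  obtain ⟨f, hf, hx⟩ := le_iff_natLE.1 h
  have := idem_mul hf (f := some e) he
  rw [← hx] at this
  exact this

/-- If `w` is below a product then `w w⁻¹` is below the range of the first factor. -/
theorem range_le_of_le_mul {ew ex : Γ} (h : mul x y = some z) (hw : w ≤ z)
    (hew : mul w (inv w) = some ew) (hex : mul x (inv x) = some ex) : ew ≤ ex := by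
  obtain ⟨t, ht, htx, hty⟩ := exists_mul_inv_of_le h hw
  obtain ⟨et, het, -⟩ := exists_mul_inv t
  have h1 : et ≤ ex := le_of_mul htx (inv_le_inv htx) het hex
  refine le_trans ?_ h1
  have hy' := mul_eq_inv hty
  obtain ⟨r, hr, hr'⟩ := mul_assoc_left hty hew
  obtain ⟨s, hs, hs'⟩ := mul_assoc_right hy' hr
  have hu : IsUnitElt s := ⟨y, hs⟩
  exact le_of_mul le_rfl (hu.mul_le hs') hr' het

/-- Elements with a common lower bound. -/
def Compatible (x y : Γ) : Prop := ∃ z, z ≤ x ∧ z ≤ y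

theorem Compatible.symm (h : Compatible x y) : Compatible y x := by
  obtain ⟨z, h1, h2⟩ := h
  exact ⟨z, h2, h1⟩

theorem Compatible.mono (h : Compatible x y) (hx : x ≤ x') (hy : y ≤ y') : Compatible x' y' := by
  obtain ⟨z, h1, h2⟩ := h
  exact ⟨z, h1.trans hx, h2.trans hy⟩

/-- Every element above a unit is a unit. -/
def IsUnitary (Γ : Type u) [AlmostGroupoid Γ] : Prop :=
  ∀ e x : Γ, IsUnitElt e → e ≤ x → IsUnitElt x

/-- For a common lower bound `z`, the product `x y⁻¹` is above `z z⁻¹`, hence a unit. Thus `x y⁻¹ y`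
restricts `y` by a unit on the left and `x` by the unit `y⁻¹ y` on the right. `le_meet` shows that
it is the greatest lower bound. -/
theorem IsUnitary.exists_meet (hΓ : IsUnitary Γ) (h : Compatible x y) :
    ∃ t w, mul x (inv y) = some t ∧ mul t y = some w ∧ w ≤ x ∧ w ≤ y := by
  obtain ⟨z, hx, hy⟩ := h
  obtain ⟨e, he, hez⟩ := exists_mul_inv z
  obtain ⟨t, ht, het⟩ := mul_mono hx (inv_le_inv hy) he
  have htu := hΓ e t ⟨z, he⟩ het
  obtain ⟨w, hw, -⟩ := mul_mono het hy hez
  refine ⟨t, w, ht, hw, ?_, htu.mul_le hw⟩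
  obtain ⟨s, hs, hxs⟩ := mul_assoc_left ht hw
  exact (isUnitElt_of_inv_mul hs).mul_le_left hxs

/-! ### Products of lists -/

theorem listProd_singleton (c : Γ) : listProd [c] = some c := rfl

theorem listProd_append_singleton {l : List Γ} (hl : l ≠ []) (c : Γ) :
    listProd (l ++ [c]) = listProd l * some c := by
  cases l with
  | nil => exact absurd rfl hl
  | cons a l =>
    change (l ++ [c]).foldlM mul a = (l.foldlM mul a).bind fun t => mul t c
    rw [List.foldlM_append]
    congr 1
    funext t
    simp

theorem ne_nil_of_listProd {l : List Γ} {c : Γ} (h : listProd l = some c) : l ≠ [] := by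
  rintro rfl
  simp [listProd] at h

theorem listProd_append {l l' : List Γ} (hl : l ≠ []) (hl' : l' ≠ []) :
    listProd (l ++ l') = listProd l * listProd l' := by
  induction l' using List.reverseRecOn with
  | nil => exact absurd rfl hl'
  | append_singleton l' c ih =>
    by_cases h : l' = []
    · subst h
      exact listProd_append_singleton hl c
    · rw [← List.append_assoc, listProd_append_singleton (by simp [hl]), ih h,
        listProd_append_singleton h, mul_assoc]

theorem listProd_append_eq {l l' : List Γ} {c c' : Γ} (h : listProd l = some c)
    (h' : listProd l' = some c') : listProd (l ++ l') = mul c c' := by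
  rw [listProd_append (ne_nil_of_listProd h) (ne_nil_of_listProd h'), h, h', some_mul_some]

theorem listProd_append_singleton_eq_some {l : List Γ} (hl : l ≠ []) {a c : Γ}
    (h : listProd (l ++ [a]) = some c) : ∃ b, listProd l = some b ∧ mul b a = some c := by
  rw [listProd_append_singleton hl] at h
  cases hb : listProd l with
  | none => rw [hb, none_mul'] at h; simp at h
  | some b => rw [hb] at h; exact ⟨b, rfl, h⟩

theorem listProd_reverse_inv (l : List Γ) : listProd (l.reverse.map inv) = (listProd l)⁻¹ := by
  induction l using List.reverseRecOn with
  | nil => rfl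
  | append_singleton l c ih =>
    by_cases h : l = []
    · subst h; rfl
    · rw [List.reverse_append, listProd_append_singleton h, mul_inv_eq, ← ih, inv_some,
        List.map_append, listProd_append (by simp) (by simp [h])]
      rfl

end AlmostGroupoid

end TilingGroupoid

namespace TilingGroupoid

open AlmostGroupoid

/-! ## Decreasing sequences and the groupoid `𝓡(Γ)` -/

section

variable {Γ : Type u} [AlmostGroupoid Γ]

theorem cls_le_cls {x y : DecSeq Γ} : x.cls ≤ y.cls ↔ x ≤ y :=
  toAntisymmetrization_le_toAntisymmetrization_iff

theorem cls_eq_cls {x y : DecSeq Γ} (h : x ≤ y) (h' : y ≤ x) : x.cls = y.cls :=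
  le_antisymm (cls_le_cls.2 h) (cls_le_cls.2 h')

theorem cls_le_constClass {x : DecSeq Γ} {c : Γ} : x.cls ≤ constClass c ↔ ∃ m, x.seq m ≤ c :=
  cls_le_cls.trans ⟨fun h => h 0, fun h _ => h⟩

theorem exists_cls_eq (a : SeqClass Γ) : ∃ x : DecSeq Γ, x.cls = a :=
  ⟨ofAntisymmetrization _ a, toAntisymmetrization_ofAntisymmetrization _ a⟩

theorem isMin_cls {x : DecSeq Γ} : IsMin x.cls ↔ ∀ y, y ≤ x → x ≤ y := by
  constructor
  · exact fun h y hy => cls_le_cls.1 (h (cls_le_cls.2 hy))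
  · intro h b hb
    obtain ⟨y, rfl⟩ := exists_cls_eq b
    exact cls_le_cls.2 (h y (cls_le_cls.1 hb))

/-- A sequence can be replaced by an equivalent one which is point-wise below a larger
sequence. -/
theorem DecSeq.exists_pointwise_le {x y : DecSeq Γ} (h : x ≤ y) :
    ∃ x' : DecSeq Γ, (∀ n, x'.seq n ≤ y.seq n) ∧ x'.cls = x.cls := by
  choose f hf using h
  -- The reindexing must be monotone, dominate `f n`, and tend to infinity so that the class is
  -- unchanged; the term `n` in the maximum secures the last point.
  have hm : Monotone fun n => max n ((Finset.range (n + 1)).sup f) := fun a b hab =>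
    max_le_max hab (Finset.sup_mono (Finset.range_mono (by omega)))
  refine ⟨⟨fun n => x.seq (max n ((Finset.range (n + 1)).sup f)),
    fun a b hab => x.antitone (hm hab)⟩, fun n => ?_, cls_eq_cls ?_ ?_⟩
  · refine le_trans (x.antitone ?_) (hf n)
    exact (Finset.le_sup (f := f) (Finset.self_mem_range_succ n)).trans (le_max_right _ _)
  · exact fun n => ⟨n, x.antitone (le_max_left _ _)⟩
  · exact fun n => ⟨_, le_rfl⟩

/-- If the product of a minimal sequence with another one is defined, then it is minimal. -/
theorem isMin_cls_of_mul {w y z : DecSeq Γ} (hw : IsMin w.cls)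
    (h : ∀ n, mul (w.seq n) (y.seq n) = some (z.seq n)) : IsMin z.cls := by
  rw [isMin_cls] at hw ⊢
  intro v hv
  obtain ⟨v', hv', hvv'⟩ := v.exists_pointwise_le hv
  -- Dividing a sequence below `z` by `y` gives one below `w`; minimality of `w` applies to it, and
  -- multiplying back by `y` gives the claim for `z`.
  choose t ht htw hty using fun n => exists_mul_inv_of_le (h n) (hv' n)
  have hta : Antitone t := fun a b hab =>
    le_of_mul (v'.antitone hab) (inv_le_inv (y.antitone hab)) (ht b) (ht a)
  have hwt := hw ⟨t, hta⟩ fun n => ⟨n, htw n⟩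
  refine le_trans (b := v') (fun n => ?_) (cls_le_cls.1 hvv'.le)
  obtain ⟨k, hk⟩ := hwt n
  exact ⟨max k n, le_of_mul ((w.antitone (le_max_left _ _)).trans hk)
    (y.antitone (le_max_right _ _)) (h _) (hty n)⟩

/-- The point-wise inverse of a decreasing sequence. -/
def DecSeq.inverse (x : DecSeq Γ) : DecSeq Γ :=
  ⟨fun n => inv (x.seq n), fun _ _ h => inv_le_inv (x.antitone h)⟩

theorem DecSeq.inverse_inverse (x : DecSeq Γ) : x.inverse.inverse = x := by
  simp [DecSeq.inverse]

theorem DecSeq.inverse_le_inverse {x y : DecSeq Γ} (h : x ≤ y) : x.inverse ≤ y.inverse :=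
  fun n => (h n).imp fun _ => inv_le_inv

theorem isMin_cls_inverse {x : DecSeq Γ} (h : IsMin x.cls) : IsMin x.inverse.cls := by
  rw [isMin_cls] at h ⊢
  intro y hy
  have h1 := DecSeq.inverse_le_inverse hy
  rw [x.inverse_inverse] at h1
  have h2 := DecSeq.inverse_le_inverse (h _ h1)
  rwa [y.inverse_inverse] at h2

/-! ### Elements of `𝓡(Γ)` as lower directed sets in `Γ`. -/

namespace Grpd

/-- The element `a` of `𝓡(Γ)` lies below `c ∈ Γ`. -/
def Below (a : Grpd Γ) (c : Γ) : Prop := a.1 ≤ constClass c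

variable {a b c d : Grpd Γ} {x y z p : Γ}

theorem exists_seq (a : Grpd Γ) : ∃ x : DecSeq Γ, x.cls = a.1 := exists_cls_eq a.1

theorem below_iff {s : DecSeq Γ} (hs : s.cls = a.1) : a.Below x ↔ ∃ m, s.seq m ≤ x := by
  rw [Below, ← hs, cls_le_constClass]

theorem le_cls_iff {s : DecSeq Γ} : a.1 ≤ s.cls ↔ ∀ n, a.Below (s.seq n) := by
  obtain ⟨t, ht⟩ := a.exists_seq
  simp only [below_iff ht]
  rw [← ht, cls_le_cls]
  rfl

theorem cls_eq_of_le {s : DecSeq Γ} (h : s.cls ≤ a.1) : s.cls = a.1 := le_antisymm h (a.2 h)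

theorem Below.mono (h : a.Below x) (hxy : x ≤ y) : a.Below y :=
  le_trans h (cls_le_cls.2 fun _ => ⟨0, hxy⟩)

theorem exists_below (a : Grpd Γ) : ∃ x, a.Below x := by
  obtain ⟨s, hs⟩ := a.exists_seq
  exact ⟨s.seq 0, (below_iff hs).2 ⟨0, le_rfl⟩⟩

theorem Below.exists_le_le (hx : a.Below x) (hy : a.Below y) :
    ∃ z, a.Below z ∧ z ≤ x ∧ z ≤ y := by
  obtain ⟨s, hs⟩ := a.exists_seq
  obtain ⟨m, hm⟩ := (below_iff hs).1 hx
  obtain ⟨n, hn⟩ := (below_iff hs).1 hy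
  exact ⟨s.seq (max m n), (below_iff hs).2 ⟨_, le_rfl⟩,
    (s.antitone (le_max_left _ _)).trans hm, (s.antitone (le_max_right _ _)).trans hn⟩

theorem Below.compatible (hx : a.Below x) (hy : a.Below y) : Compatible x y := by
  obtain ⟨z, -, h⟩ := hx.exists_le_le hy
  exact ⟨z, h⟩

theorem exists_below_lower_bound (a : Grpd Γ) {F : Set Γ} (hF : F.Finite)
    (h : ∀ e ∈ F, a.Below e) : ∃ z, a.Below z ∧ ∀ e ∈ F, z ≤ e := by
  induction F, hF using Set.Finite.induction_on with
  | empty => exact (a.exists_below).imp fun z hz => ⟨hz, by simp⟩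
  | @insert e F _ _ ih =>
    obtain ⟨z, hz, hzF⟩ := ih fun e he => h e (Or.inr he)
    obtain ⟨w, hw, hwe, hwz⟩ := (h e (Or.inl rfl)).exists_le_le hz
    refine ⟨w, hw, ?_⟩
    rintro e' (rfl | he')
    · exact hwe
    · exact hwz.trans (hzF _ he')

theorem eq_of_forall_below (h : ∀ x, b.Below x → a.Below x) : a = b := by
  obtain ⟨s, hs⟩ := b.exists_seq
  have : a.1 ≤ b.1 := by
    rw [← hs, le_cls_iff]
    exact fun n => h _ ((below_iff hs).2 ⟨n, le_rfl⟩)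
  exact Subtype.ext (le_antisymm this (b.2 this))

/-- This removes the choice of sequences. In the converse direction the products of representatives
of `a` and `b` form a sequence above `c` that need not represent `c`; it is replaced by a smaller
representative of `c`, and dividing by the second factor changes the representative of `a` without
changing its class, by minimality. -/
theorem isProd_iff : IsProd a b c ↔
    ∀ x y, a.Below x → b.Below y → ∃ z, mul x y = some z ∧ c.Below z := by
  constructor
  · rintro ⟨s, t, r, hs, ht, hr, h⟩ x y hx hy
    obtain ⟨m, hm⟩ := (below_iff hs).1 hx
    obtain ⟨n, hn⟩ := (below_iff ht).1 hy
    obtain ⟨z, hz, hle⟩ := mul_mono ((s.antitone (le_max_left m n)).trans hm)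
      ((t.antitone (le_max_right m n)).trans hn) (h _)
    exact ⟨z, hz, (below_iff hr).2 ⟨_, hle⟩⟩
  · intro h
    obtain ⟨s, hs⟩ := a.exists_seq
    obtain ⟨t, ht⟩ := b.exists_seq
    obtain ⟨r, hr⟩ := c.exists_seq
    choose w hw hcw using fun n => h (s.seq n) (t.seq n) ((below_iff hs).2 ⟨n, le_rfl⟩)
      ((below_iff ht).2 ⟨n, le_rfl⟩)
    have hwa : Antitone w := fun i j hij =>
      le_of_mul (s.antitone hij) (t.antitone hij) (hw j) (hw i)
    have hrw : r ≤ ⟨w, hwa⟩ := by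
      rw [← cls_le_cls, hr, le_cls_iff]
      exact hcw
    obtain ⟨r', hr', hrr'⟩ := r.exists_pointwise_le hrw
    choose q hq hqs hqt using fun n => exists_mul_inv_of_le (hw n) (hr' n)
    have hqa : Antitone q := fun i j hij =>
      le_of_mul (r'.antitone hij) (inv_le_inv (t.antitone hij)) (hq j) (hq i)
    refine ⟨⟨q, hqa⟩, t, r', cls_eq_of_le ?_, ht, hrr'.trans hr, hqt⟩
    rw [← hs]
    exact cls_le_cls.2 fun n => ⟨n, hqs n⟩

/-- Factorisation of an element below a product. -/
theorem Below.exists_factors (h : c.Below z) (hz : mul x y = some z) :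
    ∃ a b : Grpd Γ, a.Below x ∧ b.Below y ∧ IsProd a b c := by
  obtain ⟨s, hs⟩ := c.exists_seq
  have hsz : s ≤ ⟨fun _ => z, antitone_const⟩ := fun _ => (below_iff hs).1 h
  obtain ⟨w, hwz, hws⟩ := s.exists_pointwise_le hsz
  choose t ht htx hty using fun n => exists_mul_inv_of_le hz (hwz n)
  have hta : Antitone t := fun i j hij => le_of_mul (w.antitone hij) le_rfl (ht j) (ht i)
  have htm : IsMin (DecSeq.cls ⟨t, hta⟩) :=
    isMin_cls_of_mul (w := w) (y := ⟨fun _ => inv y, antitone_const⟩)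
      (by rw [hws, hs]; exact c.2) ht
  -- The second factor is `t⁻¹ w`. Since `w = t y`, it equals `(t⁻¹ t) y` and so is below `y`.
  have hq : ∀ n, ∃ q, mul (inv (t n)) (w.seq n) = some q ∧ q ≤ y ∧ mul (t n) q = some (w.seq n) := by
    intro n
    obtain ⟨e, he, het⟩ := exists_inv_mul (t n)
    obtain ⟨q, hq, hq'⟩ := mul_assoc_left het (hty n)
    obtain ⟨r, hr, hr'⟩ := mul_assoc_left he hq
    rw [hty n, Option.some_inj] at hr
    exact ⟨q, hr ▸ hr', (isUnitElt_of_inv_mul he).mul_le hq, hq'⟩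
  choose q hq hqy htq using hq
  have hqa : Antitone q := fun i j hij =>
    le_of_mul (inv_le_inv (hta hij)) (w.antitone hij) (hq j) (hq i)
  have hqm : IsMin (DecSeq.cls ⟨q, hqa⟩) :=
    isMin_cls_of_mul (isMin_cls_inverse htm) hq
  exact ⟨⟨_, htm⟩, ⟨_, hqm⟩, cls_le_constClass.2 ⟨0, htx 0⟩, cls_le_constClass.2 ⟨0, hqy 0⟩,
    _, _, w, rfl, rfl, hws.trans hs, htq⟩

/-- A sequence of elements of a lower set `D`, given that some element of `D` is above `a`. -/
theorem exists_seq_mem {D : Set Γ} (hD : ∀ x ∈ D, ∀ y ≤ x, y ∈ D)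
    {a : Grpd Γ} (h : ∃ x ∈ D, a.Below x) : ∃ s : DecSeq Γ, s.cls = a.1 ∧ ∀ n, s.seq n ∈ D := by
  obtain ⟨x, hx, hax⟩ := h
  obtain ⟨s, hs⟩ := a.exists_seq
  obtain ⟨t, ht, hts⟩ := s.exists_pointwise_le (y := ⟨fun _ => x, antitone_const⟩)
    (fun _ => (Grpd.below_iff hs).1 hax)
  exact ⟨t, hts.trans hs, fun n => hD x hx _ (ht n)⟩

/-- The range unit of `b` is the range unit of `a`, expressed by elements of `Γ`. -/
def SameRange (a b : Grpd Γ) : Prop :=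
  ∀ x, b.Below x → ∃ y ex ey, a.Below y ∧ mul x (inv x) = some ex ∧ mul y (inv y) = some ey ∧
    ey ≤ ex

theorem SameRange.refl (a : Grpd Γ) : SameRange a a := fun x hx => by
  obtain ⟨e, he, -⟩ := exists_mul_inv x
  exact ⟨x, e, e, hx, he, he, le_rfl⟩

theorem SameRange.trans (h : SameRange a b) (h' : SameRange b c) : SameRange a c := by
  intro x hx
  obtain ⟨y, ex, ey, hy, hex, hey, hle⟩ := h' x hx
  obtain ⟨z, ey', ez, hz, hey', hez, hle'⟩ := h y hy
  rw [hey, Option.some_inj] at hey'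
  subst hey'
  exact ⟨z, ex, ez, hz, hex, hez, hle'.trans hle⟩

theorem IsProd.sameRange (h : IsProd b d a) : SameRange a b := by
  intro x hx
  obtain ⟨y, hy⟩ := d.exists_below
  obtain ⟨z, hz, haz⟩ := isProd_iff.1 h x y hx hy
  obtain ⟨ex, hex, -⟩ := exists_mul_inv x
  obtain ⟨ez, hez, -⟩ := exists_mul_inv z
  exact ⟨z, ex, ez, haz, hex, hez, range_le_of_le_mul hz le_rfl hez hex⟩

/-- In a unitary almost-groupoid, an element of `𝓡(Γ)` is below everything that is compatible
with all elements above it. -/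
theorem below_of_forall_compatible (hΓ : IsUnitary Γ)
    (h : ∀ z, a.Below z → Compatible z x) : a.Below x := by
  obtain ⟨s, hs⟩ := a.exists_seq
  -- The meets `w n` of `s n` and `x` decrease and lie below `s`, so by minimality they still
  -- represent `a`; and all of them are below `x`.
  choose t w ht hw hws hwx using fun n =>
    hΓ.exists_meet (h (s.seq n) ((below_iff hs).2 ⟨n, le_rfl⟩))
  have hta : Antitone t := fun i j hij => le_of_mul (s.antitone hij) le_rfl (ht j) (ht i)
  have hwa : Antitone w := fun i j hij => le_of_mul (hta hij) le_rfl (hw j) (hw i)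
  have : DecSeq.cls ⟨w, hwa⟩ = a.1 := cls_eq_of_le (by
    rw [← hs]; exact cls_le_cls.2 fun n => ⟨n, hws n⟩)
  exact (below_iff this).2 ⟨0, hwx 0⟩

/-- Otherwise each `e ∈ F` is incompatible with some element above `a`; a common lower bound of
these finitely many elements, again above `a`, would be incompatible with all of `F`. -/
theorem exists_below_of_finite (hΓ : IsUnitary Γ) {F : Set Γ} (hF : F.Finite)
    (h : ∀ z, a.Below z → ∃ e ∈ F, Compatible z e) : ∃ e ∈ F, a.Below e := by
  by_contra! hn
  have hz : ∀ e ∈ F, ∃ z, a.Below z ∧ ¬ Compatible z e := by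
    intro e he
    by_contra! hc
    exact hn e he (below_of_forall_compatible hΓ hc)
  choose! g hg hgc using hz
  obtain ⟨z, hz, hzg⟩ := a.exists_below_lower_bound (hF.image g) (by
    rintro _ ⟨e, he, rfl⟩; exact hg e he)
  obtain ⟨e, he, hce⟩ := h z hz
  exact hgc e he (hce.mono (hzg _ ⟨e, he, rfl⟩) le_rfl)

/-- An element below `p` is the restriction of `p` by its range unit, so `p` and the range determine
it. This uniqueness is what bounds the images of prefixes in `finite_Phi`. -/
theorem eq_of_sameRange (hΓ : IsUnitary Γ) {a' : Grpd Γ} (hp : a.Below p) (hp' : a'.Below p)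
    (h : SameRange b a) (h' : SameRange b a') : a = a' := by
  refine eq_of_forall_below fun x hx => below_of_forall_compatible hΓ fun z hz => ?_
  obtain ⟨x', hx', hxx, hxp⟩ := hx.exists_le_le hp'
  obtain ⟨z', hz', hzz, hzp⟩ := hz.exists_le_le hp
  obtain ⟨y, ex, ey, hy, hex, hey, hle⟩ := h' x' hx'
  obtain ⟨q, ez, eq, hq, hez, heq, hle'⟩ := h z' hz'
  obtain ⟨w, -, hwy, hwq⟩ := hy.exists_le_le hq
  obtain ⟨ew, hew, -⟩ := exists_mul_inv w
  have h1 : ew ≤ ex := (le_of_mul hwy (inv_le_inv hwy) hew hey).trans hle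
  have h2 : ew ≤ ez := (le_of_mul hwq (inv_le_inv hwq) hew heq).trans hle'
  have hu : IsUnitElt ew := ⟨w, hew⟩
  -- With `r = er p` and `ew = ew er`, the restriction `ew p` equals `ew r` and is below `r`.
  -- Applied to both elements, it yields the same lower bound.
  have hmeet : ∀ {r er : Γ}, mul r (inv r) = some er → ew ≤ er → r ≤ p →
      ∃ s, mul ew p = some s ∧ s ≤ r := by
    intro r er her hle hrp
    have h3 := mul_inv_mul_of_le hrp her
    have h4 := mul_inv_mul_of_le hle (by rw [hu.inv_eq]; exact isUnitElt_iff.1 hu)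
    obtain ⟨r', hr', hr''⟩ : ∃ r', mul ew r = some r' ∧ r' ≤ r := by
      obtain ⟨er', her', hrr'⟩ := exists_mul_inv r
      rw [her, Option.some_inj] at her'
      subst her'
      obtain ⟨t, ht, ht'⟩ := mul_assoc_right (a := ew) (b := r) (c := inv r) her h4
      exact ⟨t, ht, hu.mul_le ht⟩
    obtain ⟨t, ht, ht'⟩ := mul_assoc_right h3 hr'
    rw [h4, Option.some_inj] at ht
    exact ⟨r', ht ▸ ht', hr''⟩
  obtain ⟨s, hs, hsx⟩ := hmeet hex h1 hxp
  obtain ⟨s', hs', hsz⟩ := hmeet hez h2 hzp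
  rw [hs, Option.some_inj] at hs'
  subst hs'
  exact ⟨s, hsz.trans hzz, hsx.trans hxx⟩

/-! ### Units and inverses -/

/-- The units of the groupoid `𝓡(Γ)`. -/
def IsUnitGrpd (a : Grpd Γ) : Prop := ∃ x, IsUnitElt x ∧ a.Below x

theorem IsUnitGrpd.isUnitElt (hΓ : IsUnitary Γ) (h : IsUnitGrpd a) (hx : a.Below x) :
    IsUnitElt x := by
  obtain ⟨y, hy, hay⟩ := h
  obtain ⟨z, hzx, hzy⟩ := hx.compatible hay
  exact hΓ z x (hy.of_le hzy) hzx

/-- Characterising units by the multiplication alone shows that isomorphisms preserve them. -/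
theorem isUnitGrpd_iff (hΓ : IsUnitary Γ) : IsUnitGrpd a ↔ IsProd a a a := by
  constructor
  · rintro ⟨e, he, hae⟩
    refine isProd_iff.2 fun x y hx hy => ?_
    obtain ⟨z, hz, hzx, hzy⟩ := hx.exists_le_le hy
    obtain ⟨w, hw, hwz, hwe⟩ := hz.exists_le_le hae
    obtain ⟨t, ht, hwt⟩ := mul_mono (hwz.trans hzx) (hwz.trans hzy)
      (isUnitElt_iff.1 (he.of_le hwe))
    exact ⟨t, ht, hw.mono hwt⟩
  · intro h
    obtain ⟨x, hx⟩ := a.exists_below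
    obtain ⟨z, hz, haz⟩ := isProd_iff.1 h x x hx hx
    obtain ⟨w, hwx, hwz⟩ := hx.compatible haz
    obtain ⟨e, he, hxe⟩ := exists_inv_mul x
    obtain ⟨t, ht, hxt⟩ := mul_assoc_left hxe hz
    obtain ⟨z', hz', hzt⟩ := mul_assoc_left he ht
    rw [hz, Option.some_inj] at hz'
    subst hz'
    obtain ⟨u, hu, -⟩ := exists_inv_mul w
    have h1 : u ≤ t := le_of_mul (inv_le_inv hwx) hwz hu hzt
    exact ⟨x, hΓ u x (isUnitElt_of_inv_mul hu)
      (h1.trans ((isUnitElt_of_inv_mul he).mul_le ht)), hx⟩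

theorem exists_inverse (a : Grpd Γ) :
    ∃ b u : Grpd Γ, IsProd b a u ∧ IsUnitGrpd u ∧ ∀ x, a.Below x → b.Below (inv x) := by
  obtain ⟨s, hs⟩ := a.exists_seq
  have hm := isMin_cls_inverse (x := s) (by rw [hs]; exact a.2)
  choose e he hse using fun n => exists_inv_mul (s.seq n)
  have hea : Antitone e := fun i j hij =>
    le_of_mul (inv_le_inv (s.antitone hij)) (s.antitone hij) (he j) (he i)
  refine ⟨⟨_, hm⟩, ⟨DecSeq.cls ⟨e, hea⟩, isMin_cls_of_mul hm he⟩,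
    ⟨_, _, _, rfl, hs, rfl, he⟩, ⟨e 0, isUnitElt_of_inv_mul (he 0),
      cls_le_constClass.2 ⟨0, le_rfl⟩⟩, fun x hx => ?_⟩
  obtain ⟨m, hm⟩ := (below_iff hs).1 hx
  exact cls_le_constClass.2 ⟨m, inv_le_inv hm⟩

theorem below_inv_of_isProd (hΓ : IsUnitary Γ) (h : IsProd a b c) (hc : IsUnitGrpd c)
    (hx : a.Below x) : b.Below (inv x) := by
  refine below_of_forall_compatible hΓ fun y hy => ?_
  obtain ⟨z, hz, hcz⟩ := isProd_iff.1 h x y hx hy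
  have hzu := hc.isUnitElt hΓ hcz
  obtain ⟨e, he, hxe⟩ := exists_inv_mul x
  obtain ⟨t, ht, hxt⟩ := mul_assoc_left hxe hz
  obtain ⟨z', hz', hzt⟩ := mul_assoc_left he ht
  rw [hz, Option.some_inj] at hz'
  subst hz'
  exact ⟨t, (isUnitElt_of_inv_mul he).mul_le ht, hzu.mul_le_left hzt⟩

/-! ### The topology -/

/-- The generating sets form a basis because the set of elements above `a` is lower directed, which
handles finite intersections. -/
theorem exists_below_subset_of_isOpen {U : Set (Grpd Γ)} (hU : IsOpen U) (ha : a ∈ U) :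
    ∃ x, a.Below x ∧ ∀ b : Grpd Γ, b.Below x → b ∈ U := by
  obtain ⟨V, hV, rfl⟩ := isOpen_induced_iff.1 hU
  change a.1 ∈ V at ha
  have key : ∃ x, a.Below x ∧ ∀ b : Grpd Γ, b.Below x → b.1 ∈ V := by
    change TopologicalSpace.GenerateOpen _ V at hV
    induction hV with
    | basic s hs =>
      obtain ⟨c, rfl⟩ := hs
      exact ⟨c, ha, fun b hb => hb⟩
    | univ => exact a.exists_below.imp fun x hx => ⟨hx, fun _ _ => trivial⟩
    | inter s t _ _ ihs iht =>
      obtain ⟨x, hx, hxs⟩ := ihs ((isOpen_induced_iff.2 ⟨s, by assumption, rfl⟩)) ha.1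
      obtain ⟨y, hy, hyt⟩ := iht ((isOpen_induced_iff.2 ⟨t, by assumption, rfl⟩)) ha.2
      obtain ⟨z, hz, hzx, hzy⟩ := hx.exists_le_le hy
      exact ⟨z, hz, fun b hb => ⟨hxs b (hb.mono hzx), hyt b (hb.mono hzy)⟩⟩
    | sUnion S hS ih =>
      obtain ⟨s, hs, has⟩ := ha
      obtain ⟨x, hx, hxs⟩ := ih s hs ((isOpen_induced_iff.2 ⟨s, hS s hs, rfl⟩)) has
      exact ⟨x, hx, fun b hb => ⟨s, hs, hxs b hb⟩⟩
  exact key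

theorem isOpen_below (x : Γ) : IsOpen {a : Grpd Γ | a.Below x} :=
  isOpen_induced_iff.2 ⟨{y | y ≤ constClass x},
    TopologicalSpace.isOpen_generateFrom_of_mem ⟨x, rfl⟩, rfl⟩

theorem continuous_of_forall_below {Γ' : Type v} [AlmostGroupoid Γ'] {f : Grpd Γ → Grpd Γ'}
    (h : ∀ a x', (f a).Below x' → ∃ x, a.Below x ∧ ∀ b : Grpd Γ, b.Below x → (f b).Below x') :
    Continuous f := by
  refine continuous_induced_rng.2 (continuous_generateFrom_iff.2 ?_)
  rintro _ ⟨x', rfl⟩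
  refine isOpen_iff_forall_mem_open.2 fun a ha => ?_
  obtain ⟨x, hx, hxb⟩ := h a x' ha
  exact ⟨_, hxb, isOpen_below x, hx⟩

theorem exists_below_of_continuous {Γ' : Type v} [AlmostGroupoid Γ'] {f : Grpd Γ → Grpd Γ'}
    (hf : Continuous f) {x' : Γ'} (h : (f a).Below x') :
    ∃ x, a.Below x ∧ ∀ b : Grpd Γ, b.Below x → (f b).Below x' :=
  exists_below_subset_of_isOpen ((isOpen_below x').preimage hf) h

end Grpd

end

end TilingGroupoid

namespace TilingGroupoid

open AlmostGroupoid

/-! ## The induced map of a local derivation rule -/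

theorem AlmostGroupoid.le_meet {Γ : Type u} [AlmostGroupoid Γ] {x y z t w : Γ} (hx : z ≤ x)
    (hy : z ≤ y) (ht : mul x (inv y) = some t) (hw : mul t y = some w) : z ≤ w := by
  obtain ⟨e, he, hez⟩ := exists_mul_inv z
  exact le_of_mul (le_of_mul hx (inv_le_inv hy) he ht) hy hez hw

namespace RuleData

variable {Γ : Type u} {Γ' : Type v} [AlmostGroupoid Γ] [AlmostGroupoid Γ'] (R : RuleData Γ Γ')

/-- `R.IsImage l c c'`: the generators in `l` have product `c` and their images have
product `c'`. -/
def IsImage (l : List R.C) (c : Γ) (c' : Γ') : Prop :=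
  listProd (l.map Subtype.val) = some c ∧ listProd (l.map R.toFun) = some c'

/-- The list of inverses in reverse order. -/
def invList (l : List R.C) : List R.C :=
  l.reverse.map fun c : R.C => ⟨inv (c : Γ), R.inv_mem c c.2⟩

variable {R} {l l' : List R.C} {c d e : Γ} {c' d' e' : Γ'}

theorem exists_isImage (h : listProd (l.map Subtype.val) = some c) : ∃ c', R.IsImage l c c' := by
  obtain ⟨c', hc'⟩ := Option.isSome_iff_exists.1 (R.map_collatable l (by rw [h]; rfl))
  exact ⟨c', h, hc'⟩

theorem IsImage.inv (h : R.IsImage l c c') : R.IsImage (R.invList l) (inv c) (inv c') := by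
  obtain ⟨h1, h2⟩ := h
  constructor
  · have : (R.invList l).map Subtype.val = (l.map Subtype.val).reverse.map AlmostGroupoid.inv := by
      simp [invList, Function.comp_def]
    rw [this, listProd_reverse_inv, h1, inv_some]
  · have : (R.invList l).map R.toFun = (l.map R.toFun).reverse.map AlmostGroupoid.inv := by
      simp only [invList, List.map_map, ← List.map_reverse]
      exact List.map_congr_left fun c _ => R.map_inv c
    rw [this, listProd_reverse_inv, h2, inv_some]

theorem IsImage.append (h : R.IsImage l c c') (h' : R.IsImage l' d d')
    (hcd : mul c d = some e) : ∃ e', mul c' d' = some e' ∧ R.IsImage (l ++ l') e e' := by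
  have h1 : listProd ((l ++ l').map Subtype.val) = some e := by
    rw [List.map_append, listProd_append_eq h.1 h'.1, hcd]
  obtain ⟨e', he⟩ := exists_isImage h1
  refine ⟨e', ?_, he⟩
  rw [← he.2, List.map_append, listProd_append_eq h.2 h'.2]

/-- Two images can be refined by a common one. -/
theorem IsImage.refine (h : R.IsImage l c c') (h' : R.IsImage l' d d') (hcd : c ≤ d) :
    ∃ l'' e', R.IsImage l'' c e' ∧ e' ≤ c' ∧ e' ≤ d' := by
  obtain ⟨e, he, hec⟩ := exists_mul_inv c
  have he' : mul c (AlmostGroupoid.inv d) = some e := Eq.trans hcd he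
  -- The common refinement is the word `l`, then the inverse of `l'`, then `l'`, with product `c d⁻¹
  -- d = c`. As `c d⁻¹ = c c⁻¹` is a unit, (E3) makes `c' d'⁻¹` a unit, whence the image is below
  -- both `c'` and `d'`.
  obtain ⟨t, ht, h1⟩ := h.append h'.inv he'
  obtain ⟨w, hw, h2⟩ := h1.append h' (mul_inv_mul_of_le hcd he)
  have htu := R.map_unit _ _ _ h1.1 h1.2 ⟨c, he⟩
  obtain ⟨s, hs, hs'⟩ := mul_assoc_left ht hw
  exact ⟨_, w, h2, (isUnitElt_of_inv_mul hs).mul_le_left hs', htu.mul_le hw⟩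

theorem directedOn_Phi (c : Γ) : DirectedOn (· ≥ ·) (R.Phi c) := by
  rintro a ⟨l, h⟩ b ⟨l', h'⟩
  obtain ⟨l'', e, he, hea, heb⟩ := IsImage.refine (R := R) h h' le_rfl
  exact ⟨e, ⟨l'', he⟩, hea, heb⟩

theorem gen_mul (hc : c ∈ R.gen) (hd : d ∈ R.gen) (h : mul c d = some e) : e ∈ R.gen := by
  obtain ⟨l, hl⟩ := hc
  obtain ⟨l', hl'⟩ := hd
  exact ⟨l ++ l', by rw [List.map_append, listProd_append_eq hl hl', h]⟩

theorem gen_inv (hc : c ∈ R.gen) : inv c ∈ R.gen := by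
  obtain ⟨l, hl⟩ := hc
  obtain ⟨c', h⟩ := exists_isImage hl
  exact ⟨_, h.inv.1⟩

/-- The meet of two elements is the product `a b⁻¹ b`, so it stays in the generated almost-groupoid.
-/
theorem directedOn_H (hΓ : IsUnitary Γ) (c : Γ) : DirectedOn (· ≥ ·) (R.H c) := by
  rintro a ⟨ha, hca⟩ b ⟨hb, hcb⟩
  obtain ⟨t, w, ht, hw, hwa, hwb⟩ := hΓ.exists_meet ⟨c, hca, hcb⟩
  exact ⟨w, ⟨gen_mul (gen_mul ha (gen_inv hb) ht) hb hw, le_meet hca hcb ht hw⟩, hwa, hwb⟩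

theorem mem_dom_of_le (hd : d ∈ R.dom) (h : c ≤ d) : c ∈ R.dom := by
  obtain ⟨b, hb, hdb⟩ := hd
  exact ⟨b, hb, h.trans hdb⟩

theorem mem_dom_mul (hc : c ∈ R.dom) (hd : d ∈ R.dom) (h : mul c d = some e) : e ∈ R.dom := by
  obtain ⟨a, ha, hca⟩ := hc
  obtain ⟨b, hb, hdb⟩ := hd
  obtain ⟨z, hz, hez⟩ := mul_mono hca hdb h
  exact ⟨z, gen_mul ha hb hz, hez⟩

namespace FiniteDirected

variable (h : R.FiniteDirected)

theorem exists_isImage_value (x : R.dom) : ∃ l m, (x : Γ) ≤ m ∧ R.IsImage l m (h.value x) := by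
  obtain ⟨m, hm, ⟨l, hl⟩, -⟩ := (h.exists_value x).choose_spec
  exact ⟨l, m, hm.1.2, hl⟩

/-- The value is bounded by the image of every word whose product is above `x`, not only of words
for `min H(x)`. Monotonicity, inverses and products of the induced map all reduce to this. -/
theorem value_le {x : R.dom} (hx : (x : Γ) ≤ c) (hl : R.IsImage l c c') : h.value x ≤ c' := by
  obtain ⟨m, hm, ⟨l', hl'⟩, hmin⟩ := (h.exists_value x).choose_spec
  have hmc : m ≤ c := hm.2 ⟨⟨l, hl.1⟩, hx⟩
  obtain ⟨l'', e, he, -, hec⟩ := IsImage.refine (R := R) hl' hl hmc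
  exact le_trans (hmin ⟨l'', he⟩) hec

theorem value_mono {x y : R.dom} (hxy : (x : Γ) ≤ y) : h.value x ≤ h.value y := by
  obtain ⟨l, m, hm, hl⟩ := h.exists_isImage_value y
  exact h.value_le (hxy.trans hm) hl

theorem value_inv {x y : R.dom} (hxy : (y : Γ) = inv (x : Γ)) : h.value y = inv (h.value x) := by
  have key : ∀ {x y : R.dom}, (y : Γ) = inv (x : Γ) → h.value y ≤ inv (h.value x) := by
    intro x y hxy
    obtain ⟨l, m, hm, hl⟩ := h.exists_isImage_value x
    exact h.value_le (by rw [hxy]; exact inv_le_inv hm) hl.inv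
  refine eq_of_le_of_le (key hxy) ?_
  have := key (x := y) (y := x) (by rw [hxy, inv_inv_self])
  simpa using inv_le_inv this

theorem value_mul {x y z : R.dom} (hxy : mul (x : Γ) (y : Γ) = some (z : Γ)) :
    ∃ t, mul (h.value x) (h.value y) = some t ∧ h.value z ≤ t := by
  obtain ⟨l, m, hm, hl⟩ := h.exists_isImage_value x
  obtain ⟨l', m', hm', hl'⟩ := h.exists_isImage_value y
  obtain ⟨w, hw, hzw⟩ := mul_mono hm hm' hxy
  obtain ⟨t, ht, h1⟩ := hl.append hl' hw
  exact ⟨t, ht, h.value_le hzw h1⟩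

/-- The induced map of a rule represents a map of groupoids. -/
structure Represents (f : Grpd Γ → Grpd Γ') : Prop where
  exists_mem_dom : ∀ a : Grpd Γ, ∃ x ∈ R.dom, a.Below x
  below_value : ∀ (a : Grpd Γ) (x : R.dom), a.Below (x : Γ) → (f a).Below (h.value x)
  exists_value_le : ∀ (a : Grpd Γ) (y : Γ'), (f a).Below y →
    ∃ x : R.dom, a.Below (x : Γ) ∧ h.value x ≤ y

variable {h} {f : Grpd Γ → Grpd Γ'}

theorem Represents.cls_eq (hf : h.Represents f) {x : ℕ → R.dom}
    (hx : Antitone fun n => (x n : Γ)) {a : Grpd Γ}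
    (ha : DecSeq.cls ⟨fun n => (x n : Γ), hx⟩ = a.1)
    (hy : Antitone fun n => h.value (x n)) :
    DecSeq.cls ⟨fun n => h.value (x n), hy⟩ = (f a).1 := by
  have hle : (f a).1 ≤ DecSeq.cls ⟨fun n => h.value (x n), hy⟩ :=
    Grpd.le_cls_iff.2 fun n => hf.below_value a (x n) ((Grpd.below_iff ha).2 ⟨n, le_rfl⟩)
  refine le_antisymm ?_ hle
  obtain ⟨s, hs⟩ := (f a).exists_seq
  rw [← hs, cls_le_cls]
  intro n
  obtain ⟨y, hay, hy'⟩ := hf.exists_value_le a (s.seq n) ((Grpd.below_iff hs).2 ⟨n, le_rfl⟩)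
  obtain ⟨m, hm⟩ := (Grpd.below_iff ha).1 hay
  exact ⟨m, (h.value_mono hm).trans hy'⟩

theorem isApproximatingPrehom_of_represents (hf : h.Represents f) :
    IsApproximatingPrehom h.value where
  map_inv _ _ hxy := h.value_inv hxy
  map_mul _ _ _ hxy := h.value_mul hxy
  map_approximating x := by
    rintro ⟨hx, hmin⟩
    have hy : Antitone fun n => h.value (x n) := fun i j hij => h.value_mono (hx hij)
    refine ⟨hy, ?_⟩
    rw [hf.cls_eq hx (a := ⟨_, hmin⟩) rfl hy]
    exact (f _).2

end FiniteDirected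

end RuleData

/-! ### Passage between local derivation rules and maps of groupoids. -/

namespace LocalDerivationRule

variable {Γ : Type u} {Γ' : Type v} [AlmostGroupoid Γ] [AlmostGroupoid Γ']
  {R : LocalDerivationRule Γ Γ'} {S : LocalDerivationRule Γ' Γ}

theorem mem_compDom_of_le {x y : Γ} (hx : x ∈ compDom R S) (h : y ≤ x) : y ∈ compDom R S := by
  obtain ⟨hd, hd'⟩ := hx
  exact ⟨RuleData.mem_dom_of_le hd h,
    RuleData.mem_dom_of_le hd' (R.finiteDirected.value_mono (show ((⟨y, _⟩ : R.dom) : Γ) ≤ x from h))⟩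

theorem induces_of_represents {f : Grpd Γ → Grpd Γ'} (hf : R.finiteDirected.Represents f) :
    R.Induces f := by
  intro a
  obtain ⟨s, hs, hsD⟩ := Grpd.exists_seq_mem (fun x hx y hyx => RuleData.mem_dom_of_le hx hyx)
    (hf.exists_mem_dom a)
  exact ⟨fun n => ⟨s.seq n, hsD n⟩, s.antitone,
    fun i j hij => R.finiteDirected.value_mono (s.antitone hij), hs, hf.cls_eq _ hs _⟩

/-- A rule whose domain is large enough represents a map of groupoids. -/
theorem exists_represents (h : ∀ a : Grpd Γ, ∃ x ∈ R.dom, a.Below x) :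
    ∃ f : Grpd Γ → Grpd Γ', R.finiteDirected.Represents f := by
  have key : ∀ a : Grpd Γ, ∃ b : Grpd Γ',
      (∀ x : R.dom, a.Below (x : Γ) → b.Below (R.finiteDirected.value x)) ∧
      ∀ y, b.Below y → ∃ x : R.dom, a.Below (x : Γ) ∧ R.finiteDirected.value x ≤ y := by
    intro a
    obtain ⟨s, hs, hsD⟩ := Grpd.exists_seq_mem (fun x hx y hyx => RuleData.mem_dom_of_le hx hyx)
      (h a)
    obtain ⟨hy, hmin⟩ := R.approximating.map_approximating (fun n => ⟨s.seq n, hsD n⟩)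
      ⟨s.antitone, by rw [show DecSeq.cls ⟨_, _⟩ = a.1 from hs]; exact a.2⟩
    refine ⟨⟨_, hmin⟩, fun x hx => ?_, fun y hy' => ?_⟩
    · obtain ⟨m, hm⟩ := (Grpd.below_iff hs).1 hx
      exact cls_le_constClass.2 ⟨m, R.finiteDirected.value_mono hm⟩
    · obtain ⟨m, hm⟩ := cls_le_constClass.1 hy'
      exact ⟨⟨s.seq m, hsD m⟩, (Grpd.below_iff hs).2 ⟨m, le_rfl⟩, hm⟩
  choose f hf hf' using key
  exact ⟨f, h, hf, hf'⟩

theorem continuous_of_represents {f : Grpd Γ → Grpd Γ'} (hf : R.finiteDirected.Represents f) :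
    Continuous f := by
  refine Grpd.continuous_of_forall_below fun a y hy => ?_
  obtain ⟨x, hx, hxy⟩ := hf.exists_value_le a y hy
  exact ⟨x, hx, fun b hb => (hf.below_value b x hb).mono hxy⟩

theorem isProd_of_represents {f : Grpd Γ → Grpd Γ'} (hf : R.finiteDirected.Represents f)
    {a b c : Grpd Γ} (h : Grpd.IsProd a b c) : Grpd.IsProd (f a) (f b) (f c) := by
  refine Grpd.isProd_iff.2 fun x' y' hx' hy' => ?_
  obtain ⟨x, hx, hxx⟩ := hf.exists_value_le a x' hx'
  obtain ⟨y, hy, hyy⟩ := hf.exists_value_le b y' hy'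
  obtain ⟨z, hz, hcz⟩ := Grpd.isProd_iff.1 h x y hx hy
  have hzD : z ∈ R.dom := RuleData.mem_dom_mul x.2 y.2 hz
  obtain ⟨t, ht, hzt⟩ := R.finiteDirected.value_mul (z := ⟨z, hzD⟩) hz
  obtain ⟨w, hw, htw⟩ := mul_mono hxx hyy ht
  exact ⟨w, hw, (hf.below_value c ⟨z, hzD⟩ hcz).mono (hzt.trans htw)⟩

theorem exists_below_of_cls_eq {D : Set Γ} {a : Grpd Γ}
    (h : ∃ x : DecSeq Γ, x.cls = a.1 ∧ ∀ n, x.seq n ∈ D) : ∃ x ∈ D, a.Below x := by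
  obtain ⟨s, hs, hD⟩ := h
  exact ⟨s.seq 0, hD 0, (Grpd.below_iff hs).2 ⟨0, le_rfl⟩⟩

/-- Given `z` above `g (f a)` and `x` above `a`, a small enough `x₂ ≤ x` above `a` satisfies
`ψ(φ(x₂)) ≤ z`. The common lower bound of `ψ(φ(x₂))` and `x₂` makes `z` and `x` compatible, which
suffices by unitarity. -/
theorem leftInverse_of_represents (hΓ : IsUnitary Γ) (hSR : S.IsLocalLeftInverse R)
    {f : Grpd Γ → Grpd Γ'} {g : Grpd Γ' → Grpd Γ} (hf : R.finiteDirected.Represents f)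
    (hg : S.finiteDirected.Represents g) : Function.LeftInverse g f := by
  intro a
  refine Grpd.eq_of_forall_below fun x hx => Grpd.below_of_forall_compatible hΓ fun z hz => ?_
  obtain ⟨y, hy, hyz⟩ := hg.exists_value_le (f a) z hz
  obtain ⟨x₁, hx₁, hxy⟩ := hf.exists_value_le a y hy
  obtain ⟨x₂, -, h1, h2⟩ := hx.exists_le_le hx₁
  have hD : x₂ ∈ R.dom := RuleData.mem_dom_of_le x₁.2 h2
  have hle : R.map ⟨x₂, hD⟩ ≤ y :=
    (R.finiteDirected.value_mono (x := ⟨x₂, hD⟩) h2).trans hxy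
  have hD' : R.map ⟨x₂, hD⟩ ∈ S.dom := RuleData.mem_dom_of_le y.2 hle
  obtain ⟨w, hw, hw'⟩ := hSR.lowerBound x₂ hD hD'
  exact ⟨w, hw.trans ((S.finiteDirected.value_mono (x := ⟨_, hD'⟩) hle).trans hyz), hw'.trans h1⟩

/-- Any `a` below `c` is `g (f a)`, hence also below `ψ(φ(c))`; two elements above the same `a` have
a common lower bound. -/
theorem isLocalLeftInverse_of_represents (hne : ∀ c : Γ, ∃ a : Grpd Γ, a.Below c)
    {f : Grpd Γ → Grpd Γ'} {g : Grpd Γ' → Grpd Γ} (hf : R.finiteDirected.Represents f)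
    (hg : S.finiteDirected.Represents g) (hfg : Function.LeftInverse g f) :
    S.IsLocalLeftInverse R := by
  have key : ∀ a : Grpd Γ, ∃ x ∈ compDom R S, a.Below x := by
    intro a
    obtain ⟨y, hyD, hy⟩ := hg.exists_mem_dom (f a)
    obtain ⟨x, hx, hxy⟩ := hf.exists_value_le a y hy
    exact ⟨x, ⟨x.2, RuleData.mem_dom_of_le hyD hxy⟩, hx⟩
  refine ⟨fun c => ?_, fun a => ?_, fun c hD hD' => ?_⟩
  · obtain ⟨a, ha⟩ := hne c
    obtain ⟨x, hxD, hx⟩ := key a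
    obtain ⟨z, -, hzc, hzx⟩ := ha.exists_le_le hx
    exact ⟨z, mem_compDom_of_le hxD hzx, hzc⟩
  · exact Grpd.exists_seq_mem (fun x hx y hyx => mem_compDom_of_le hx hyx) (key a)
  · obtain ⟨a, ha⟩ := hne c
    have h1 := hg.below_value (f a) ⟨_, hD'⟩ (hf.below_value a ⟨c, hD⟩ ha)
    rw [hfg a] at h1
    exact h1.compatible ha

end LocalDerivationRule

theorem TopologicallyEquivalent.nonempty_grpdIso {Γ : Type u} {Γ' : Type v} [AlmostGroupoid Γ]
    [AlmostGroupoid Γ'] (hΓ : IsUnitary Γ) (hΓ' : IsUnitary Γ')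
    (h : TopologicallyEquivalent Γ Γ') : Nonempty (GrpdIso Γ Γ') := by
  obtain ⟨R, S, hSR, hRS⟩ := h
  obtain ⟨f, hf⟩ := LocalDerivationRule.exists_represents (R := R) fun a => by
    obtain ⟨x, ⟨hx, -⟩, hax⟩ := LocalDerivationRule.exists_below_of_cls_eq (hSR.covers a)
    exact ⟨x, hx, hax⟩
  obtain ⟨g, hg⟩ := LocalDerivationRule.exists_represents (R := S) fun a => by
    obtain ⟨x, ⟨hx, -⟩, hax⟩ := LocalDerivationRule.exists_below_of_cls_eq (hRS.covers a)
    exact ⟨x, hx, hax⟩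
  have hgf := LocalDerivationRule.leftInverse_of_represents hΓ hSR hf hg
  have hfg := LocalDerivationRule.leftInverse_of_represents hΓ' hRS hg hf
  refine ⟨⟨⟨⟨f, g, hgf, hfg⟩, LocalDerivationRule.continuous_of_represents hf,
    LocalDerivationRule.continuous_of_represents hg⟩, fun a b c =>
      ⟨LocalDerivationRule.isProd_of_represents hf, fun h => ?_⟩⟩⟩
  have := LocalDerivationRule.isProd_of_represents hg h
  change Grpd.IsProd (g (f a)) (g (f b)) (g (f c)) at this
  rwa [hgf a, hgf b, hgf c] at this

end TilingGroupoid

namespace TilingGroupoid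

open AlmostGroupoid

/-! ## Isomorphisms are locally defined -/

/-- Elements that are above everything they are compatible with. -/
def IsPrimitive {Γ : Type u} [AlmostGroupoid Γ] (v : Γ) : Prop := ∀ z, Compatible z v → z ≤ v

/-- The properties of the almost-groupoid of a tiling of finite type from which it follows that
isomorphisms are locally defined. -/
structure IsPatternLike (Γ : Type u) [AlmostGroupoid Γ] : Prop where
  unitary : IsUnitary Γ
  exists_grpd_below : ∀ c : Γ, ∃ a : Grpd Γ, a.Below c
  exists_finite_cover : ∀ (g : Γ) (P : Set Γ), (∀ a : Grpd Γ, a.Below g → ∃ c ∈ P, a.Below c) →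
    ∃ F ⊆ P, F.Finite ∧ ∀ a : Grpd Γ, a.Below g → ∃ c ∈ F, a.Below c
  exists_generators : ∃ G : Set Γ, G.Finite ∧ ∀ a : Grpd Γ, ∃ (l : List Γ) (w : Γ),
    (∀ g ∈ l, g ∈ G) ∧ listProd l = some w ∧ a.Below w
  finite_left : ∀ c : Γ, {p : Γ | ∃ q, mul p q = some c}.Finite
  exists_primitive : ∀ c : Γ, ∃ v, IsPrimitive v ∧ c ≤ v
  exists_primitive_list : ∀ c : Γ, ∃ l : List Γ, (∀ v ∈ l, IsPrimitive v) ∧ listProd l = some c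
  -- A walk multiplying by primitive elements, whose positions after each step stay in the finite
  -- set `A`, runs through finitely many elements only.
  exists_finite_local : ∀ A : Set Γ, A.Finite → (∀ v ∈ A, IsPrimitive v) →
    ∃ L : Set Γ, L.Finite ∧ A ⊆ L ∧ ∀ b ∈ L, ∀ v v' z, IsPrimitive v → mul b v = some z →
      v' ∈ A → z ≤ v' → z ∈ L

section

variable {Γ : Type u} {Γ' : Type v} [AlmostGroupoid Γ] [AlmostGroupoid Γ']

theorem IsPrimitive.eq_of_compatible {v v' : Γ} (hv : IsPrimitive v) (hv' : IsPrimitive v')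
    (h : Compatible v v') : v = v' :=
  eq_of_le_of_le (hv' v h) (hv v' h.symm)

theorem IsPrimitive.inverse {v : Γ} (hv : IsPrimitive v) : IsPrimitive (inv v) := by
  rintro z ⟨y, hyz, hyv⟩
  have h := hv (inv z) ⟨inv y, inv_le_inv hyz, by simpa using inv_le_inv hyv⟩
  simpa using inv_le_inv h

namespace GrpdIso

variable (f : GrpdIso Γ Γ')

/-- The inverse of an isomorphism. -/
def symm : GrpdIso Γ' Γ :=
  ⟨f.toHomeo.symm, fun a b c => by rw [f.map_isProd]; simp⟩

variable {f}

theorem isUnitGrpd_map (hΓ : IsUnitary Γ) (hΓ' : IsUnitary Γ') {a : Grpd Γ}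
    (ha : a.IsUnitGrpd) : (f.toHomeo a).IsUnitGrpd :=
  (Grpd.isUnitGrpd_iff hΓ').2 ((f.map_isProd _ _ _).1 ((Grpd.isUnitGrpd_iff hΓ).1 ha))

theorem below_inv_of_forall_below (hΓ : IsUnitary Γ) (hΓ' : IsUnitary Γ') {c : Γ} {v : Γ'}
    (h : ∀ a : Grpd Γ, a.Below c → (f.toHomeo a).Below v) :
    ∀ a : Grpd Γ, a.Below (inv c) → (f.toHomeo a).Below (inv v) := by
  intro a ha
  obtain ⟨b, u, hbu, hu, hb⟩ := a.exists_inverse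
  have hbc := hb _ ha
  rw [inv_inv_self] at hbc
  exact Grpd.below_inv_of_isProd hΓ' ((f.map_isProd _ _ _).1 hbu) (isUnitGrpd_map hΓ hΓ' hu)
    (h b hbc)

/-- Local images of products: if `f` maps what is below a generator `c` below `φ c`, then it
maps what is below a product of generators below the product of their images. -/
theorem exists_listProd_below {C : Set Γ} {φ : C → Γ'}
    (hφ : ∀ (c : C) (a : Grpd Γ), a.Below (c : Γ) → (f.toHomeo a).Below (φ c)) (l : List C)
    {p : Γ} {a : Grpd Γ} (hl : listProd (l.map Subtype.val) = some p) (ha : a.Below p) :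
    ∃ z, listProd (l.map φ) = some z ∧ (f.toHomeo a).Below z := by
  induction l using List.reverseRecOn generalizing p a with
  | nil => exact absurd rfl (ne_nil_of_listProd hl)
  | append_singleton l c ih =>
    by_cases h : l = []
    · subst h
      have hp : (c : Γ) = p := Option.some_injective _ hl
      exact ⟨φ c, rfl, hφ c a (hp ▸ ha)⟩
    · rw [List.map_append] at hl
      obtain ⟨q, hq, hqc⟩ := listProd_append_singleton_eq_some (mt List.map_eq_nil_iff.1 h) hl
      obtain ⟨b, d, hb, hd, hbd⟩ := ha.exists_factors hqc
      obtain ⟨z, hz, hbz⟩ := ih hq hb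
      obtain ⟨t, ht, hat⟩ := Grpd.isProd_iff.1 ((f.map_isProd _ _ _).1 hbd) z (φ c) hbz (hφ c d hd)
      refine ⟨t, ?_, hat⟩
      rw [List.map_append]
      exact (listProd_append_eq hz (listProd_singleton _)).trans ht

/-- Products of elements of `G` can be refined by products of elements of a cover. -/
theorem exists_list_of_cover {G C : Set Γ}
    (hC : ∀ g ∈ G, ∀ a : Grpd Γ, a.Below g → ∃ c ∈ C, a.Below c) (l : List Γ)
    (hl : ∀ g ∈ l, g ∈ G) {p : Γ} {a : Grpd Γ} (hp : listProd l = some p) (ha : a.Below p) :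
    ∃ (l' : List C) (q : Γ), listProd (l'.map Subtype.val) = some q ∧ a.Below q := by
  induction l using List.reverseRecOn generalizing p a with
  | nil => exact absurd rfl (ne_nil_of_listProd hp)
  | append_singleton l g ih =>
    by_cases h : l = []
    · subst h
      have hp : g = p := Option.some_injective _ hp
      obtain ⟨c, hc, hac⟩ := hC g (hl g (by simp)) a (hp ▸ ha)
      exact ⟨[⟨c, hc⟩], c, rfl, hac⟩
    · obtain ⟨q, hq, hqg⟩ := listProd_append_singleton_eq_some h hp
      obtain ⟨b, d, hb, hd, hbd⟩ := ha.exists_factors hqg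
      obtain ⟨l', q', hq', hbq⟩ := ih (fun g hg => hl g (by simp [hg])) hq hb
      obtain ⟨c, hc, hdc⟩ := hC g (hl g (by simp)) d hd
      obtain ⟨t, ht, hat⟩ := Grpd.isProd_iff.1 hbd q' c hbq hdc
      refine ⟨l' ++ [⟨c, hc⟩], t, ?_, hat⟩
      rw [List.map_append]
      exact (listProd_append_eq hq' (listProd_singleton _)).trans ht

/-- By continuity, elements that `f` maps below a single primitive element cover `𝓡(Γ)`. Finitely
many suffice below each of the finitely many generators; closing up under inverses preserves the
property, since `f` respects inverses. -/
theorem exists_generating_cover (hΓ : IsPatternLike Γ) (hΓ' : IsPatternLike Γ')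
    (f : GrpdIso Γ Γ') :
    ∃ C : Set Γ, C.Finite ∧ (∀ c ∈ C, inv c ∈ C) ∧
      (∀ c ∈ C, ∃ v, IsPrimitive v ∧ ∀ a : Grpd Γ, a.Below c → (f.toHomeo a).Below v) ∧
      ∀ a : Grpd Γ, ∃ (l : List C) (q : Γ), listProd (l.map Subtype.val) = some q ∧ a.Below q := by
  obtain ⟨G, hG, hGl⟩ := hΓ.exists_generators
  set P : Set Γ := {c | ∃ v, IsPrimitive v ∧ ∀ a : Grpd Γ, a.Below c → (f.toHomeo a).Below v}
    with hP
  have hcov : ∀ a : Grpd Γ, ∃ c ∈ P, a.Below c := by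
    intro a
    obtain ⟨c', hc'⟩ := (f.toHomeo a).exists_below
    obtain ⟨v, hv, hcv⟩ := hΓ'.exists_primitive c'
    obtain ⟨c, hc, hcb⟩ := Grpd.exists_below_of_continuous f.toHomeo.continuous (hc'.mono hcv)
    exact ⟨c, ⟨v, hv, hcb⟩, hc⟩
  choose F hFP hF hFc using fun g => hΓ.exists_finite_cover g P fun a _ => hcov a
  have hfin : (⋃ g ∈ G, F g).Finite := hG.biUnion fun g _ => hF g
  refine ⟨(⋃ g ∈ G, F g) ∪ inv '' ⋃ g ∈ G, F g, hfin.union (hfin.image _), ?_, ?_, fun a => ?_⟩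
  · rintro c (hc | ⟨c, hc, rfl⟩)
    · exact Or.inr ⟨c, hc, rfl⟩
    · rw [inv_inv_self]; exact Or.inl hc
  · have h1 : ∀ c ∈ ⋃ g ∈ G, F g, c ∈ P := by
      intro c hc
      simp only [Set.mem_iUnion] at hc
      obtain ⟨g, -, hc⟩ := hc
      exact hFP g hc
    rintro c (hc | ⟨c, hc, rfl⟩)
    · exact h1 c hc
    · obtain ⟨v, hv, hcv⟩ := h1 c hc
      exact ⟨inv v, hv.inverse, below_inv_of_forall_below hΓ.unitary hΓ'.unitary hcv⟩
  · obtain ⟨l, w, hl, hw, haw⟩ := hGl a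
    refine exists_list_of_cover (fun g hg b hb => ?_) l hl hw haw
    obtain ⟨c, hc, hbc⟩ := hFc g b hb
    exact ⟨c, Or.inl (Set.mem_biUnion hg hc), hbc⟩

end GrpdIso

/-- A rule with primitive values which describes the isomorphism `f`. -/
structure RuleData.Describes (R : RuleData Γ Γ') (f : GrpdIso Γ Γ') : Prop where
  isPrimitive : ∀ c, IsPrimitive (R.toFun c)
  below : ∀ (c : R.C) (a : Grpd Γ), a.Below (c : Γ) → (f.toHomeo a).Below (R.toFun c)
  exists_list : ∀ a : Grpd Γ, ∃ (l : List R.C) (q : Γ),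
    listProd (l.map Subtype.val) = some q ∧ a.Below q

/-- All three rules are tested on some `a` below the product: `f a` lies below the product of the
images. This gives (E2) and (E3), and (E1) because compatible primitive elements coincide. -/
theorem RuleData.exists_describes (hΓ : IsPatternLike Γ) (hΓ' : IsPatternLike Γ')
    (f : GrpdIso Γ Γ') : ∃ R : RuleData Γ Γ', R.Describes f := by
  obtain ⟨C, hC, hCinv, hCP, hCl⟩ := GrpdIso.exists_generating_cover hΓ hΓ' f
  choose φ hφp hφ using fun c : C => hCP c c.2
  refine ⟨{ C := C, finite := hC, inv_mem := hCinv, toFun := φ, map_inv := ?_,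
            map_collatable := ?_, map_unit := ?_ }, ⟨hφp, hφ, hCl⟩⟩
  · intro c
    obtain ⟨a, ha⟩ := hΓ.exists_grpd_below (inv (c : Γ))
    exact (hφp _).eq_of_compatible (hφp c).inverse ((hφ ⟨_, hCinv c c.2⟩ a ha).compatible
      (GrpdIso.below_inv_of_forall_below hΓ.unitary hΓ'.unitary (hφ c) a ha))
  · intro l hl
    obtain ⟨p, hp⟩ := Option.isSome_iff_exists.1 hl
    obtain ⟨a, ha⟩ := hΓ.exists_grpd_below p
    obtain ⟨z, hz, -⟩ := GrpdIso.exists_listProd_below hφ l hp ha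
    exact Option.isSome_iff_exists.2 ⟨z, hz⟩
  · intro l e e' hl hl' he
    obtain ⟨a, ha⟩ := hΓ.exists_grpd_below e
    obtain ⟨z, hz, haz⟩ := GrpdIso.exists_listProd_below hφ l hl ha
    rw [hl', Option.some_inj] at hz
    subst hz
    exact (GrpdIso.isUnitGrpd_map hΓ.unitary hΓ'.unitary ⟨e, he, ha⟩).isUnitElt hΓ'.unitary haz

/-! ### Finiteness of `Φ(c)` and surjectivity in the limit. -/

namespace RuleData.Describes

variable {R : RuleData Γ Γ'} {f : GrpdIso Γ Γ'}

theorem exists_below (h : R.Describes f) {l : List R.C} {c : Γ} {a : Grpd Γ}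
    (hl : listProd (l.map Subtype.val) = some c) (ha : a.Below c) :
    ∃ z, R.IsImage l c z ∧ (f.toHomeo a).Below z := by
  obtain ⟨z, hz, haz⟩ := GrpdIso.exists_listProd_below h.below l hl ha
  exact ⟨z, ⟨hl, hz⟩, haz⟩

theorem below_of_isImage (h : R.Describes f) {l : List R.C} {c : Γ} {z : Γ'} {a : Grpd Γ}
    (hl : R.IsImage l c z) (ha : a.Below c) : (f.toHomeo a).Below z := by
  obtain ⟨z', hz', haz⟩ := h.exists_below hl.1 ha
  have := hl.2.symm.trans hz'.2
  rw [Option.some_inj] at this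
  exact this ▸ haz

/-- Fix `a` below `c`. For a left factor `p` of `c`, at most one `b` below `p` has the range of `a`,
and at most one primitive element is above `f b`; call `A` the finite set of these. The images of
all prefixes of words for `c` lie below elements of `A`, so by `exists_finite_local` they never
leave a finite set `L`. -/
theorem finite_Phi (hΓ : IsPatternLike Γ) (hΓ' : IsPatternLike Γ') (h : R.Describes f) (c : Γ) :
    (R.Phi c).Finite := by
  obtain ⟨a, ha⟩ := hΓ.exists_grpd_below c
  set V : Γ → Set Γ' := fun p => {v | IsPrimitive v ∧
    ∃ b : Grpd Γ, b.Below p ∧ Grpd.SameRange a b ∧ (f.toHomeo b).Below v} with hV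
  have hVs : ∀ p, (V p).Subsingleton := by
    rintro p v ⟨hv, b, hbp, hab, hbv⟩ v' ⟨hv', b', hbp', hab', hbv'⟩
    have := Grpd.eq_of_sameRange hΓ.unitary hbp hbp' hab hab'
    subst this
    exact hv.eq_of_compatible hv' (hbv.compatible hbv')
  set A : Set Γ' := ⋃ p ∈ {p : Γ | ∃ q, mul p q = some c}, V p with hA
  have hAf : A.Finite := (hΓ.finite_left c).biUnion fun p _ => (hVs p).finite
  have hmem : ∀ {p q : Γ} {b : Grpd Γ} {v : Γ'}, mul p q = some c → b.Below p →
      Grpd.SameRange a b → IsPrimitive v → (f.toHomeo b).Below v → v ∈ A :=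
    fun {p q b v} hpq hb hab hv hbv => Set.mem_biUnion (x := p) ⟨q, hpq⟩ ⟨hv, b, hb, hab, hbv⟩
  obtain ⟨L, hL, hAL, hstep⟩ := hΓ'.exists_finite_local A hAf (by
    intro v hv
    simp only [hA, Set.mem_iUnion] at hv
    obtain ⟨p, -, hv⟩ := hv
    exact hv.1)
  have key : ∀ (l : List R.C) (p q : Γ) (b : Grpd Γ) (z : Γ'), R.IsImage l p z → b.Below p →
      mul p q = some c → Grpd.SameRange a b → z ∈ L := by
    intro l
    induction l using List.reverseRecOn with
    | nil => intro p q b z hl; exact absurd rfl (ne_nil_of_listProd hl.1)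
    | append_singleton l c₁ ih =>
      intro p q b z hl hb hpq hab
      by_cases hne : l = []
      · subst hne
        have hz : R.toFun c₁ = z := Option.some_injective _ hl.2
        subst hz
        exact hAL (hmem hpq hb hab (h.isPrimitive c₁) (h.below_of_isImage hl hb))
      · have hbz := h.below_of_isImage hl hb
        obtain ⟨hl1, hl2⟩ := hl
        rw [List.map_append] at hl1 hl2
        obtain ⟨p₀, hp₀, hpc⟩ := listProd_append_singleton_eq_some (mt List.map_eq_nil_iff.1 hne) hl1
        obtain ⟨z₀, hz₀, hzc⟩ := listProd_append_singleton_eq_some (mt List.map_eq_nil_iff.1 hne) hl2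
        obtain ⟨b₀, d, hb₀, hd, hbd⟩ := hb.exists_factors hpc
        obtain ⟨q₀, -, hq₀⟩ := mul_assoc_left hpc hpq
        -- Removing the last generator leaves a left factor of `c`, and the first factor `b₀` of `b`
        -- keeps its range, so the induction hypothesis applies.
        have hz₀L := ih p₀ q₀ b₀ z₀ ⟨hp₀, hz₀⟩ hb₀ hq₀ (hab.trans hbd.sameRange)
        obtain ⟨v', hv', hzv⟩ := hΓ'.exists_primitive z
        exact hstep z₀ hz₀L _ v' z (h.isPrimitive c₁) hzc
          (hmem hpq hb hab hv' (hbz.mono hzv)) hzv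
  refine hL.subset ?_
  rintro z ⟨l, hl⟩
  -- The whole word counts as a prefix because `c = c (c⁻¹ c)` is a left factor of itself.
  obtain ⟨e, -, he⟩ := exists_inv_mul c
  exact key l c e a z hl ha he (Grpd.SameRange.refl a)

theorem finiteDirected (hΓ : IsPatternLike Γ) (hΓ' : IsPatternLike Γ') (h : R.Describes f) :
    R.FiniteDirected where
  finite_Phi := h.finite_Phi hΓ hΓ'
  directed_Phi := RuleData.directedOn_Phi
  finite_H c := (hΓ.finite_left c).subset fun c' hc' => by
    obtain ⟨e, -, he⟩ := exists_mul_eq_of_le hc'.2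
    exact ⟨e, he⟩
  directed_H := RuleData.directedOn_H hΓ.unitary

/-- For one primitive `v` above `f b`, any word with product above `b` works: its image is also
above `f b`, hence compatible with `v` and absorbed by it. For a product, `f a` is factored and the
factors are pulled back along `f`. -/
theorem exists_isImage_le (h : R.Describes f) (l' : List Γ') (hl' : ∀ v ∈ l', IsPrimitive v)
    {z' : Γ'} {a : Grpd Γ} (hz' : listProd l' = some z') (ha : (f.toHomeo a).Below z') :
    ∃ l c z, R.IsImage l c z ∧ a.Below c ∧ z ≤ z' := by
  induction l' using List.reverseRecOn generalizing z' a with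
  | nil => exact absurd rfl (ne_nil_of_listProd hz')
  | append_singleton l' v ih =>
    have hsingle : ∀ b : Grpd Γ, (f.toHomeo b).Below v →
        ∃ l c z, R.IsImage l c z ∧ b.Below c ∧ z ≤ v := by
      intro b hb
      obtain ⟨l, q, hl, hbq⟩ := h.exists_list b
      obtain ⟨z, hz, hbz⟩ := h.exists_below hl hbq
      exact ⟨l, q, z, hz, hbq, hl' v (by simp) z (hbz.compatible hb)⟩
    by_cases hne : l' = []
    · subst hne
      have hv : v = z' := Option.some_injective _ hz'
      subst hv
      exact hsingle a ha
    · obtain ⟨y', hy', hyv⟩ := listProd_append_singleton_eq_some hne hz'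
      obtain ⟨b', d', hb', hd', hbd⟩ := ha.exists_factors hyv
      obtain ⟨b, rfl⟩ := f.toHomeo.surjective b'
      obtain ⟨d, rfl⟩ := f.toHomeo.surjective d'
      rw [← f.map_isProd] at hbd
      obtain ⟨l₁, c₁, z₁, h₁, hb₁, hz₁⟩ := ih (fun v hv => hl' v (by simp [hv])) hy' hb'
      obtain ⟨l₂, c₂, z₂, h₂, hd₂, hz₂⟩ := hsingle d hd'
      obtain ⟨c, hc, hac⟩ := Grpd.isProd_iff.1 hbd c₁ c₂ hb₁ hd₂
      obtain ⟨z, hz, hl⟩ := h₁.append h₂ hc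
      exact ⟨_, c, z, hl, hac, le_of_mul hz₁ hz₂ hz hyv⟩

theorem represents (hΓ' : IsPatternLike Γ') (h : R.Describes f) (hR : R.FiniteDirected) :
    hR.Represents f.toHomeo where
  exists_mem_dom a := by
    obtain ⟨l, q, hl, haq⟩ := h.exists_list a
    exact ⟨q, ⟨q, ⟨l, hl⟩, le_rfl⟩, haq⟩
  below_value a x hax := by
    obtain ⟨l, m, hxm, hl⟩ := hR.exists_isImage_value x
    exact h.below_of_isImage hl (hax.mono hxm)
  exists_value_le a y hay := by
    obtain ⟨l', hl', hy⟩ := hΓ'.exists_primitive_list y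
    obtain ⟨l, c, z, hl, hac, hzy⟩ := h.exists_isImage_le l' hl' hy hay
    exact ⟨⟨c, c, ⟨l, hl.1⟩, le_rfl⟩, hac, (hR.value_le le_rfl hl).trans hzy⟩

end RuleData.Describes

theorem LocalDerivationRule.exists_represents_iso (hΓ : IsPatternLike Γ) (hΓ' : IsPatternLike Γ')
    (f : GrpdIso Γ Γ') :
    ∃ R : LocalDerivationRule Γ Γ', R.finiteDirected.Represents f.toHomeo := by
  obtain ⟨R, hR⟩ := RuleData.exists_describes hΓ hΓ' f
  have hfd := hR.finiteDirected hΓ hΓ'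
  have hrep := hR.represents hΓ' hfd
  exact ⟨⟨R, hfd, RuleData.FiniteDirected.isApproximatingPrehom_of_represents hrep⟩, hrep⟩

theorem topologicallyEquivalent_of_grpdIso (hΓ : IsPatternLike Γ) (hΓ' : IsPatternLike Γ')
    (f : GrpdIso Γ Γ') : TopologicallyEquivalent Γ Γ' := by
  obtain ⟨R, hR⟩ := LocalDerivationRule.exists_represents_iso hΓ hΓ' f
  obtain ⟨S, hS⟩ := LocalDerivationRule.exists_represents_iso hΓ' hΓ f.symm
  exact ⟨R, S,
    LocalDerivationRule.isLocalLeftInverse_of_represents hΓ.exists_grpd_below hR hS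
      f.toHomeo.symm_apply_apply,
    LocalDerivationRule.isLocalLeftInverse_of_represents hΓ'.exists_grpd_below hS hR
      f.toHomeo.apply_symm_apply⟩

end

end TilingGroupoid

namespace TilingGroupoid

open Metric

/-! ## Countable closed partitions -/

/-- A nonempty complete normed space is not the disjoint union of countably many closed proper
subsets. -/
theorem exists_eq_univ_of_closed_partition {E : Type*} [NormedAddCommGroup E] [NormedSpace ℝ E]
    [CompleteSpace E] {ι : Type*} [Countable ι] {A : ι → Set E} (hc : ∀ i, IsClosed (A i))
    (hd : ∀ i j x, x ∈ A i → x ∈ A j → i = j) (hu : ⋃ i, A i = Set.univ) :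
    ∃ i, A i = Set.univ := by
  have hmem : ∀ x, ∃ i, x ∈ A i := fun x => Set.mem_iUnion.1 (hu ▸ Set.mem_univ x)
  by_contra! hn
  set F : Set E := (⋃ i, interior (A i))ᶜ
  have hFc : IsClosed F := (isOpen_iUnion fun i => isOpen_interior).isClosed_compl
  have hFmem : ∀ {i x}, x ∈ A i → x ∉ interior (A i) → x ∈ F := by
    intro i x hx hxi hxF
    obtain ⟨j, hj⟩ := Set.mem_iUnion.1 hxF
    exact hxi (hd j i x (interior_subset hj) hx ▸ hj)
  have hFne : Nonempty F := by
    obtain ⟨i, hi⟩ := hmem 0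
    by_contra hne
    have ho : IsOpen (A i) := by
      refine isOpen_iff_mem_nhds.2 fun x hx => mem_interior_iff_mem_nhds.1 ?_
      by_contra hxi
      exact hne ⟨x, hFmem hx hxi⟩
    exact hn i (IsClopen.eq_univ ⟨hc i, ho⟩ ⟨0, hi⟩)
  have : CompleteSpace F := hFc.completeSpace_coe
  -- Baire's theorem in the closed set `F` of points interior to no member: some `A i` contains all
  -- of `F` within a ball about `x ∈ F`.
  obtain ⟨i, ⟨x, hxF⟩, hx⟩ := nonempty_interior_of_iUnion_of_closed
    (f := fun i => (Subtype.val ⁻¹' A i : Set F)) (fun i => (hc i).preimage continuous_subtype_val)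
    (by rw [← Set.preimage_iUnion, hu, Set.preimage_univ])
  obtain ⟨ε, hε, hball⟩ := Metric.mem_nhds_iff.1 (mem_interior_iff_mem_nhds.1 hx)
  have hxi : x ∈ A i := hball (mem_ball_self hε)
  have hxn : x ∉ interior (A i) := fun h => hxF (Set.mem_iUnion.2 ⟨i, h⟩)
  obtain ⟨y, hy, hyi⟩ : ∃ y ∈ ball x ε, y ∉ A i := by
    by_contra! hcon
    exact hxn (mem_interior_iff_mem_nhds.2 (Filter.mem_of_superset (ball_mem_nhds x hε) hcon))
  obtain ⟨j, hj⟩ := hmem y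
  have hji : j ≠ i := by rintro rfl; exact hyi hj
  -- `A j` meets the connected ball but misses its centre, so it has a boundary point there. That
  -- point belongs to `F`, hence to `A i`, contradicting disjointness.
  obtain ⟨z, hz, hzf⟩ : (ball x ε ∩ frontier (A j)).Nonempty := by
    by_contra hne
    have hint : ∀ z ∈ ball x ε, z ∈ A j → z ∈ interior (A j) := by
      intro z hz hzj
      by_contra hzi
      exact hne ⟨z, hz, subset_closure hzj, hzi⟩
    obtain ⟨z, -, h1, h2⟩ := (convex_ball x ε).isPreconnected (interior (A j)) (A j)ᶜ
      isOpen_interior (hc j).isOpen_compl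
      (fun z hz => (em (z ∈ A j)).imp (hint z hz) id) ⟨y, hy, hint y hy hj⟩
      ⟨x, mem_ball_self hε, fun h => hji (hd j i x h hxi)⟩
    exact h2 (interior_subset h1)
  have hzj : z ∈ A j := (hc j).frontier_subset hzf
  exact hji (hd j i z hzj (hball (show (⟨z, hFmem hzj hzf.2⟩ : F) ∈ ball _ ε from hz)))

/-! ## Geometry of tilings -/

variable {d : ℕ} {δ : Type w} {T : Tiling d δ}

namespace Tile

theorem isClosed (t : Tile d δ) : IsClosed t.carrier := t.closure_interior ▸ isClosed_closure

theorem nonempty (t : Tile d δ) : t.carrier.Nonempty := t.isConnected.nonempty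

theorem nonempty_interior (t : Tile d δ) : (interior t.carrier).Nonempty := by
  rw [← closure_nonempty_iff, t.closure_interior]
  exact t.nonempty

theorem vadd_mem_iff {t : Tile d δ} {x z : EuclideanSpace ℝ (Fin d)} :
    x + z ∈ (x +ᵥ t).carrier ↔ z ∈ t.carrier :=
  Set.vadd_mem_vadd_set_iff (a := x) (x := z) (s := t.carrier)

theorem interior_vadd' (t : Tile d δ) (x : EuclideanSpace ℝ (Fin d)) :
    interior (x +ᵥ t).carrier = x +ᵥ interior t.carrier := interior_vadd x t.carrier

end Tile

theorem Tiling.eq_of_mem_interior {s t : Tile d δ} (hs : s ∈ T.tiles) (ht : t ∈ T.tiles)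
    {z : EuclideanSpace ℝ (Fin d)} (hz : z ∈ interior s.carrier) (hz' : z ∈ t.carrier) :
    s = t := by
  by_contra hne
  exact (T.overlap hs ht hne ⟨interior_subset hz, hz'⟩).1.2 hz

theorem Tiling.exists_mem (T : Tiling d δ) (z : EuclideanSpace ℝ (Fin d)) :
    ∃ t ∈ T.tiles, z ∈ t.carrier := by
  have := T.covers.symm ▸ Set.mem_univ z
  simpa using this

theorem Tiling.countable_tiles (T : Tiling d δ) : T.tiles.Countable := by
  refine Set.PairwiseDisjoint.countable_of_isOpen (s := fun t : Tile d δ => interior t.carrier)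
    (fun s hs t ht hne => Set.disjoint_left.2 fun z hz hz' => ?_)
    (fun t _ => isOpen_interior) fun t _ => t.nonempty_interior
  exact hne (T.eq_of_mem_interior hs ht hz (interior_subset hz'))

/-- Uniform bounds for the size of the tiles of finitely many translation types. -/
theorem exists_tile_bounds {K B : Set (Tile d δ)} (hB : B.Finite)
    (hK : ∀ t ∈ K, ∃ b ∈ B, ∃ x : EuclideanSpace ℝ (Fin d), x +ᵥ b = t) :
    ∃ ρ D : ℝ, 0 < ρ ∧ ∀ t ∈ K, ∃ q, ball q ρ ⊆ interior t.carrier ∧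
      t.carrier ⊆ closedBall q D := by
  choose p hp using fun t : Tile d δ => t.nonempty_interior
  have h1 : ∀ᶠ ρ in nhdsWithin (0 : ℝ) (Set.Ioi 0), ∀ b ∈ B, ball (p b) ρ ⊆ interior b.carrier := by
    refine (Filter.eventually_all_finite hB).2 fun b _ => ?_
    obtain ⟨ε, hε, hb⟩ := Metric.isOpen_iff.1 isOpen_interior (p b) (hp b)
    filter_upwards [Ioo_mem_nhdsGT hε] with ρ hρ
    exact (ball_subset_ball hρ.2.le).trans hb
  have h2 : ∀ᶠ D in (Filter.atTop : Filter ℝ), ∀ b ∈ B, b.carrier ⊆ closedBall (p b) D := by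
    refine (Filter.eventually_all_finite hB).2 fun b _ => ?_
    obtain ⟨r, hr⟩ := b.isBounded.subset_closedBall (p b)
    filter_upwards [Filter.eventually_ge_atTop r] with D hD
    exact hr.trans (closedBall_subset_closedBall hD)
  obtain ⟨ρ, hρ, hρ0⟩ := (h1.and self_mem_nhdsWithin).exists
  obtain ⟨D, hD⟩ := h2.exists
  refine ⟨ρ, D, hρ0, fun t ht => ?_⟩
  obtain ⟨b, hb, x, rfl⟩ := hK t ht
  refine ⟨x + p b, fun z hz => ?_, ?_⟩
  · rw [Tile.interior_vadd']
    refine ⟨-x + z, hρ b hb ?_, by simp⟩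
    rw [mem_ball, dist_eq_norm] at hz ⊢
    convert hz using 2
    abel
  · rintro _ ⟨z, hz, rfl⟩
    have := hD b hb hz
    simpa [mem_closedBall] using this

/-- A packing argument: tiles of finitely many types contain balls of a common radius `ρ` about
points `q t`. Two tiles for which `q t - x` is close to the same point of a finite `ρ / 2`-net
coincide. The net covers a ball about the origin, so the bound does not depend on `x`. -/
theorem Tiling.exists_ncard_le {K B : Set (Tile d δ)} (hB : B.Finite)
    (hK : ∀ t ∈ K, ∃ b ∈ B, ∃ x : EuclideanSpace ℝ (Fin d), x +ᵥ b = t) (hKT : K ⊆ T.tiles)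
    (R : ℝ) : ∃ N : ℕ, ∀ x, {t ∈ K | (t.carrier ∩ closedBall x R).Nonempty}.Finite ∧
      {t ∈ K | (t.carrier ∩ closedBall x R).Nonempty}.ncard ≤ N := by
  obtain ⟨ρ, D, hρ, hKb⟩ := exists_tile_bounds hB hK
  choose! q hq hqD using hKb
  obtain ⟨Z, -, hZf, hZ⟩ := finite_cover_balls_of_compact
    (isCompact_closedBall (0 : EuclideanSpace ℝ (Fin d)) (D + R)) (half_pos hρ)
  have key : ∀ x, ∃ g : Tile d δ → EuclideanSpace ℝ (Fin d),
      Set.MapsTo g {t ∈ K | (t.carrier ∩ closedBall x R).Nonempty} Z ∧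
      Set.InjOn g {t ∈ K | (t.carrier ∩ closedBall x R).Nonempty} := by
    intro x
    have hg : ∀ t ∈ {t ∈ K | (t.carrier ∩ closedBall x R).Nonempty},
        ∃ z ∈ Z, dist (q t - x) z < ρ / 2 := by
      rintro t ⟨htK, y, hyt, hyx⟩
      have h1 : q t - x ∈ closedBall (0 : EuclideanSpace ℝ (Fin d)) (D + R) := by
        rw [mem_closedBall, dist_zero_right, ← dist_eq_norm]
        have h2 := hqD t htK hyt
        rw [mem_closedBall] at h2 hyx
        linarith [dist_triangle_left (q t) x y]
      simpa using hZ h1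
    choose! g hgZ hgd using hg
    refine ⟨g, hgZ, fun s hs t ht hst => ?_⟩
    have h1 := hgd s hs
    have h2 := hgd t ht
    rw [← hst] at h2
    have h3 : dist (q t) (q s) < ρ := by
      rw [← dist_sub_right (q t) (q s) x]
      linarith [dist_triangle_right (q t - x) (q s - x) (g s)]
    exact T.eq_of_mem_interior (hKT hs.1) (hKT ht.1) (hq s hs.1 h3)
      (interior_subset (hq t ht.1 (mem_ball_self hρ)))
  refine ⟨Z.ncard, fun x => ?_⟩
  obtain ⟨g, hgZ, hgi⟩ := key x
  exact ⟨Set.Finite.of_injOn hgZ hgi hZf, Set.ncard_le_ncard_of_injOn g hgZ hgi hZf⟩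

/-- The pattern consisting of two given tiles. -/
def pairPattern {s t : Tile d δ} (hs : s ∈ T.tiles) (ht : t ∈ T.tiles) : PointedPattern T :=
  ⟨{s, t}, s, t, by simp, Set.insert_subset hs (Set.singleton_subset_iff.2 ht), by simp, by simp⟩

namespace Tiling.FiniteType

theorem pairPattern_mem {s t : Tile d δ} (hs : s ∈ T.tiles) (ht : t ∈ T.tiles) (hne : s ≠ t)
    (h : (s.carrier ∩ t.carrier).Nonempty) :
    (pairPattern hs ht).cls ∈ {c : PatternClass T | ∃ p : PointedPattern T, p.cls = c ∧
      p.tiles.ncard = 2 ∧ IsConnected (⋃ t ∈ p.tiles, t.carrier)} := by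
  refine ⟨_, rfl, Set.ncard_pair hne, ?_⟩
  change IsConnected (⋃ u ∈ ({s, t} : Set (Tile d δ)), u.carrier)
  rw [Set.biUnion_pair]
  exact IsConnected.union h s.isConnected t.isConnected

theorem exists_types_of_touching (hT : T.FiniteType) :
    ∃ B : Set (Tile d δ), B.Finite ∧ ∀ s ∈ T.tiles,
      (∃ t ∈ T.tiles, s ≠ t ∧ (s.carrier ∩ t.carrier).Nonempty) →
      ∃ b ∈ B, ∃ x : EuclideanSpace ℝ (Fin d), x +ᵥ b = s := by
  refine ⟨_, Set.Finite.image (fun c : PatternClass T => (Quotient.out c).fst) hT, ?_⟩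
  rintro s hs ⟨t, ht, hne, h⟩
  refine ⟨_, ⟨_, pairPattern_mem hs ht hne h, rfl⟩, ?_⟩
  have : (Quotient.out (pairPattern hs ht).cls).cls = (pairPattern hs ht).cls :=
    Quotient.out_eq _
  obtain ⟨x, -, hx, -⟩ := cls_eq_iff.1 this
  exact ⟨x, hx⟩

/-- Every tile touches another one. -/
theorem exists_touching (hT : T.FiniteType) {s : Tile d δ} (hs : s ∈ T.tiles) :
    ∃ t ∈ T.tiles, s ≠ t ∧ (s.carrier ∩ t.carrier).Nonempty := by
  by_contra hiso
  set K : Set (Tile d δ) := {s ∈ T.tiles | ∃ t ∈ T.tiles, s ≠ t ∧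
    (s.carrier ∩ t.carrier).Nonempty} with hK
  obtain ⟨B, hB, hBK⟩ := hT.exists_types_of_touching
  have hsub : T.tiles \ K ⊆ T.tiles := Set.sdiff_subset
  have : Countable ↥(T.tiles \ K) := (T.countable_tiles.mono hsub).to_subtype
  have hdisj : ∀ u ∈ T.tiles \ K, ∀ v ∈ T.tiles, ∀ z, z ∈ u.carrier → z ∈ v.carrier → u = v := by
    intro u hu v hv z hzu hzv
    by_contra hne
    exact hu.2 ⟨hu.1, v, hv, hne, z, hzu, hzv⟩
  have hWc : IsClosed (⋃ t : K, (t : Tile d δ).carrier) := by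
    refine LocallyFinite.isClosed_iUnion (fun x => ?_) fun t => t.1.isClosed
    refine ⟨closedBall x 1, closedBall_mem_nhds x one_pos, ?_⟩
    obtain ⟨N, hN⟩ := Tiling.exists_ncard_le (T := T) hB (K := K) (fun t ht => hBK t ht.1 ht.2)
      (fun t ht => ht.1) 1
    refine Set.Finite.of_injOn (f := Subtype.val) ?_ Subtype.val_injective.injOn (hN x).1
    exact fun t ht => ⟨t.2, ht⟩
  -- Space is partitioned into the countably many isolated tiles and one further closed set, the
  -- union of all touching tiles, indexed by `none`. One piece must be everything; it is then `s`,
  -- which leaves no room for a second tile.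
  let A : Option ↥(T.tiles \ K) → Set (EuclideanSpace ℝ (Fin d)) := fun i =>
    i.elim (⋃ t : K, (t : Tile d δ).carrier) fun t => t.1.carrier
  have hAd : ∀ i j x, x ∈ A i → x ∈ A j → i = j := by
    have h1 : ∀ (u : ↥(T.tiles \ K)) x, x ∈ u.1.carrier → x ∈ ⋃ t : K, (t : Tile d δ).carrier →
        False := by
      intro u x hxu hx
      obtain ⟨t, ht⟩ := Set.mem_iUnion.1 hx
      have := hdisj u u.2 t t.2.1 x hxu ht
      exact u.2.2 (this ▸ t.2)
    rintro (_ | u) (_ | v) x hx hx'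
    · rfl
    · exact (h1 v x hx' hx).elim
    · exact (h1 u x hx hx').elim
    · exact congrArg some (Subtype.ext (hdisj u u.2 v v.2.1 x hx hx'))
  obtain ⟨i, hi⟩ := exists_eq_univ_of_closed_partition (A := A) (by
    rintro (_ | u)
    · exact hWc
    · exact u.1.isClosed) hAd (by
    refine Set.eq_univ_of_forall fun z => ?_
    obtain ⟨t, ht, hz⟩ := T.exists_mem z
    by_cases htK : t ∈ K
    · exact Set.mem_iUnion.2 ⟨none, Set.mem_iUnion.2 ⟨⟨t, htK⟩, hz⟩⟩
    · exact Set.mem_iUnion.2 ⟨some ⟨t, ht, htK⟩, hz⟩)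
  have hsK : s ∈ T.tiles \ K := ⟨hs, fun h => hiso h.2⟩
  obtain ⟨z, hz⟩ := s.nonempty
  have his : i = some ⟨s, hsK⟩ := hAd i _ z (hi ▸ Set.mem_univ z) hz
  subst his
  obtain ⟨t, ht, hts⟩ := T.infinite.exists_notMem_finite (Set.finite_singleton s)
  obtain ⟨y, hy⟩ := t.nonempty
  have hys : y ∈ s.carrier := (Set.ext_iff.1 hi y).2 trivial
  exact hts (hdisj s hsK t ht y hys hy).symm

theorem exists_ncard_le (hT : T.FiniteType) (R : ℝ) :
    ∃ N : ℕ, ∀ x, {t ∈ T.tiles | (t.carrier ∩ closedBall x R).Nonempty}.Finite ∧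
      {t ∈ T.tiles | (t.carrier ∩ closedBall x R).Nonempty}.ncard ≤ N := by
  obtain ⟨B, hB, hBK⟩ := hT.exists_types_of_touching
  exact Tiling.exists_ncard_le hB (fun t ht => hBK t ht (hT.exists_touching ht)) subset_rfl R

end Tiling.FiniteType

/-- Tiles of a tiling that are linked by a chain of `n` touching tiles. -/
def Tiling.Linked (T : Tiling d δ) : ℕ → Tile d δ → Tile d δ → Prop
  | 0, s, t => s ∈ T.tiles ∧ s = t
  | n + 1, s, t => ∃ u, T.Linked n s u ∧ t ∈ T.tiles ∧ (u.carrier ∩ t.carrier).Nonempty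

namespace Tiling.Linked

variable {n m : ℕ} {s t : Tile d δ}

theorem mem (h : T.Linked n s t) : s ∈ T.tiles ∧ t ∈ T.tiles := by
  induction n generalizing t with
  | zero => exact ⟨h.1, h.2 ▸ h.1⟩
  | succ n ih =>
    obtain ⟨u, hu, ht, -⟩ := h
    exact ⟨(ih hu).1, ht⟩

theorem mono (h : T.Linked n s t) (hnm : n ≤ m) : T.Linked m s t := by
  induction hnm with
  | refl => exact h
  | step _ ih => exact ⟨t, ih, ih.mem.2, by simpa using t.nonempty⟩

end Tiling.Linked

/-- Tiles at bounded distance are linked by chains of bounded length. -/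
theorem Tiling.FiniteType.exists_linked (hT : T.FiniteType) (R : ℝ) :
    ∃ N : ℕ, ∀ s ∈ T.tiles, ∀ t ∈ T.tiles, ∀ x ∈ s.carrier, ∀ y ∈ t.carrier, dist x y ≤ R →
      T.Linked N s t := by
  obtain ⟨N, hN⟩ := hT.exists_ncard_le R
  refine ⟨N, fun s hs t ht x hx y hy hxy => ?_⟩
  obtain ⟨hfin, hcard⟩ := hN x
  set V := {t ∈ T.tiles | (t.carrier ∩ closedBall x R).Nonempty}
  have hR : 0 ≤ R := dist_nonneg.trans hxy
  have hsV : s ∈ V := ⟨hs, x, hx, mem_closedBall_self hR⟩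
  have htV : t ∈ V := ⟨ht, y, hy, by rwa [mem_closedBall, dist_comm]⟩
  have : Fintype V := hfin.fintype
  let G : SimpleGraph V := SimpleGraph.fromRel fun u v => (u.1.carrier ∩ v.1.carrier).Nonempty
  have hadj : ∀ {u v : V}, G.Adj u v → (u.1.carrier ∩ v.1.carrier).Nonempty := by
    intro u v h
    rcases ((SimpleGraph.fromRel_adj _ _ _).1 h).2 with h | h
    · exact h
    · rwa [Set.inter_comm]
  have hreach : G.Reachable ⟨s, hsV⟩ ⟨t, htV⟩ := by
    by_contra hn
    -- The tiles reachable from `s` and the others form two finite closed unions covering the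
    -- connected segment from `x` to `y`, so a reachable tile touches an unreachable one.
    have hclosed : ∀ P : V → Prop, IsClosed (⋃ u ∈ {u : V | P u}, u.1.carrier) := fun P =>
      (Set.toFinite _).isClosed_biUnion fun u _ => u.1.isClosed
    have hseg : segment ℝ x y ⊆ closedBall x R :=
      (convex_closedBall x R).segment_subset (mem_closedBall_self hR)
        (by rwa [mem_closedBall, dist_comm])
    obtain ⟨z, -, hz₁, hz₂⟩ := isPreconnected_closed_iff.1 (convex_segment x y).isPreconnected
      _ _ (hclosed fun u => G.Reachable ⟨s, hsV⟩ u) (hclosed fun u => ¬ G.Reachable ⟨s, hsV⟩ u)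
      (fun z hz => by
        obtain ⟨u, hu, hzu⟩ := T.exists_mem z
        have huV : u ∈ V := ⟨hu, z, hzu, hseg hz⟩
        by_cases h : G.Reachable ⟨s, hsV⟩ ⟨u, huV⟩
        · exact Or.inl (Set.mem_biUnion (x := (⟨u, huV⟩ : V)) h hzu)
        · exact Or.inr (Set.mem_biUnion (x := (⟨u, huV⟩ : V)) h hzu))
      ⟨x, left_mem_segment ℝ x y, Set.mem_biUnion (x := (⟨s, hsV⟩ : V))
        (SimpleGraph.Reachable.refl _) hx⟩
      ⟨y, right_mem_segment ℝ x y, Set.mem_biUnion (x := (⟨t, htV⟩ : V)) hn hy⟩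
    simp only [Set.mem_iUnion, Set.mem_ofPred_eq] at hz₁ hz₂
    obtain ⟨u, hu, hzu⟩ := hz₁
    obtain ⟨v, hv, hzv⟩ := hz₂
    refine hv (hu.trans ?_)
    by_cases huv : u = v
    · rw [huv]
    · exact SimpleGraph.Adj.reachable
        ((SimpleGraph.fromRel_adj _ _ _).2 ⟨huv, Or.inl ⟨z, hzu, hzv⟩⟩)
  have hwalk : ∀ {u v : V} (w : G.Walk u v), T.Linked w.length v.1 u.1 := by
    intro u v w
    induction w with
    | @nil u => exact ⟨u.2.1, rfl⟩
    | @cons u v' v h w ih =>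
      exact ⟨v'.1, ih, u.2.1, by rw [Set.inter_comm]; exact hadj h⟩
  obtain ⟨w, hw⟩ := hreach.symm.exists_isPath
  -- A path repeats no vertex, so its length is less than the number of tiles in `V`, which is at
  -- most `N`.
  refine (hwalk w).mono (hw.length_lt.le.trans ?_)
  rwa [← Nat.card_eq_fintype_card]

end TilingGroupoid

namespace TilingGroupoid

open AlmostGroupoid Metric

variable {d : ℕ} {δ : Type w} {T : Tiling d δ}

/-! ## The order and the products of pattern classes -/

theorem mul_eq_some_iff {a b c : PatternClass T} : mul a b = some c ↔ IsProduct a b c :=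
  patternMul_eq_some

theorem mul_cls {p q : PointedPattern T} (h : p.snd = q.fst) :
    mul p.cls q.cls = some (p.union q).cls :=
  mul_eq_some_iff.2 ⟨p, q, rfl, rfl, h, rfl⟩

theorem exists_cls (c : PatternClass T) : ∃ p : PointedPattern T, p.cls = c :=
  Quotient.exists_rep c

theorem IsTranslate.symm {x : EuclideanSpace ℝ (Fin d)} {p q : PointedPattern T}
    (h : IsTranslate x p q) : IsTranslate (-x) q p :=
  ⟨by rw [← h.1, neg_vadd_vadd], by rw [← h.2.1, neg_vadd_vadd], by rw [← h.2.2, neg_vadd_vadd]⟩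

/-- `p ≤ q` if and only if `p` contains a translate of `q` with the same chosen tiles. -/
theorem cls_le_iff {p q : PointedPattern T} : p.cls ≤ q.cls ↔
    ∃ q' : PointedPattern T, q'.cls = q.cls ∧ q'.tiles ⊆ p.tiles ∧ q'.fst = p.fst ∧
      q'.snd = p.snd := by
  have hpp : mul p.cls (inv p.cls) = some (p.union p.swap).cls := mul_cls (q := p.swap) rfl
  constructor
  · intro h
    have h' : mul p.cls (inv q.cls) = some (p.union p.swap).cls := Eq.trans h hpp
    obtain ⟨p₁, q₁, hp₁, hq₁, hpq, hu⟩ := mul_eq_some_iff.1 h'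
    change q₁.cls = q.swap.cls at hq₁
    obtain ⟨x, x1, x2, x3⟩ := cls_eq_iff.1 hp₁
    obtain ⟨y, y1, y2, y3⟩ := cls_eq_iff.1 hu
    have hxy : y = x := eq_of_vadd_eq_vadd (t := p₁.fst) (y2.trans x2.symm)
    subst hxy
    have hsub : y +ᵥ q₁.tiles ⊆ p.tiles := by
      refine (Set.vadd_set_mono (Set.subset_union_right (s := p₁.tiles))).trans ?_
      have : y +ᵥ (p₁.tiles ∪ q₁.tiles) = p.tiles ∪ p.tiles := y1
      rw [this, Set.union_self]
    obtain ⟨r, hr⟩ := exists_translate hsub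
    refine ⟨r.swap, ?_, ?_, ?_, ?_⟩
    · have h1 : r.cls = q.swap.cls := (cls_eq_iff.2 ⟨y, hr⟩).symm.trans hq₁
      exact congrArg patternInv h1
    · change r.tiles ⊆ p.tiles
      rw [← hr.1]; exact hsub
    · exact hr.2.2.symm.trans y3
    · exact hr.2.1.symm.trans (hpq ▸ x3)
  · rintro ⟨q', hq, hsub, hf, hs⟩
    have h1 : mul p.cls (inv q'.cls) = some (p.union q'.swap).cls :=
      mul_cls (q := q'.swap) hs.symm
    have h2 : p.union q'.swap = p.union p.swap := by
      refine PointedPattern.ext ?_ rfl hf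
      change p.tiles ∪ q'.tiles = p.tiles ∪ p.tiles
      rw [Set.union_eq_self_of_subset_right hsub, Set.union_self]
    change mul p.cls (inv q.cls) = mul p.cls (inv p.cls)
    rw [← hq, h1, h2, hpp]

theorem cls_le_of_subset {p q : PointedPattern T} (h : q.tiles ⊆ p.tiles) (hf : q.fst = p.fst)
    (hs : q.snd = p.snd) : p.cls ≤ q.cls := cls_le_iff.2 ⟨q, rfl, h, hf, hs⟩

theorem exists_rep_of_le {c : PatternClass T} {p : PointedPattern T} (h : c ≤ p.cls) :
    ∃ r p' : PointedPattern T, r.cls = c ∧ p'.cls = p.cls ∧ p'.tiles ⊆ r.tiles ∧ p'.fst = r.fst ∧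
      p'.snd = r.snd := by
  obtain ⟨r, rfl⟩ := exists_cls c
  obtain ⟨p', h⟩ := cls_le_iff.1 h
  exact ⟨r, p', rfl, h⟩

theorem isUnitElt_cls_iff {p : PointedPattern T} : IsUnitElt p.cls ↔ p.fst = p.snd := by
  constructor
  · rintro ⟨x, hx⟩
    obtain ⟨r, rfl⟩ := exists_cls x
    have h : mul r.cls (inv r.cls) = some (r.union r.swap).cls := mul_cls (q := r.swap) rfl
    rw [h, Option.some_inj] at hx
    obtain ⟨x, -, x2, x3⟩ := cls_eq_iff.1 hx
    exact x2.symm.trans x3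
  · intro h
    refine ⟨p.cls, (mul_cls (q := p.swap) rfl).trans (congrArg some (congrArg _ ?_))⟩
    exact PointedPattern.ext (Set.union_self _) rfl h

theorem isUnitary_patternClass (T : Tiling d δ) : IsUnitary (PatternClass T) := by
  intro e c he h
  obtain ⟨q, rfl⟩ := exists_cls c
  obtain ⟨r, q', rfl, hq, -, hf, hs⟩ := exists_rep_of_le h
  rw [isUnitElt_cls_iff] at he
  rw [← hq, isUnitElt_cls_iff, hf, hs, he]

theorem finite_cls_of_subset {S : Set (Tile d δ)} (hS : S.Finite) :
    {c : PatternClass T | ∃ p : PointedPattern T, p.cls = c ∧ p.tiles ⊆ S}.Finite := by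
  have h : {p : PointedPattern T | p.tiles ⊆ S}.Finite := by
    refine Set.Finite.of_injOn (f := fun p => (p.tiles, p.fst, p.snd))
      (t := 𝒫 S ×ˢ S ×ˢ S) (fun p hp => ⟨hp, hp p.fst_mem, hp p.snd_mem⟩) (fun p _ q _ hpq => ?_)
      (hS.finite_subsets.prod (hS.prod hS))
    simp only [Prod.mk.injEq] at hpq
    exact PointedPattern.ext hpq.1 hpq.2.1 hpq.2.2
  refine (h.image PointedPattern.cls).subset ?_
  rintro _ ⟨p, rfl, hp⟩
  exact ⟨p, hp, rfl⟩

theorem finite_left_factors (c : PatternClass T) : {p | ∃ q, mul p q = some c}.Finite := by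
  obtain ⟨r, rfl⟩ := exists_cls c
  refine (finite_cls_of_subset r.finite).subset ?_
  rintro _ ⟨_, h⟩
  obtain ⟨p, q, rfl, rfl, hpq, hu⟩ := mul_eq_some_iff.1 h
  obtain ⟨x, x1, -, -⟩ := cls_eq_iff.1 hu
  have hsub : x +ᵥ p.tiles ⊆ r.tiles :=
    (Set.vadd_set_mono (Set.subset_union_left (t := q.tiles))).trans x1.le
  obtain ⟨p', hp'⟩ := exists_translate hsub
  exact ⟨p', (cls_eq_iff.2 ⟨x, hp'⟩).symm, hp'.1 ▸ hsub⟩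

/-! ### Pairs of tiles -/

/-- The class of the pattern consisting of two given tiles. -/
def pairCls {s t : Tile d δ} (hs : s ∈ T.tiles) (ht : t ∈ T.tiles) : PatternClass T :=
  (pairPattern hs ht).cls

/-- The class of the pair of chosen tiles of a pattern. -/
def PointedPattern.pair (p : PointedPattern T) : PatternClass T :=
  pairCls (p.subset p.fst_mem) (p.subset p.snd_mem)

theorem pairCls_eq_iff {s t s' t' : Tile d δ} {hs : s ∈ T.tiles} {ht : t ∈ T.tiles}
    {hs' : s' ∈ T.tiles} {ht' : t' ∈ T.tiles} :
    pairCls hs ht = pairCls hs' ht' ↔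
      ∃ x : EuclideanSpace ℝ (Fin d), x +ᵥ s = s' ∧ x +ᵥ t = t' := by
  constructor
  · intro h
    obtain ⟨x, -, x2, x3⟩ := cls_eq_iff.1 h
    exact ⟨x, x2, x3⟩
  · rintro ⟨x, x2, x3⟩
    refine cls_eq_iff.2 ⟨x, ?_, x2, x3⟩
    change x +ᵥ ({s, t} : Set (Tile d δ)) = {s', t'}
    rw [← x2, ← x3]
    exact Set.image_pair _ _ _

theorem pair_eq_of_cls_eq {p q : PointedPattern T} (h : p.cls = q.cls) : p.pair = q.pair := by
  obtain ⟨x, -, x2, x3⟩ := cls_eq_iff.1 h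
  exact pairCls_eq_iff.2 ⟨x, x2, x3⟩

theorem cls_le_pair (p : PointedPattern T) : p.cls ≤ p.pair :=
  cls_le_of_subset (Set.insert_subset p.fst_mem (Set.singleton_subset_iff.2 p.snd_mem)) rfl rfl

theorem pair_eq_of_le {p q : PointedPattern T} (h : p.cls ≤ q.cls) : p.pair = q.pair := by
  obtain ⟨q', hq, -, hf, hs⟩ := cls_le_iff.1 h
  rw [← pair_eq_of_cls_eq hq]
  exact pairCls_eq_iff.2 ⟨0, by rw [zero_vadd, hf], by rw [zero_vadd, hs]⟩

theorem pair_eq_of_compatible {p q : PointedPattern T} (h : Compatible p.cls q.cls) :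
    p.pair = q.pair := by
  obtain ⟨c, h1, h2⟩ := h
  obtain ⟨r, rfl⟩ := exists_cls c
  exact (pair_eq_of_le h1).symm.trans (pair_eq_of_le h2)

/-- Passing to a larger or smaller class does not change the relative position of the chosen tiles,
so compatible classes have the same pair. -/
theorem isPrimitive_pairCls {s t : Tile d δ} (hs : s ∈ T.tiles) (ht : t ∈ T.tiles) :
    IsPrimitive (pairCls hs ht) := by
  intro z hz
  obtain ⟨p, rfl⟩ := exists_cls z
  have : p.pair = (pairPattern hs ht).pair := pair_eq_of_compatible hz
  exact (cls_le_pair p).trans this.le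

theorem IsPrimitive.eq_pair {p : PointedPattern T} (h : IsPrimitive p.cls) : p.cls = p.pair :=
  h.eq_of_compatible (isPrimitive_pairCls _ _) ⟨p.cls, le_rfl, cls_le_pair p⟩

/-- A pattern is assembled as a star: for each tile `t`, go from the first chosen tile to `t` and
back, and at the end go to the second chosen tile. -/
theorem exists_primitive_list_patternClass (c : PatternClass T) :
    ∃ l : List (PatternClass T), (∀ v ∈ l, IsPrimitive v) ∧ listProd l = some c := by
  set Gen : Set (PatternClass T) :=
    {c | ∃ l : List (PatternClass T), (∀ v ∈ l, IsPrimitive v) ∧ listProd l = some c} with hGen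
  have hpair : ∀ {s t : Tile d δ} (hs : s ∈ T.tiles) (ht : t ∈ T.tiles), pairCls hs ht ∈ Gen :=
    fun hs ht => ⟨[pairCls hs ht], by simpa using isPrimitive_pairCls hs ht, rfl⟩
  have hmul : ∀ {p q : PointedPattern T}, p.cls ∈ Gen → q.cls ∈ Gen → p.snd = q.fst →
      (p.union q).cls ∈ Gen := by
    rintro p q ⟨l, hl, hp⟩ ⟨l', hl', hq⟩ h
    refine ⟨l ++ l', fun v hv => (List.mem_append.1 hv).elim (hl v) (hl' v), ?_⟩
    rw [listProd_append_eq hp hq, mul_cls h]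
  obtain ⟨p, rfl⟩ := exists_cls c
  have key : ∀ q : PointedPattern T, q.tiles = insert p.fst p.tiles → q.fst = p.fst →
      q.snd = p.fst → q.cls ∈ Gen := by
    refine Set.Finite.induction_on_subset (motive := fun S _ => ∀ q : PointedPattern T,
      q.tiles = insert p.fst S → q.fst = p.fst → q.snd = p.fst → q.cls ∈ Gen) p.tiles p.finite
      ?_ ?_
    · intro q h1 h2 h3
      have hp := p.subset p.fst_mem
      have : q = pairPattern hp hp := PointedPattern.ext (by rw [h1]; simp [pairPattern]) h2 h3
      rw [this]
      exact hpair hp hp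
    · intro t S ht hS _ ih q h1 h2 h3
      have hp := p.subset p.fst_mem
      have htT := p.subset ht
      let r : PointedPattern T := ⟨insert p.fst S, p.fst, p.fst,
        p.finite.subset (Set.insert_subset p.fst_mem hS),
        (Set.insert_subset p.fst_mem hS).trans p.subset, Set.mem_insert _ _, Set.mem_insert _ _⟩
      have : q = (r.union (pairPattern hp htT)).union (pairPattern htT hp) := by
        refine PointedPattern.ext ?_ h2 h3
        rw [h1]
        change insert p.fst (insert t S) = insert p.fst S ∪ {p.fst, t} ∪ {t, p.fst}
        ext u
        simp only [Set.mem_insert_iff, Set.mem_union, Set.mem_singleton_iff]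
        tauto
      rw [this]
      exact hmul (hmul (ih r rfl rfl rfl) (hpair hp htT) rfl) (hpair htT hp) rfl
  let q : PointedPattern T := ⟨p.tiles, p.fst, p.fst, p.finite, p.subset, p.fst_mem, p.fst_mem⟩
  have hq := hmul (key q (Set.insert_eq_of_mem p.fst_mem).symm rfl rfl)
    (hpair (p.subset p.fst_mem) (p.subset p.snd_mem)) rfl
  have : q.union (pairPattern (p.subset p.fst_mem) (p.subset p.snd_mem)) = p := by
    refine PointedPattern.ext ?_ rfl rfl
    change p.tiles ∪ {p.fst, p.snd} = p.tiles
    exact Set.union_eq_self_of_subset_right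
      (Set.insert_subset p.fst_mem (Set.singleton_subset_iff.2 p.snd_mem))
  rwa [this] at hq

/-- Classes of patterns all of whose tiles have relative positions in `A`, with respect to the
first chosen tile. -/
def localClasses (A : Set (PatternClass T)) : Set (PatternClass T) :=
  {c | ∃ p : PointedPattern T, p.cls = c ∧ p.pair ∈ A ∧ ∀ t (ht : t ∈ p.tiles), t = p.fst ∨
    pairCls (p.subset p.fst_mem) (p.subset ht) ∈ A}

/-- A factorisation criterion for the finiteness of an image. -/
theorem finite_image_of_factors {α β γ : Type*} {s : Set α} {g : α → β} {h : α → γ}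
    (hs : (h '' s).Finite) (hg : ∀ a ∈ s, ∀ b ∈ s, h a = h b → g a = g b) : (g '' s).Finite := by
  choose r hrs hr using fun y : ↥(h '' s) => y.2
  have := hs.to_subtype
  refine (Set.finite_range fun y : ↥(h '' s) => g (r y)).subset ?_
  rintro _ ⟨a, ha, rfl⟩
  exact ⟨⟨h a, a, ha, rfl⟩, hg _ (hrs _) _ ha (hr _)⟩

/-- Such a class is determined by its pair and the set of relative positions in `A` that occur: a
translation aligning the first chosen tiles carries one pattern into the other, because no nonzero
translation fixes a tile. -/
theorem finite_localClasses {A : Set (PatternClass T)} (hA : A.Finite) :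
    (localClasses A).Finite := by
  let h : PointedPattern T → PatternClass T × Set (PatternClass T) := fun p =>
    (p.pair, A ∩ {c | ∃ t, ∃ ht : t ∈ p.tiles, pairCls (p.subset p.fst_mem) (p.subset ht) = c})
  have key : ∀ p q : PointedPattern T, (∀ t (ht : t ∈ q.tiles), t = q.fst ∨
      pairCls (q.subset q.fst_mem) (q.subset ht) ∈ A) → h p = h q → p.cls ≤ q.cls := by
    intro p q hq hpq
    simp only [h, Prod.mk.injEq] at hpq
    obtain ⟨h1, h2⟩ := hpq
    obtain ⟨x, x2, x3⟩ := pairCls_eq_iff.1 h1.symm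
    have hsub : x +ᵥ q.tiles ⊆ p.tiles := by
      rintro _ ⟨t, ht, rfl⟩
      rcases hq t ht with rfl | htA
      · change x +ᵥ q.fst ∈ p.tiles
        rw [x2]
        exact p.fst_mem
      · obtain ⟨-, t', ht', e⟩ := h2.ge ⟨htA, t, ht, rfl⟩
        obtain ⟨y, y2, y3⟩ := pairCls_eq_iff.1 e.symm
        have : x = y := eq_of_vadd_eq_vadd (x2.trans y2.symm)
        change x +ᵥ t ∈ p.tiles
        rw [this, y3]
        exact ht'
    obtain ⟨q', hq'⟩ := exists_translate hsub
    exact cls_le_iff.2 ⟨q', (cls_eq_iff.2 ⟨x, hq'⟩).symm, hq'.1 ▸ hsub, hq'.2.1.symm.trans x2,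
      hq'.2.2.symm.trans x3⟩
  let S : Set (PointedPattern T) := {p | p.pair ∈ A ∧ ∀ t (ht : t ∈ p.tiles), t = p.fst ∨
    pairCls (p.subset p.fst_mem) (p.subset ht) ∈ A}
  have hS : (PointedPattern.cls '' S).Finite := by
    refine finite_image_of_factors (h := h) ?_ fun p hp q hq hpq =>
      eq_of_le_of_le (key p q hq.2 hpq) (key q p hp.2 hpq.symm)
    refine (hA.prod hA.finite_subsets).subset ?_
    rintro _ ⟨p, hp, rfl⟩
    exact ⟨hp.1, Set.inter_subset_left⟩
  refine hS.subset ?_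
  rintro _ ⟨p, rfl, hp⟩
  exact ⟨p, hp, rfl⟩

/-- Primitive classes consist only of their two chosen tiles, so multiplying by one adds at most one
tile, the new second chosen tile; its position relative to the first chosen tile is the prescribed
element of `A`. -/
theorem exists_finite_local_patternClass (A : Set (PatternClass T)) (hA : A.Finite)
    (hAp : ∀ v ∈ A, IsPrimitive v) :
    ∃ L : Set (PatternClass T), L.Finite ∧ A ⊆ L ∧ ∀ b ∈ L, ∀ v v' z, IsPrimitive v →
      mul b v = some z → v' ∈ A → z ≤ v' → z ∈ L := by
  have hpair : ∀ {p : PointedPattern T} {v : PatternClass T}, v ∈ A → p.cls ≤ v → p.pair = v := by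
    intro p v hv h
    obtain ⟨r, rfl⟩ := exists_cls v
    rw [pair_eq_of_le h, (hAp _ hv).eq_pair]
  refine ⟨localClasses A, finite_localClasses hA, fun v hv => ?_, ?_⟩
  · obtain ⟨p, rfl⟩ := exists_cls v
    have hp := (hAp _ hv).eq_pair
    refine ⟨pairPattern (p.subset p.fst_mem) (p.subset p.snd_mem), hp.symm, ?_, ?_⟩
    · exact (hp ▸ hv : p.pair ∈ A)
    · rintro t (rfl | rfl)
      · exact Or.inl rfl
      · exact Or.inr (hp ▸ hv : p.pair ∈ A)
  · rintro b ⟨p₀, rfl, hp₀, hp₀A⟩ v v' z hv hz hv' hzv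
    obtain ⟨p, q, hp, rfl, hpq, rfl⟩ := mul_eq_some_iff.1 hz
    have hpairA : (p.union q).pair ∈ A := by rw [hpair hv' hzv]; exact hv'
    have hq : pairPattern (q.subset q.fst_mem) (q.subset q.snd_mem) = q :=
      eq_of_cls_eq hv.eq_pair.symm
        (Set.insert_subset q.fst_mem (Set.singleton_subset_iff.2 q.snd_mem)) (Or.inl rfl)
    have hpA : ∀ t (ht : t ∈ p.tiles), t = p.fst ∨
        pairCls (p.subset p.fst_mem) (p.subset ht) ∈ A := by
      intro t ht
      obtain ⟨x, x1, x2, -⟩ := cls_eq_iff.1 hp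
      have ht' : x +ᵥ t ∈ p₀.tiles := x1 ▸ Set.vadd_mem_vadd_set ht
      rcases hp₀A _ ht' with h | h
      · rw [← x2] at h
        exact Or.inl (AddAction.injective x h)
      · have e : pairCls (p.subset p.fst_mem) (p.subset ht) =
            pairCls (p₀.subset p₀.fst_mem) (p₀.subset ht') := pairCls_eq_iff.2 ⟨x, x2, rfl⟩
        exact Or.inr (e ▸ h)
    refine ⟨p.union q, rfl, hpairA, ?_⟩
    rintro t (ht | ht)
    · exact hpA t ht
    · have ht' : t ∈ ({q.fst, q.snd} : Set (Tile d δ)) :=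
        (congrArg PointedPattern.tiles hq).ge ht
      rcases ht' with rfl | rfl
      · exact hpA _ (hpq ▸ p.snd_mem)
      · exact Or.inr hpairA

end TilingGroupoid

namespace TilingGroupoid

open AlmostGroupoid Metric

variable {d : ℕ} {δ : Type w} {T : Tiling d δ}

/-! ## Finite local complexity -/

theorem finite_setOf_mul_eq {Γ : Type u} [AlmostGroupoid Γ] {A B : Set Γ} (hA : A.Finite)
    (hB : B.Finite) : {c | ∃ a ∈ A, ∃ b ∈ B, mul a b = some c}.Finite := by
  refine (hA.biUnion fun a _ => hB.biUnion fun b _ =>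
    Set.Subsingleton.finite (s := {c | mul a b = some c}) fun c hc c' hc' =>
      Option.some_injective _ (hc.symm.trans hc')).subset ?_
  rintro c ⟨a, ha, b, hb, h⟩
  exact Set.mem_biUnion ha (Set.mem_biUnion hb h)

/-- The classes of pairs of touching tiles. -/
def touchingPairs (T : Tiling d δ) : Set (PatternClass T) :=
  {c | ∃ (s t : Tile d δ) (hs : s ∈ T.tiles) (ht : t ∈ T.tiles),
    (s.carrier ∩ t.carrier).Nonempty ∧ pairCls hs ht = c}

/-- The classes of pairs of tiles that are linked by chains of `n` tiles. -/
def linkedPairs (T : Tiling d δ) (n : ℕ) : Set (PatternClass T) :=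
  {c | ∃ (s t : Tile d δ) (hs : s ∈ T.tiles) (ht : t ∈ T.tiles),
    T.Linked n s t ∧ pairCls hs ht = c}

/-- The products of `n + 1` classes of pairs of touching tiles. -/
def chainClasses (T : Tiling d δ) : ℕ → Set (PatternClass T)
  | 0 => touchingPairs T
  | n + 1 => {c | ∃ a ∈ chainClasses T n, ∃ b ∈ touchingPairs T, mul a b = some c}

/-- Finite type covers pairs of distinct tiles. A degenerate pair of equal tiles is the first tile
of such a pair, since every tile touches another one. -/
theorem Tiling.FiniteType.finite_touchingPairs (hT : T.FiniteType) : (touchingPairs T).Finite := by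
  refine (Set.Finite.union hT (Set.Finite.image (fun c : PatternClass T =>
    pairCls ((Quotient.out c).subset (Quotient.out c).fst_mem)
      ((Quotient.out c).subset (Quotient.out c).fst_mem)) hT)).subset ?_
  rintro _ ⟨s, t, hs, ht, h, rfl⟩
  by_cases hst : s = t
  · subst hst
    obtain ⟨t, ht, hne, h⟩ := hT.exists_touching hs
    refine Or.inr ⟨_, pairPattern_mem hs ht hne h, pairCls_eq_iff.2 ?_⟩
    obtain ⟨x, -, hx, -⟩ := cls_eq_iff.1 (show (Quotient.out (pairPattern hs ht).cls).cls =
      (pairPattern hs ht).cls from Quotient.out_eq _)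
    exact ⟨x, hx, hx⟩
  · exact Or.inl (pairPattern_mem hs ht hst h)

theorem Tiling.FiniteType.finite_linkedPairs (hT : T.FiniteType) (n : ℕ) :
    (linkedPairs T n).Finite := by
  induction n with
  | zero =>
    refine hT.finite_touchingPairs.subset ?_
    rintro _ ⟨s, t, hs, ht, ⟨-, rfl⟩, rfl⟩
    exact ⟨s, s, hs, ht, by simpa using s.nonempty, rfl⟩
  | succ n ih =>
    refine (ih.biUnion fun a _ => hT.finite_touchingPairs.biUnion fun b _ =>
      Set.Subsingleton.finite (s := {c | ∃ (s u t : Tile d δ) (hs : s ∈ T.tiles)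
        (hu : u ∈ T.tiles) (ht : t ∈ T.tiles), pairCls hs hu = a ∧ pairCls hu ht = b ∧
          pairCls hs ht = c}) ?_).subset ?_
    · rintro _ ⟨s, u, t, hs, hu, ht, h1, h2, rfl⟩ _ ⟨s', u', t', hs', hu', ht', h1', h2', rfl⟩
      obtain ⟨x, x1, x2⟩ := pairCls_eq_iff.1 (h1.trans h1'.symm)
      obtain ⟨y, y1, y2⟩ := pairCls_eq_iff.1 (h2.trans h2'.symm)
      have := eq_of_vadd_eq_vadd (x2.trans y1.symm)
      subst this
      exact pairCls_eq_iff.2 ⟨x, x1, y2⟩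
    · rintro _ ⟨s, t, hs, ht, ⟨u, hu, -, hut⟩, rfl⟩
      exact Set.mem_biUnion ⟨s, u, hs, hu.mem.2, hu, rfl⟩
        (Set.mem_biUnion ⟨u, t, hu.mem.2, ht, hut, rfl⟩ ⟨s, u, t, hs, hu.mem.2, ht, rfl, rfl, rfl⟩)

theorem Tiling.FiniteType.finite_chainClasses (hT : T.FiniteType) (n : ℕ) :
    (chainClasses T n).Finite := by
  induction n with
  | zero => exact hT.finite_touchingPairs
  | succ n ih => exact finite_setOf_mul_eq ih hT.finite_touchingPairs

theorem exists_list_of_mem_chainClasses {n : ℕ} {c : PatternClass T} (h : c ∈ chainClasses T n) :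
    ∃ l : List (PatternClass T), (∀ g ∈ l, g ∈ touchingPairs T) ∧ listProd l = some c := by
  induction n generalizing c with
  | zero => exact ⟨[c], List.forall_mem_singleton.2 h, rfl⟩
  | succ n ih =>
    obtain ⟨a, ha, b, hb, h⟩ := h
    obtain ⟨l, hl, hla⟩ := ih ha
    refine ⟨l ++ [b], fun g hg => ?_, (listProd_append_eq hla (listProd_singleton b)).trans h⟩
    rcases List.mem_append.1 hg with hg | hg
    · exact hl g hg
    · exact (List.mem_singleton.1 hg).symm ▸ hb

theorem Tiling.Linked.exists_mem_chainClasses {n : ℕ} {s t : Tile d δ} (h : T.Linked n s t) :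
    ∃ p : PointedPattern T, p.fst = s ∧ p.snd = t ∧ p.cls ∈ chainClasses T n := by
  induction n generalizing t with
  | zero =>
    obtain ⟨hs, rfl⟩ := h
    exact ⟨pairPattern hs hs, rfl, rfl, s, s, hs, hs, by simpa using s.nonempty, rfl⟩
  | succ n ih =>
    obtain ⟨u, hu, ht, hut⟩ := h
    obtain ⟨p, hps, hpu, hp⟩ := ih hu
    exact ⟨p.union (pairPattern hu.mem.2 ht), hps, rfl, p.cls, hp, _, ⟨u, t, hu.mem.2, ht, hut, rfl⟩,
      mul_cls hpu⟩

theorem IsTranslate.mem_fst_iff {x z : EuclideanSpace ℝ (Fin d)} {p q : PointedPattern T}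
    (h : IsTranslate x p q) : x + z ∈ q.fst.carrier ↔ z ∈ p.fst.carrier := by
  rw [← h.2.1]
  exact Tile.vadd_mem_iff

theorem IsTranslate.mem_snd_iff {x z : EuclideanSpace ℝ (Fin d)} {p q : PointedPattern T}
    (h : IsTranslate x p q) : x + z ∈ q.snd.carrier ↔ z ∈ p.snd.carrier := by
  rw [← h.2.2]
  exact Tile.vadd_mem_iff

/-- In every class below `c` the chosen tiles have the same relative position, so a chain of fixed
length `N` links them. One of the finitely many classes of such chains is then above `a`. -/
theorem Tiling.FiniteType.exists_generators (hT : T.FiniteType) (a : Grpd (PatternClass T)) :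
    ∃ (l : List (PatternClass T)) (w : PatternClass T),
      (∀ g ∈ l, g ∈ touchingPairs T) ∧ listProd l = some w ∧ a.Below w := by
  obtain ⟨c, hc⟩ := a.exists_below
  obtain ⟨p, rfl⟩ := exists_cls c
  obtain ⟨x, hx⟩ := p.fst.nonempty
  obtain ⟨y, hy⟩ := p.snd.nonempty
  obtain ⟨N, hN⟩ := hT.exists_linked (dist x y)
  obtain ⟨e, he, hae⟩ := Grpd.exists_below_of_finite (a := a) (isUnitary_patternClass T)
    (hT.finite_chainClasses N) fun z hz => by
      obtain ⟨z', -, hz'z, hz'p⟩ := hz.exists_le_le hc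
      obtain ⟨r, p', rfl, hp', -, hf, hs⟩ := exists_rep_of_le hz'p
      obtain ⟨v, hv⟩ := cls_eq_iff.1 hp'.symm
      obtain ⟨q, hqf, hqs, hq⟩ := (hN r.fst (r.subset r.fst_mem) r.snd (r.subset r.snd_mem)
        (v + x) (hf ▸ hv.mem_fst_iff.2 hx) (v + y) (hs ▸ hv.mem_snd_iff.2 hy)
        (by simp)).exists_mem_chainClasses
      refine ⟨q.cls, hq, (r.union q).cls, le_trans ?_ hz'z, ?_⟩
      · exact cls_le_of_subset Set.subset_union_left rfl hqs.symm
      · exact cls_le_of_subset Set.subset_union_right hqf rfl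
  obtain ⟨l, hl, hle⟩ := exists_list_of_mem_chainClasses he
  exact ⟨l, e, hl, hle, hae⟩

/-! ## Patterns that cover a neighbourhood of a tile -/

/-- The pattern `p` covers the `R`-neighbourhood of its first chosen tile. -/
def PointedPattern.Full (R : ℝ) (p : PointedPattern T) : Prop :=
  ∀ x ∈ p.fst.carrier, ∀ z, dist x z ≤ R → ∃ t ∈ p.tiles, z ∈ t.carrier

theorem PointedPattern.Full.of_cls_eq {R : ℝ} {p q : PointedPattern T} (h : p.Full R)
    (hpq : p.cls = q.cls) : q.Full R := by
  obtain ⟨v, hv⟩ := cls_eq_iff.1 hpq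
  intro x hx z hxz
  have hx' : -v + x ∈ p.fst.carrier := hv.symm.mem_fst_iff.2 hx
  obtain ⟨t, ht, hz⟩ := h _ hx' (-v + z) (by simpa using hxz)
  refine ⟨v +ᵥ t, hv.1 ▸ Set.vadd_mem_vadd_set ht, ?_⟩
  simpa using (Tile.vadd_mem_iff (x := v)).2 hz

/-- Every pattern is contained in all compatible ones that cover a large neighbourhood. -/
theorem exists_le_of_full (q : PointedPattern T) :
    ∃ n : ℕ, ∀ p : PointedPattern T, p.Full n → Compatible p.cls q.cls → p.cls ≤ q.cls := by
  obtain ⟨x, hx⟩ := q.fst.nonempty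
  choose z hz using fun t : Tile d δ => t.nonempty_interior
  obtain ⟨R, hR⟩ := (q.finite.image fun t => dist x (z t)).bddAbove
  obtain ⟨n, hn⟩ := exists_nat_ge R
  refine ⟨n, fun p hp => ?_⟩
  rintro ⟨c, hcp, hcq⟩
  obtain ⟨r, p', rfl, hp', hpr, hpf, hps⟩ := exists_rep_of_le hcp
  obtain ⟨q', hq', hqr, hqf, hqs⟩ := cls_le_iff.1 hcq
  obtain ⟨v, hv⟩ := cls_eq_iff.1 hq'.symm
  have hsub : q'.tiles ⊆ p'.tiles := by
    rw [← hv.1]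
    rintro _ ⟨t, ht, rfl⟩
    change v +ᵥ t ∈ p'.tiles
    have ht' : v +ᵥ t ∈ q'.tiles := hv.1 ▸ Set.vadd_mem_vadd_set ht
    have hx' : v + x ∈ p'.fst.carrier := by
      rw [hpf, ← hqf]
      exact hv.mem_fst_iff.2 hx
    obtain ⟨u, hu, hzu⟩ := hp.of_cls_eq hp'.symm (v + x) hx' (v + z t)
      (by rw [dist_add_left]; exact (hR ⟨t, ht, rfl⟩).trans hn)
    -- A covered interior point identifies its tile; boundary points would not.
    have hzi : v + z t ∈ interior (v +ᵥ t).carrier := by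
      rw [Tile.interior_vadd']
      exact Set.vadd_mem_vadd_set (hz t)
    rw [T.eq_of_mem_interior (r.subset (hqr ht')) (r.subset (hpr hu)) hzi hzu]
    exact hu
  rw [← hp', ← hq']
  exact cls_le_of_subset hsub (hqf.trans hpf.symm) (hqs.trans hps.symm)

/-- Decreasing sequences of patterns that cover larger and larger neighbourhoods of the first
chosen tile are approximating. -/
theorem isMin_of_full {s : DecSeq (PatternClass T)}
    (h : ∀ n : ℕ, ∃ m, ∃ p : PointedPattern T, p.cls = s.seq m ∧ p.Full n) : IsMin s.cls := by
  refine isMin_cls.2 fun y hy k => ?_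
  obtain ⟨q, hq⟩ := exists_cls (y.seq k)
  obtain ⟨n, hn⟩ := exists_le_of_full q
  obtain ⟨m, p, hp, hpn⟩ := h n
  obtain ⟨j, hj⟩ := hy m
  refine ⟨m, ?_⟩
  rw [← hp, ← hq]
  refine hn p hpn ⟨y.seq (max j k), ?_, ?_⟩
  · rw [hp]; exact (y.antitone (le_max_left _ _)).trans hj
  · rw [hq]; exact y.antitone (le_max_right _ _)

/-- If a property can be kept while passing to smaller classes that cover arbitrarily large
neighbourhoods, then there is an element of the groupoid all of whose neighbourhoods have it. -/
theorem exists_grpd_of_step {P : PatternClass T → Prop}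
    (step : ∀ c, P c → ∀ n : ℕ, ∃ p : PointedPattern T, p.Full n ∧ p.cls ≤ c ∧ P p.cls)
    {c : PatternClass T} (hc : P c) :
    ∃ a : Grpd (PatternClass T), a.Below c ∧ ∀ x, a.Below x → ∃ e ≤ x, P e := by
  choose g hg hgle hgP using fun (c : {c // P c}) (n : ℕ) => step c c.2 n
  let s : ℕ → {c // P c} := fun n =>
    Nat.rec (motive := fun _ => {c // P c}) ⟨c, hc⟩ (fun n c => ⟨_, hgP c n⟩) n
  have hs : Antitone fun n => (s n).1 :=
    antitone_nat_of_succ_le fun n => hgle (s n) n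
  have hmin : IsMin (DecSeq.cls ⟨fun n => (s n).1, hs⟩) :=
    -- The passage from stage `n` to `n + 1` produces a pattern full to radius `n`; nothing is known
    -- about stage `0`.
    isMin_of_full fun n => ⟨n + 1, g (s n) n, rfl, hg (s n) n⟩
  refine ⟨⟨_, hmin⟩, cls_le_constClass.2 ⟨0, le_rfl⟩, fun x hx => ?_⟩
  obtain ⟨m, hm⟩ := cls_le_constClass.1 hx
  exact ⟨s m, hm, (s m).2⟩

namespace Tiling.FiniteType

/-- The tiles that meet a neighbourhood of the first chosen tile can be added to a pattern. -/
theorem exists_full_extension (hT : T.FiniteType) (p : PointedPattern T) (R : ℝ) :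
    ∃ q : PointedPattern T, q.tiles = p.tiles ∪ {t ∈ T.tiles | ∃ x ∈ p.fst.carrier,
      ∃ z ∈ t.carrier, dist x z ≤ R} ∧ q.fst = p.fst ∧ q.snd = p.snd ∧ q.Full R := by
  obtain ⟨x, hx⟩ := p.fst.nonempty
  obtain ⟨D, hD⟩ := p.fst.isBounded.subset_closedBall x
  obtain ⟨N, hN⟩ := hT.exists_ncard_le (D + R)
  have hfin : {t ∈ T.tiles | ∃ x ∈ p.fst.carrier, ∃ z ∈ t.carrier, dist x z ≤ R}.Finite := by
    refine (hN x).1.subset ?_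
    rintro t ⟨ht, y, hy, z, hz, hyz⟩
    refine ⟨ht, z, hz, ?_⟩
    have := hD hy
    rw [mem_closedBall] at this ⊢
    linarith [dist_triangle_left z x y]
  refine ⟨⟨_, p.fst, p.snd, p.finite.union hfin, Set.union_subset p.subset fun t ht => ht.1,
    Or.inl p.fst_mem, Or.inl p.snd_mem⟩, rfl, rfl, rfl, fun y hy z hyz => ?_⟩
  obtain ⟨t, ht, hzt⟩ := T.exists_mem z
  exact ⟨t, Or.inr ⟨ht, y, hy, z, hzt, hyz⟩, hzt⟩

theorem exists_grpd_below (hT : T.FiniteType) (c : PatternClass T) :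
    ∃ a : Grpd (PatternClass T), a.Below c := by
  obtain ⟨a, ha, -⟩ := exists_grpd_of_step (P := fun _ : PatternClass T => True) (c := c)
    (fun c _ n => by
      obtain ⟨p, rfl⟩ := exists_cls c
      obtain ⟨q, hq, hf, hs, hfull⟩ := hT.exists_full_extension p n
      exact ⟨q, hfull, cls_le_of_subset (hq ▸ Set.subset_union_left) hf.symm hs.symm, trivial⟩)
    trivial
  exact ⟨a, ha⟩

/-- The classes below `c` are covered by finitely many classes of patterns which cover a given
neighbourhood. -/
theorem exists_finite_full_cover (hT : T.FiniteType) (c : PatternClass T) (R : ℝ) :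
    ∃ F : Set (PatternClass T), F.Finite ∧
      (∀ e ∈ F, ∃ q : PointedPattern T, q.cls = e ∧ q.Full R ∧ e ≤ c) ∧
      ∀ a : Grpd (PatternClass T), a.Below c → ∃ e ∈ F, a.Below e := by
  obtain ⟨p₀, rfl⟩ := exists_cls c
  obtain ⟨N, hN⟩ := hT.exists_linked R
  set F : Set (PatternClass T) := {e | ∃ p q : PointedPattern T, p.cls = p₀.cls ∧ q.cls = e ∧
    q.tiles = p.tiles ∪ {t ∈ T.tiles | ∃ x ∈ p.fst.carrier, ∃ z ∈ t.carrier, dist x z ≤ R} ∧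
    q.fst = p.fst ∧ q.snd = p.snd ∧ q.Full R} with hF
  set A : Set (PatternClass T) := {v | ∃ t, ∃ ht : t ∈ p₀.tiles,
    pairCls (p₀.subset p₀.fst_mem) (p₀.subset ht) = v}
  have hpA : ∀ p : PointedPattern T, p.cls = p₀.cls → ∀ t (ht : t ∈ p.tiles),
      pairCls (p.subset p.fst_mem) (p.subset ht) ∈ A := by
    intro p hp t ht
    obtain ⟨x, x1, x2, -⟩ := cls_eq_iff.1 hp
    have ht' : x +ᵥ t ∈ p₀.tiles := x1 ▸ Set.vadd_mem_vadd_set ht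
    refine ⟨x +ᵥ t, ht', (pairCls_eq_iff.2 ⟨x, x2, rfl⟩).symm⟩
  have hAf : (A ∪ linkedPairs T N).Finite :=
    (p₀.finite.dependent_image fun t ht =>
      pairCls (p₀.subset p₀.fst_mem) (p₀.subset ht)).union (hT.finite_linkedPairs N)
  have hFf : F.Finite := by
    -- A tile of the extension is either an old one, with position in `A`, or within distance `R` of
    -- the first chosen tile, hence linked to it by a chain of length `N`.
    refine (finite_localClasses hAf).subset ?_
    rintro _ ⟨p, q, hp, rfl, hq, hf, hs, -⟩
    have key : ∀ t (ht : t ∈ q.tiles),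
        pairCls (q.subset q.fst_mem) (q.subset ht) ∈ A ∪ linkedPairs T N := by
      intro t ht
      have h0 : ∀ ht' : t ∈ T.tiles, pairCls (q.subset q.fst_mem) (q.subset ht) =
          pairCls (p.subset p.fst_mem) ht' := fun ht' =>
        pairCls_eq_iff.2 ⟨0, by rw [zero_vadd, hf], zero_vadd _ _⟩
      rcases hq ▸ ht with h | ⟨htT, x, hx, z, hz, hxz⟩
      · rw [h0 (p.subset h)]
        exact Or.inl (hpA p hp t h)
      · rw [h0 htT]
        exact Or.inr ⟨_, _, _, _, hN p.fst (p.subset p.fst_mem) t htT x hx z hz hxz, rfl⟩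
    exact ⟨q, rfl, key _ q.snd_mem, fun t ht => Or.inr (key t ht)⟩
  refine ⟨F, hFf, ?_, fun a ha => ?_⟩
  · rintro _ ⟨p, q, hp, rfl, hq, hf, hs, hfull⟩
    refine ⟨q, rfl, hfull, ?_⟩
    rw [← hp]
    exact cls_le_of_subset (hq ▸ Set.subset_union_left) hf.symm hs.symm
  · refine Grpd.exists_below_of_finite (isUnitary_patternClass T) hFf fun z hz => ?_
    obtain ⟨z', -, hz'z, hz'p⟩ := hz.exists_le_le ha
    obtain ⟨r, p, rfl, hp, -, hpf, hps⟩ := exists_rep_of_le hz'p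
    obtain ⟨q, hq, hf, hs, hfull⟩ := hT.exists_full_extension p R
    refine ⟨q.cls, ⟨p, q, hp, rfl, hq, hf, hs, hfull⟩, (r.union q).cls, le_trans ?_ hz'z, ?_⟩
    · exact cls_le_of_subset Set.subset_union_left rfl (hps.symm.trans hs.symm)
    · exact cls_le_of_subset Set.subset_union_right (hf.trans hpf) rfl

/-- Compactness by König's argument: a class without a finite subcover has, among finitely many
smaller classes covering a larger neighbourhood, one without a finite subcover. The limit `a` lies
below some `c ∈ P`, so some class without a finite subcover is below `c`, yet `{c}` covers it. -/
theorem exists_finite_cover (hT : T.FiniteType) (g : PatternClass T) (P : Set (PatternClass T))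
    (hP : ∀ a : Grpd (PatternClass T), a.Below g → ∃ c ∈ P, a.Below c) :
    ∃ F ⊆ P, F.Finite ∧ ∀ a : Grpd (PatternClass T), a.Below g → ∃ c ∈ F, a.Below c := by
  by_contra hg
  obtain ⟨a, hag, ha⟩ := exists_grpd_of_step (P := fun c : PatternClass T => ¬ ∃ F ⊆ P,
    F.Finite ∧ ∀ a : Grpd (PatternClass T), a.Below c → ∃ c ∈ F, a.Below c) (c := g) (by
      intro c hc n
      obtain ⟨F, hF, hFfull, hFc⟩ := hT.exists_finite_full_cover c n
      by_contra hno
      have hcov : ∀ e ∈ F, ∃ F' ⊆ P, F'.Finite ∧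
          ∀ a : Grpd (PatternClass T), a.Below e → ∃ c ∈ F', a.Below c := by
        intro e he
        by_contra hne
        obtain ⟨q, rfl, hq, hqc⟩ := hFfull e he
        exact hno ⟨q, hq, hqc, hne⟩
      choose! F' hF'P hF' hF'c using hcov
      refine hc ⟨⋃ e ∈ F, F' e, Set.iUnion₂_subset hF'P, hF.biUnion hF', fun a ha => ?_⟩
      obtain ⟨e, he, hae⟩ := hFc a ha
      obtain ⟨c', hc', hac'⟩ := hF'c e he a hae
      exact ⟨c', Set.mem_biUnion he hc', hac'⟩) hg
  obtain ⟨c, hc, hac⟩ := hP a hag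
  obtain ⟨e, hec, he⟩ := ha c hac
  exact he ⟨{c}, Set.singleton_subset_iff.2 hc, Set.finite_singleton c, fun b hb =>
    ⟨c, rfl, hb.mono hec⟩⟩

theorem isPatternLike (hT : T.FiniteType) : IsPatternLike (PatternClass T) where
  unitary := isUnitary_patternClass T
  exists_grpd_below := hT.exists_grpd_below
  exists_finite_cover := hT.exists_finite_cover
  exists_generators := ⟨touchingPairs T, hT.finite_touchingPairs, hT.exists_generators⟩
  finite_left := finite_left_factors
  exists_primitive c := by
    obtain ⟨p, rfl⟩ := exists_cls c
    exact ⟨p.pair, isPrimitive_pairCls _ _, cls_le_pair p⟩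
  exists_primitive_list := exists_primitive_list_patternClass
  exists_finite_local := exists_finite_local_patternClass

end Tiling.FiniteType

end TilingGroupoid

/-! ### The main theorem. -/

theorem theorem17093 {d d' : ℕ} {δ : Type u} {δ' : Type v}
    (T : TilingGroupoid.Tiling d δ) (T' : TilingGroupoid.Tiling d' δ')
    (hT : T.FiniteType) (hT' : T'.FiniteType) :
    (TilingGroupoid.TopologicallyEquivalent
        (TilingGroupoid.PatternClass T) (TilingGroupoid.PatternClass T') ↔
      Nonempty (TilingGroupoid.GrpdIso
        (TilingGroupoid.PatternClass T) (TilingGroupoid.PatternClass T'))) ∧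
    ∀ f : TilingGroupoid.GrpdIso
        (TilingGroupoid.PatternClass T) (TilingGroupoid.PatternClass T'),
      ∃ R : TilingGroupoid.LocalDerivationRule
          (TilingGroupoid.PatternClass T) (TilingGroupoid.PatternClass T'),
        R.Induces f.toHomeo := by
  have h := hT.isPatternLike
  have h' := hT'.isPatternLike
  refine ⟨⟨fun e => e.nonempty_grpdIso h.unitary h'.unitary, fun ⟨f⟩ =>
    TilingGroupoid.topologicallyEquivalent_of_grpdIso h h' f⟩, fun f => ?_⟩
  obtain ⟨R, hR⟩ := TilingGroupoid.LocalDerivationRule.exists_represents_iso h h' f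
  exact ⟨R, TilingGroupoid.LocalDerivationRule.induces_of_represents hR⟩
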